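/- Let $G=(V,E)$ be a finite simple graph, $q\ge 2$ an integer and $\beta$ a real number. For a (not necessarily proper) coloring $\sigma\in[q]^{V}$ let $m(\sigma)$ be the number of monochromatic edges of $G$, i.e. edges both of whose endpoints get the same color. The $q$-state Potts partition function of $G$ is $$Z_G^q(\beta)=\sum_{\sigma\in[q]^{V}}e^{-\beta m(\sigma)},$$ the internal energy per particle is $$U_G^q(\beta)=-\frac1{|V|}\,\frac{d}{d\beta}\log Z_G^q(\beta),$$ and the free energy per particle is $F_G^q(\beta)=\frac1{|V|}\log Z_G^q(\beta)$. Theorem. Let $G$ be a finite simple cubic (i.e. $3$-regular) graph with non-empty vertex set, let $q\ge 2$ be an integer and let $\beta>0$ (the antiferromagnetic case). Then $$U_{K_{3,3}}^q(\beta)\le U_G^q(\beta)\le U_{K_4}^q(\beta).$$ Furthermore, $U_G^q(\beta)=U_{K_{3,3}}^q(\beta)$ if and only if $G$ is a vertex-disjoint union of copies of $K_{3,3}$, and $U_G^q(\beta)=U_{K_4}^q(\beta)$ if and only if $G$ is a vertex-disjoint union of copies of $K_4$. Moreover, $$F_{K_4}^q(\beta)\le F_G^q(\beta)\le F_{K_{3,3}}^q(\beta).$$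 -/

import Mathlib

namespace Potts

open Classical in
/-- The number `m(σ)` of monochromatic edges of the finite graph `G` under the (not necessarily
proper) coloring `σ` of its vertices with `q` colors. -/
noncomputable def monoEdges {V : Type*} [Fintype V] (G : SimpleGraph V) {q : ℕ}
    (σ : V → Fin q) : ℕ :=
  (G.edgeFinset.filter fun e => (e.map σ).IsDiag).card

open Classical in
/-- The `q`-color Potts model partition function `Z_G^q(β) = ∑_σ exp (-β m(σ))`. -/
noncomputable def partitionFunction {V : Type*} [Fintype V] (G : SimpleGraph V) (q : ℕ)
    (β : ℝ) : ℝ :=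
  ∑ σ : V → Fin q, Real.exp (-β * (monoEdges G σ : ℝ))

/-- The internal energy per particle `U_G^q(β) = -(1/|V|) d/dβ log Z_G^q(β)`. -/
noncomputable def internalEnergy {V : Type*} [Fintype V] (G : SimpleGraph V) (q : ℕ)
    (β : ℝ) : ℝ :=
  -(1 / (Fintype.card V : ℝ)) * deriv (fun t : ℝ => Real.log (partitionFunction G q t)) β

/-- The free energy per particle `F_G^q(β) = (1/|V|) log Z_G^q(β)`. -/
noncomputable def freeEnergy {V : Type*} [Fintype V] (G : SimpleGraph V) (q : ℕ)
    (β : ℝ) : ℝ :=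
  (1 / (Fintype.card V : ℝ)) * Real.log (partitionFunction G q β)

/-- The vertex-disjoint union of `n` copies of the graph `H`. -/
def disjointCopies {W : Type*} (n : ℕ) (H : SimpleGraph W) : SimpleGraph (Fin n × W) where
  Adj x y := x.1 = y.1 ∧ H.Adj x.2 y.2
  symm := ⟨fun _ _ h => ⟨h.1.symm, h.2.symm⟩⟩
  loopless := ⟨fun _ h => H.irrefl h.2⟩

/-- `G` is (isomorphic to) a vertex-disjoint union of finitely many copies of `H`. -/
def IsDisjointUnionOfCopies {V W : Type*} (G : SimpleGraph V) (H : SimpleGraph W) : Prop :=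
  ∃ n : ℕ, Nonempty (G ≃g disjointCopies n H)

/-- The complete bipartite graph `K_{3,3}`. -/
abbrev K33 : SimpleGraph (Fin 3 ⊕ Fin 3) := completeBipartiteGraph (Fin 3) (Fin 3)

/-- The complete graph `K_4`. -/
abbrev K4 : SimpleGraph (Fin 4) := ⊤

end Potts

set_option linter.all false

/-! Put l = e^{-β}, so that 0 < l < 1. The energy U is the Gibbs expectation of m(σ) divided by |V|,
hence a bound on U is a linear inequality for the Gibbs measure. Each bound comes from a local
functional whose expectation is nonnegative and which, summed over a cubic graph, becomes an affine
function of m(σ). To sign a local expectation, fix the colours outside a small vertex set and sum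
over the colours inside; the result must be nonnegative for every boundary colouring, which leaves
inequalities between polynomials in q and l.

Lower bound. The small set is a vertex with its three neighbours, and the functional `starEnergy`
combines the monochromatic edges at the root with those one step further out. If the neighbourhood
spans no edge, the three leaves are independent given the root colour c: leaf i contributes a weight
p_i(c) and a weighted functional f_i(c), and the quantity to sign is the sum over c of f_1 p_2 p_3 +
f_2 p_1 p_3 + f_3 p_1 p_2. The coefficients are tuned so that the sum over c of f_i p_i^2 vanishes
for each leaf separately; this is tightness for equal boundaries, as in K_{3,3}. Subtracting these
zeros leaves `surplus`, which is nonnegative colour by colour because f decreases as p increases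
(`surplus_pos_of_sorted`). The exception is a colour at which all f_i are positive: it has its own
estimate for q ≥ 4, is paid for by another colour if q = 3 (`sum_surplus_pos_of_zero_one`), and does
not occur for q = 2. If the neighbourhood spans an edge, the expectation is strictly positive:
`pairStarSum_pos`, `pathStarSum_pos`, `cliqueStarSum_pos`.

Upper bound. The small set is an edge, and the functional `edgeEnergy` is tuned to vanish in
expectation when both ends see the same boundary, as in K_4; `edgeSum_nonneg` gives the sign for all
boundaries.

Equality. Every boundary colouring has positive weight, so a single one with positive conditional
sum makes the inequality strict. Equality therefore means that neighbours of a common vertex have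
equal neighbourhoods (`Twinned`), respectively that adjacency is transitive between distinct
vertices (`Cluster`). Cubic graphs with these properties are the disjoint unions of K_{3,3} and of
K_4.

Free energy. All graphs have F(0) = log q, and F' = -U, so the energy bounds integrate to the
reverse bounds for F. -/

namespace Potts

/-! ### Coefficients of the lower bound functional -/

section Coefficients

variable (q l : ℝ)

/-- Weight of a leaf whose two outer neighbours both carry the colour of the centre. -/
noncomputable def wHigh : ℝ := q - 1 + l ^ 3

/-- Weight of a leaf that sees two different colours, one of them twice. -/
noncomputable def wMid : ℝ := q - 2 + l + l ^ 2

/-- Weight of a leaf that sees three different colours. -/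
noncomputable def wLow : ℝ := q - 3 + 3 * l

/-- A leaf takes four values, which depend linearly on the three unknowns `cA`, `cB`, `cD`; so they
obey one linear relation. It is `relN * fHigh - relW * fMidLoop - 2 * relW * fMidPair + relK * fLow
= 0`. -/
noncomputable def relN : ℝ := 2 * q - 3 + 3 * l

noncomputable def relW : ℝ := (q - 1) * (1 + l) + 2 * l ^ 2

noncomputable def relK : ℝ := (q - 1) * (1 + 3 * l) + 3 * l ^ 2 + l ^ 3

/-- Tightness for equal boundaries fixes the ratio `fHigh : fMidLoop` (outer colours equal) and the
ratio `fMidPair : fLow` (outer colours distinct), each up to a factor. The linear relation between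
the four values then fixes the quotient of these factors, `scaleLoop` and `scalePair`. -/
noncomputable def scaleLoop : ℝ :=
  2 * (relK q l * wMid q l ^ 2 + relW q l * (q - 2) * wLow q l ^ 2)

noncomputable def scalePair : ℝ :=
  relW q l * wHigh q l ^ 2 + relN q l * (q - 1) * wMid q l ^ 2

noncomputable def fHigh : ℝ := -((q - 1) * wMid q l ^ 2 * scaleLoop q l)

noncomputable def fMidLoop : ℝ := wHigh q l ^ 2 * scaleLoop q l

noncomputable def fMidPair : ℝ := -((q - 2) * wLow q l ^ 2 * scalePair q l)

noncomputable def fLow : ℝ := 2 * wMid q l ^ 2 * scalePair q l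

/-- The remaining unknown: given the four leaf values, it is the `cD / l` for which the linear
system for `cA`, `cB`, `cD` is solved. -/
noncomputable def gapD : ℝ :=
  2 * wMid q l ^ 2 * ((q - 1) * (1 + 2 * l) * wMid q l ^ 2 + l ^ 2 * wHigh q l ^ 2 +
    (q - 1) * (q - 2) * wLow q l ^ 2)

/-- Coefficient of the monochromatic edges at distance one from the root. -/
noncomputable def cB : ℝ := (fLow q l - fMidLoop q l - gapD q l * (1 - l)) / 2

/-- Equal to `cA + 2 * cB`, the combination that survives summation over all vertices of a cubic
graph. -/
noncomputable def cS : ℝ := (1 - l) * fLow q l + gapD q l * wLow q l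

/-- Coefficient of the monochromatic edges at the root. -/
noncomputable def cA : ℝ := cS q l - 2 * cB q l

/-- The constant of the lower bound. -/
noncomputable def cD : ℝ := l * gapD q l

end Coefficients

theorem cA_add_two_mul_cB (q l : ℝ) : cA q l + 2 * cB q l = cS q l := by
  unfold cA; ring

/-- This and the next three identities say that the coefficients solve the linear system: the left
sides are the functional of a single leaf in its four possible situations. `cB` and `cS` were read
off from `fMidLoop_eq` and `fLow_eq`, which hold for any `gapD`; the other two use its actual value.
-/
theorem fHigh_eq (q l : ℝ) :
    cA q l * l ^ 3 + cB q l * (2 * l ^ 3) - cD q l * wHigh q l = l * (1 - l) * fHigh q l := by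
  simp only [cA, cB, cS, cD, gapD, fHigh, fMidLoop, fLow, scaleLoop, scalePair, relN, relW,
    relK, wHigh, wMid, wLow]
  ring

theorem fMidLoop_eq (q l : ℝ) :
    cA q l * l + cB q l * (2 * l ^ 2) - cD q l * wMid q l = l * (1 - l) * fMidLoop q l := by
  simp only [cA, cB, cS, cD, wMid, wLow]
  ring

theorem fMidPair_eq (q l : ℝ) :
    cA q l * l ^ 2 + cB q l * (l + l ^ 2) - cD q l * wMid q l = l * (1 - l) * fMidPair q l := by
  simp only [cA, cB, cS, cD, gapD, fMidPair, fMidLoop, fLow, scaleLoop, scalePair, relN, relW,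
    relK, wHigh, wMid, wLow]
  ring

theorem fLow_eq (q l : ℝ) :
    cA q l * l + cB q l * (2 * l) - cD q l * wLow q l = l * (1 - l) * fLow q l := by
  simp only [cA, cB, cS, cD]
  ring

/-! ### Values of the functional when the neighbourhood of the root spans edges -/

/-- Expanded values of `pairW`, `pairF` (prefix `one`, one edge among the neighbours) and `pathF`
(prefix `path`, two edges). `Same` and `Diff` tell whether the two outer colours agree, `In` and
`Out` whether the root colour is one of them. -/
noncomputable def oneSameInW (q l : ℝ) : ℝ :=
  (1) * q ^ 2 + ((-3) + 1 * l + 2 * l ^ 2) * q + (2 + (-1) * l + (-2) * l ^ 2 + 1 * l ^ 5)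

noncomputable def oneSameInF (q l : ℝ) : ℝ :=
  cA q l * ((2 * l ^ 2) * q + ((-2) * l ^ 2 + 2 * l ^ 5)) +
    cB q l * ((2 * l + 2 * l ^ 2) * q + ((-2) * l + (-2) * l ^ 2 + 4 * l ^ 5)) -
    2 * cD q l *
      oneSameInW q l

noncomputable def oneSameOutW (q l : ℝ) : ℝ :=
  (1) * q ^ 2 + ((-5) + 5 * l) * q + (6 + (-10) * l + 2 * l ^ 2 + 2 * l ^ 3)

noncomputable def oneSameOutF (q l : ℝ) : ℝ :=
  cA q l * ((2 * l) * q + ((-4) * l + 2 * l ^ 2 + 2 * l ^ 3)) +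
    cB q l * ((4 * l) * q + ((-8) * l + 2 * l ^ 2 + 6 * l ^ 3)) -
    2 * cD q l *
      oneSameOutW q l

noncomputable def oneDiffInW (q l : ℝ) : ℝ :=
  (1) * q ^ 2 + ((-4) + 3 * l + 1 * l ^ 2) * q + (4 + (-5) * l + (-1) * l ^ 2 + 1 * l ^ 3 +
        1 * l ^ 4)

noncomputable def oneDiffInF (q l : ℝ) : ℝ :=
  cA q l * ((1 * l + 1 * l ^ 2) * q + ((-1) * l + (-2) * l ^ 2 + 1 * l ^ 3 + 2 * l ^ 4)) +
    cB q l * ((3 * l + 1 * l ^ 2) * q + ((-6) * l + 1 * l ^ 2 + 2 * l ^ 3 + 3 * l ^ 4)) -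
    2 * cD q l *
      oneDiffInW q l

noncomputable def oneDiffOutW (q l : ℝ) : ℝ :=
  (1) * q ^ 2 + ((-5) + 5 * l) * q + (7 + (-13) * l + 5 * l ^ 2 + 1 * l ^ 3)

noncomputable def oneDiffOutF (q l : ℝ) : ℝ :=
  cA q l * ((2 * l) * q + ((-4) * l + 2 * l ^ 2 + 2 * l ^ 3)) +
    cB q l * ((4 * l) * q + ((-12) * l + 10 * l ^ 2 + 2 * l ^ 3)) -
    2 * cD q l *
      oneDiffOutW q l

noncomputable def pathSameInF (q l : ℝ) : ℝ :=
  cA q l * ((1 * l + 2 * l ^ 2) * q ^ 2 + ((-2) * l + (-6) * l ^ 2 + 2 * l ^ 3 + 6 * l ^ 4) * q +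
        (1 * l + 4 * l ^ 2 + (-2) * l ^ 3 + (-6) * l ^ 4 + 3 * l ^ 7)) +
    cB q l * ((4 * l + 2 * l ^ 2) * q ^ 2 + ((-12) * l + (-2) * l ^ 2 + 6 * l ^ 3 +
        8 * l ^ 4) * q + (8 * l + (-6) * l ^ 3 + (-8) * l ^ 4 + 6 * l ^ 7)) -
    3 * cD q l *
      ((1) * q ^ 3 + ((-5) + 3 * l + 2 * l ^ 2) * q ^ 2 + (8 + (-8) * l + (-5) * l ^ 2 +
        2 * l ^ 3 + 3 * l ^ 4) * q + ((-4) + 5 * l + 3 * l ^ 2 + (-2) * l ^ 3 + (-3) * l ^ 4 +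
        1 * l ^ 7))

noncomputable def pathSameOutF (q l : ℝ) : ℝ :=
  cA q l * ((3 * l) * q ^ 2 + ((-12) * l + 8 * l ^ 2 + 4 * l ^ 3) * q + (12 * l + (-14) * l ^ 2 +
        (-5) * l ^ 3 + 4 * l ^ 4 + 3 * l ^ 5)) +
    cB q l * ((6 * l) * q ^ 2 + ((-30) * l + 26 * l ^ 2 + 4 * l ^ 3) * q + (36 * l +
        (-52) * l ^ 2 + 12 * l ^ 4 + 4 * l ^ 5)) -
    3 * cD q l *
      ((1) * q ^ 3 + ((-7) + 7 * l) * q ^ 2 + (17 + (-32) * l + 13 * l ^ 2 + 2 * l ^ 3) * q +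
        ((-14) + 36 * l + (-25) * l ^ 2 + (-1) * l ^ 3 + 3 * l ^ 4 + 1 * l ^ 5))

noncomputable def pathDiffInF (q l : ℝ) : ℝ :=
  cA q l * ((2 * l + 1 * l ^ 2) * q ^ 2 + ((-6) * l + (-2) * l ^ 2 + 6 * l ^ 3 + 2 * l ^ 4) * q +
        (4 * l + 2 * l ^ 2 + (-8) * l ^ 3 + (-3) * l ^ 4 + 2 * l ^ 5 + 3 * l ^ 6)) +
    cB q l * ((5 * l + 1 * l ^ 2) * q ^ 2 + ((-20) * l + 9 * l ^ 2 + 8 * l ^ 3 + 3 * l ^ 4) * q +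
        (20 * l + (-19) * l ^ 2 + (-8) * l ^ 3 + (-2) * l ^ 4 + 4 * l ^ 5 + 5 * l ^ 6)) -
    3 * cD q l *
      ((1) * q ^ 3 + ((-6) + 5 * l + 1 * l ^ 2) * q ^ 2 + (12 + (-18) * l + 1 * l ^ 2 +
        4 * l ^ 3 + 1 * l ^ 4) * q + ((-8) + 16 * l + (-4) * l ^ 2 + (-5) * l ^ 3 +
        (-1) * l ^ 4 + 1 * l ^ 5 + 1 * l ^ 6))

noncomputable def pathDiffOutF (q l : ℝ) : ℝ :=
  cA q l * ((3 * l) * q ^ 2 + ((-12) * l + 8 * l ^ 2 + 4 * l ^ 3) * q + (12 * l + (-14) * l ^ 2 +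
        (-5) * l ^ 3 + 4 * l ^ 4 + 3 * l ^ 5)) +
    cB q l * ((6 * l) * q ^ 2 + ((-30) * l + 26 * l ^ 2 + 4 * l ^ 3) * q + (42 * l +
        (-70) * l ^ 2 + 18 * l ^ 3 + 6 * l ^ 4 + 4 * l ^ 5)) -
    3 * cD q l *
      ((1) * q ^ 3 + ((-7) + 7 * l) * q ^ 2 + (17 + (-32) * l + 13 * l ^ 2 + 2 * l ^ 3) * q +
        ((-15) + 40 * l + (-31) * l ^ 2 + 3 * l ^ 3 + 2 * l ^ 4 + 1 * l ^ 5))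

noncomputable def cliqueF (q l : ℝ) : ℝ :=
  cA q l * ((3 * l) * q ^ 2 + ((-9) * l + 3 * l ^ 2 + 6 * l ^ 3) * q + (6 * l + (-3) * l ^ 2 +
        (-6) * l ^ 3 + 3 * l ^ 6)) +
    cB q l * ((6 * l) * q ^ 2 + ((-18) * l + 6 * l ^ 2 + 12 * l ^ 3) * q + (12 * l +
        (-6) * l ^ 2 + (-12) * l ^ 3 + 6 * l ^ 6)) -
    3 * cD q l *
      ((1) * q ^ 3 + ((-6) + 6 * l) * q ^ 2 + (11 + (-18) * l + 3 * l ^ 2 + 4 * l ^ 3) * q +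
        ((-6) + 12 * l + (-3) * l ^ 2 + (-4) * l ^ 3 + 1 * l ^ 6))

/-! ### Positivity certificates -/

/-- `∑ c, (A c * p c + B c * f c)` when `A`, `B` take the values `Ai`, `Bi` on a set of `n` colours,
`p`, `f` take the values `pi`, `fi` on a set of `m` colours, and the two sets share `r` colours. -/
def crossSum (q n m r Ai Ao Bi Bo pi po fi fo : ℝ) : ℝ :=
  q * (Ao * po + Bo * fo) + n * ((Ai - Ao) * po + (Bi - Bo) * fo) +
    m * (Ao * (pi - po) + Bo * (fi - fo)) + r * ((Ai - Ao) * (pi - po) + (Bi - Bo) * (fi - fo))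

/-- Here and below q is shifted to its least value plus k, and t = 1 - l; after powers of l and t
are pulled out, a polynomial in k, l, t with nonnegative coefficients remains. Negative coefficients
in l are removed by summation by parts: ∑ a_j l^j = A_n l^n + (1 - l) ∑_{j<n} A_j l^j with A_j the
partial sums. This explains the pairs of a pure power of l and a multiple of t. In the names, `same`
or `diff` refers to the outer colours of the two adjacent leaves, `loop` or `pair` to those of the
third leaf being equal or distinct, and `disjoint` or `overlap` to the extreme sizes of the
intersection of the two colour sets. -/
theorem crossSum_sameLoop_disjoint_pos (k : ℝ) (hk : 0 ≤ k) (l : ℝ) (hl : 0 < l) (hl1 : l < 1) :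
    0 < crossSum (k + 3) 1 1 0 (oneSameInF (k + 3) l) (oneSameOutF (k + 3) l) (oneSameInW (k +
        3) l)
      (oneSameOutW (k + 3) l) (wHigh (k + 3) l) (wMid (k + 3) l) (l * (1 - l) * fHigh (k + 3) l)
      (l * (1 - l) * fMidLoop (k + 3) l) := by
  obtain ⟨t, ht, htl⟩ : ∃ t : ℝ, 0 < t ∧ t = 1 - l := ⟨1 - l, by linarith, rfl⟩
  have key : crossSum (k + 3) 1 1 0 (oneSameInF (k + 3) l) (oneSameOutF (k +
        3) l) (oneSameInW (k + 3) l)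
      (oneSameOutW (k + 3) l) (wHigh (k + 3) l) (wMid (k + 3) l) (l * (1 - l) * fHigh (k + 3) l)
      (l * (1 - l) * fMidLoop (k + 3) l) =
      l ^ 1 * t ^ 2 * ((l ^ 17 * (52488)) +
      t * (200 + l * (1432 + l * (5496 + l * (14792 + l * (28964 + l * (44332 + l * (56412 +
        l * (62788 + l * (63960 + l * (61582 + l * (58070 + l * (55248 + l * (53620 +
        l * (52864 + l * (52580 + l * (52506 + l * (52490))))))))))))))))) +
      k * (l ^ 15 * (166212)) +
      k * t * (1212 + l * (7784 + l * (27384 + l * (65824 + l * (115774 + l * (160674 +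
        l * (187914 + l * (196182 + l * (191922 + l * (182388 + l * (174016 + l * (169182 +
        l * (167084 + l * (166394 + l * (166230))))))))))))))) +
      k ^ 2 * (l ^ 13 * (233280)) +
      k ^ 2 * t * (3240 + l * (18558 + l * (58794 + l * (125034 + l * (196250 + l * (246338 +
        l * (266078 + l * (264410 + l * (253694 + l * (242942 + l * (236606 + l * (234110 +
        l * (233402))))))))))))) +
      k ^ 3 * (l ^ 12 * (190512)) +
      k ^ 3 * t * (5022 + l * (25348 + l * (70914 + l * (132074 + l * (183878 + l * (209170 +
        l * (211652 + l * (204992 + l * (197308 + l * (192602 + l * (190906 +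
        l * (190534)))))))))))) +
      k ^ 4 * (l ^ 11 * (99792)) +
      k ^ 4 * t * (4976 + l * (21694 + l * (52494 + l * (84734 + l * (104334 + l * (108810 +
        l * (105998 + l * (102732 + l * (100596 + l * (99870 + l * (99794))))))))))) +
      k ^ 5 * (l ^ 9 * (34776)) +
      k ^ 5 * t * (3264 + l * (11936 + l * (24468 + l * (33898 + l * (37146 + l * (36528 +
        l * (35516 + l * (34966 + l * (34782))))))))) +
      k ^ 6 * (l ^ 7 * (8064)) +
      k ^ 6 * t * (1412 + l * (4162 + l * (7086 + l * (8382 + l * (8402 + l * (8160 +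
        l * (8092))))))) +
      k ^ 7 * (l ^ 6 * (1200)) +
      k ^ 7 * t * (386 + l * (870 + l * (1208 + l * (1240 + l * (1206 + l * (1202)))))) +
      k ^ 8 * (l ^ 3 * (104)) +
      k ^ 8 * t * (60 + l * (96 + l * (108))) +
      k ^ 9 * (4)) := by
    rw [htl]
    simp only [crossSum, oneSameInF, oneSameOutF, oneSameInW, oneSameOutW, cA, cB, cS, cD, gapD, fHigh, fMidLoop, fMidPair, fLow, scaleLoop, scalePair, relN, relW, relK, wHigh, wMid, wLow]
    ring
  rw [key]
  positivity

/-- The case q = 2 is certified apart, since the general certificate starts at q = 3. -/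
theorem crossSum_sameLoop_disjoint_two_pos (l : ℝ) (hl : 0 < l) (hl1 : l < 1) :
    0 < crossSum 2 1 1 0 (oneSameInF 2 l) (oneSameOutF 2 l) (oneSameInW 2 l)
      (oneSameOutW 2 l) (wHigh 2 l) (wMid 2 l) (l * (1 - l) * fHigh 2 l)
      (l * (1 - l) * fMidLoop 2 l) := by
  obtain ⟨t, ht, htl⟩ : ∃ t : ℝ, 0 < t ∧ t = 1 - l := ⟨1 - l, by linarith, rfl⟩
  have key : crossSum 2 1 1 0 (oneSameInF 2 l) (oneSameOutF 2 l) (oneSameInW 2 l)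
      (oneSameOutW 2 l) (wHigh 2 l) (wMid 2 l) (l * (1 - l) * fHigh 2 l)
      (l * (1 - l) * fMidLoop 2 l) =
      l ^ 4 * t ^ 2 * ((l ^ 14 * (1024)) +
      t * (6 + l * (46 + l * (166 + l * (398 + l * (754 + l * (1202 + l * (1592 + l * (1736 +
        l * (1622 + l * (1406 + l * (1218 + l * (1098 + l * (1042 + l * (1026))))))))))))))) := by
    rw [htl]
    simp only [crossSum, oneSameInF, oneSameOutF, oneSameInW, oneSameOutW, cA, cB, cS, cD, gapD, fHigh, fMidLoop, fMidPair, fLow, scaleLoop, scalePair, relN, relW, relK, wHigh, wMid, wLow]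
    ring
  rw [key]
  positivity

theorem crossSum_sameLoop_overlap_pos (k : ℝ) (hk : 0 ≤ k) (l : ℝ) (hl : 0 < l) (hl1 : l < 1) :
    0 < crossSum (k + 3) 1 1 1 (oneSameInF (k + 3) l) (oneSameOutF (k + 3) l) (oneSameInW (k +
        3) l)
      (oneSameOutW (k + 3) l) (wHigh (k + 3) l) (wMid (k + 3) l) (l * (1 - l) * fHigh (k + 3) l)
      (l * (1 - l) * fMidLoop (k + 3) l) := by
  obtain ⟨t, ht, htl⟩ : ∃ t : ℝ, 0 < t ∧ t = 1 - l := ⟨1 - l, by linarith, rfl⟩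
  have key : crossSum (k + 3) 1 1 1 (oneSameInF (k + 3) l) (oneSameOutF (k +
        3) l) (oneSameInW (k + 3) l)
      (oneSameOutW (k + 3) l) (wHigh (k + 3) l) (wMid (k + 3) l) (l * (1 - l) * fHigh (k + 3) l)
      (l * (1 - l) * fMidLoop (k + 3) l) =
      l ^ 1 * t ^ 2 * ((l ^ 15 * (52488)) +
      t * (96 + l * (832 + l * (2712 + l * (8360 + l * (17968 + l * (29408 + l * (39216 +
        l * (45612 + l * (49476 + l * (51408 + l * (52208 + l * (52536 + l * (52552 +
        l * (52508 + l * (52492))))))))))))))) +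
      k * (l ^ 15 * (166212)) +
      k * t * (680 + l * (4400 + l * (14656 + l * (39744 + l * (76328 + l * (112960 +
        l * (139080 + l * (153942 + l * (161898 + l * (165160 + l * (166108 + l * (166352 +
        l * (166284 + l * (166222 + l * (166214))))))))))))))) +
      k ^ 2 * (l ^ 13 * (233280)) +
      k ^ 2 * t * (1976 + l * (10520 + l * (34094 + l * (80818 + l * (138228 + l * (185016 +
        l * (212004 + l * (225540 + l * (231504 + l * (233140 + l * (233374 + l * (233350 +
        l * (233300))))))))))))) +
      k ^ 3 * (l ^ 12 * (190512)) +
      k ^ 3 * t * (3218 + l * (14812 + l * (44594 + l * (91854 + l * (139350 + l * (169208 +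
        l * (182742 + l * (188754 + l * (190490 + l * (190582 + l * (190550 +
        l * (190518)))))))))))) +
      k ^ 4 * (l ^ 10 * (99792)) +
      k ^ 4 * t * (3310 + l * (13374 + l * (35936 + l * (63876 + l * (85652 + l * (95224 +
        l * (98624 + l * (99856 + l * (99870 + l * (99798)))))))))) +
      k ^ 5 * (l ^ 9 * (34776)) +
      k ^ 5 * t * (2258 + l * (7922 + l * (18354 + l * (27910 + l * (33098 + l * (34376 +
        l * (34788 + l * (34832 + l * (34774))))))))) +
      k ^ 6 * (l ^ 7 * (8064)) +
      k ^ 6 * t * (1028 + l * (3032 + l * (5864 + l * (7564 + l * (8036 + l * (8060 +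
        l * (8080))))))) +
      k ^ 7 * (l ^ 6 * (1200)) +
      k ^ 7 * t * (302 + l * (708 + l * (1106 + l * (1210 + l * (1200 + l * (1202)))))) +
      k ^ 8 * (l ^ 3 * (104)) +
      k ^ 8 * t * (52 + l * (88 + l * (108))) +
      k ^ 9 * (4)) := by
    rw [htl]
    simp only [crossSum, oneSameInF, oneSameOutF, oneSameInW, oneSameOutW, cA, cB, cS, cD, gapD, fHigh, fMidLoop, fMidPair, fLow, scaleLoop, scalePair, relN, relW, relK, wHigh, wMid, wLow]
    ring
  rw [key]
  positivity

theorem crossSum_sameLoop_overlap_two_pos (l : ℝ) (hl : 0 < l) (hl1 : l < 1) :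
    0 < crossSum 2 1 1 1 (oneSameInF 2 l) (oneSameOutF 2 l) (oneSameInW 2 l)
      (oneSameOutW 2 l) (wHigh 2 l) (wMid 2 l) (l * (1 - l) * fHigh 2 l)
      (l * (1 - l) * fMidLoop 2 l) := by
  obtain ⟨t, ht, htl⟩ : ∃ t : ℝ, 0 < t ∧ t = 1 - l := ⟨1 - l, by linarith, rfl⟩
  have key : crossSum 2 1 1 1 (oneSameInF 2 l) (oneSameOutF 2 l) (oneSameInW 2 l)
      (oneSameOutW 2 l) (wHigh 2 l) (wMid 2 l) (l * (1 - l) * fHigh 2 l)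
      (l * (1 - l) * fMidLoop 2 l) =
      l ^ 5 * t ^ 2 * ((l ^ 11 * (1024)) +
      t * (8 + l * (62 + l * (214 + l * (444 + l * (652 + l * (792 + l * (904 + l * (996 +
        l * (1036 + l * (1034 + l * (1026)))))))))))) := by
    rw [htl]
    simp only [crossSum, oneSameInF, oneSameOutF, oneSameInW, oneSameOutW, cA, cB, cS, cD, gapD, fHigh, fMidLoop, fMidPair, fLow, scaleLoop, scalePair, relN, relW, relK, wHigh, wMid, wLow]
    ring
  rw [key]
  positivity

theorem crossSum_samePair_disjoint_pos (k : ℝ) (hk : 0 ≤ k) (l : ℝ) (hl : 0 < l) (hl1 : l < 1) :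
    0 < crossSum (k + 3) 1 2 0 (oneSameInF (k + 3) l) (oneSameOutF (k + 3) l) (oneSameInW (k +
        3) l)
      (oneSameOutW (k + 3) l) (wMid (k + 3) l) (wLow (k + 3) l) (l * (1 - l) * fMidPair (k + 3) l)
      (l * (1 - l) * fLow (k + 3) l) := by
  obtain ⟨t, ht, htl⟩ : ∃ t : ℝ, 0 < t ∧ t = 1 - l := ⟨1 - l, by linarith, rfl⟩
  have key : crossSum (k + 3) 1 2 0 (oneSameInF (k + 3) l) (oneSameOutF (k +
        3) l) (oneSameInW (k + 3) l)
      (oneSameOutW (k + 3) l) (wMid (k + 3) l) (wLow (k + 3) l) (l * (1 - l) * fMidPair (k + 3) l)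
      (l * (1 - l) * fLow (k + 3) l) =
      l ^ 1 * t ^ 2 * ((l ^ 16 * (52488)) +
      t * (168 + l * (1216 + l * (5104 + l * (12388 + l * (23516 + l * (36140 + l * (47108 +
        l * (54096 + l * (56616 + l * (56520 + l * (55184 + l * (53744 + l * (52940 +
        l * (52612 + l * (52516 + l * (52492)))))))))))))))) +
      k * (l ^ 15 * (166212)) +
      k * t * (1016 + l * (7004 + l * (25160 + l * (55702 + l * (95854 + l * (134410 +
        l * (161754 + l * (174228 + l * (175776 + l * (173140 + l * (169672 + l * (167338 +
        l * (166478 + l * (166250 + l * (166214))))))))))))))) +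
      k ^ 2 * (l ^ 13 * (233280)) +
      k ^ 2 * t * (2770 + l * (17326 + l * (53692 + l * (106934 + l * (165620 + l * (211694 +
        l * (236456 + l * (242642 + l * (240602 + l * (237136 + l * (234508 + l * (233488 +
        l * (233292))))))))))))) +
      k ^ 3 * (l ^ 11 * (190512)) +
      k ^ 3 * t * (4420 + l * (24224 + l * (64542 + l * (114110 + l * (158406 + l * (185358 +
        l * (194762 + l * (194658 + l * (192738 + l * (191230 + l * (190576))))))))))) +
      k ^ 4 * (l ^ 10 * (99792)) +
      k ^ 4 * t * (4518 + l * (21040 + l * (47630 + l * (74026 + l * (92234 + l * (100038 +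
        l * (101090 + l * (100494 + l * (100012 + l * (99798)))))))))) +
      k ^ 5 * (l ^ 8 * (34776)) +
      k ^ 5 * t * (3054 + l * (11670 + l * (22110 + l * (30118 + l * (34022 + l * (34974 +
        l * (34874 + l * (34810)))))))) +
      k ^ 6 * (l ^ 7 * (8064)) +
      k ^ 6 * t * (1358 + l * (4072 + l * (6390 + l * (7680 + l * (8046 + l * (8068 +
        l * (8066))))))) +
      k ^ 7 * (380 + l * (464 + l * (260 + l * (88 + l * (8))))) +
      k ^ 8 * (60 + l * (32 + l * (12))) +
      k ^ 9 * (4)) := by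
    rw [htl]
    simp only [crossSum, oneSameInF, oneSameOutF, oneSameInW, oneSameOutW, cA, cB, cS, cD, gapD, fHigh, fMidLoop, fMidPair, fLow, scaleLoop, scalePair, relN, relW, relK, wHigh, wMid, wLow]
    ring
  rw [key]
  positivity

theorem crossSum_samePair_disjoint_two_pos (l : ℝ) (hl : 0 < l) (hl1 : l < 1) :
    0 < crossSum 2 1 2 0 (oneSameInF 2 l) (oneSameOutF 2 l) (oneSameInW 2 l)
      (oneSameOutW 2 l) (wMid 2 l) (wLow 2 l) (l * (1 - l) * fMidPair 2 l)
      (l * (1 - l) * fLow 2 l) := by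
  obtain ⟨t, ht, htl⟩ : ∃ t : ℝ, 0 < t ∧ t = 1 - l := ⟨1 - l, by linarith, rfl⟩
  have key : crossSum 2 1 2 0 (oneSameInF 2 l) (oneSameOutF 2 l) (oneSameInW 2 l)
      (oneSameOutW 2 l) (wMid 2 l) (wLow 2 l) (l * (1 - l) * fMidPair 2 l)
      (l * (1 - l) * fLow 2 l) =
      l ^ 4 * t ^ 2 * ((l ^ 13 * (1024)) +
      t * (6 + l * (34 + l * (98 + l * (230 + l * (500 + l * (904 + l * (1272 + l * (1424 +
        l * (1362 + l * (1222 + l * (1110 + l * (1050 + l * (1028)))))))))))))) := by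
    rw [htl]
    simp only [crossSum, oneSameInF, oneSameOutF, oneSameInW, oneSameOutW, cA, cB, cS, cD, gapD, fHigh, fMidLoop, fMidPair, fLow, scaleLoop, scalePair, relN, relW, relK, wHigh, wMid, wLow]
    ring
  rw [key]
  positivity

theorem crossSum_samePair_overlap_pos (k : ℝ) (hk : 0 ≤ k) (l : ℝ) (hl : 0 < l) (hl1 : l < 1) :
    0 < crossSum (k + 3) 1 2 1 (oneSameInF (k + 3) l) (oneSameOutF (k + 3) l) (oneSameInW (k +
        3) l)
      (oneSameOutW (k + 3) l) (wMid (k + 3) l) (wLow (k + 3) l) (l * (1 - l) * fMidPair (k + 3) l)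
      (l * (1 - l) * fLow (k + 3) l) := by
  obtain ⟨t, ht, htl⟩ : ∃ t : ℝ, 0 < t ∧ t = 1 - l := ⟨1 - l, by linarith, rfl⟩
  have key : crossSum (k + 3) 1 2 1 (oneSameInF (k + 3) l) (oneSameOutF (k +
        3) l) (oneSameInW (k + 3) l)
      (oneSameOutW (k + 3) l) (wMid (k + 3) l) (wLow (k + 3) l) (l * (1 - l) * fMidPair (k + 3) l)
      (l * (1 - l) * fLow (k + 3) l) =
      l ^ 1 * t ^ 2 * ((l ^ 15 * (52488)) +
      t * (56 + l * (724 + l * (2952 + l * (8106 + l * (16810 + l * (27752 + l * (38148 +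
        l * (45828 + l * (50448 + l * (52684 + l * (53252 + l * (52980 + l * (52638 +
        l * (52514 + l * (52492))))))))))))))) +
      k * (l ^ 14 * (166212)) +
      k * t * (432 + l * (4278 + l * (15612 + l * (39015 + l * (72887 + l * (109128 +
        l * (138054 + l * (155778 + l * (164532 + l * (167502 + l * (167442 + l * (166677 +
        l * (166269 + l * (166210)))))))))))))) +
      k ^ 2 * (l ^ 13 * (233280)) +
      k ^ 2 * t * (1382 + l * (10988 + l * (35802 + l * (80153 + l * (133897 + l * (181666 +
        l * (212662 + l * (227812 + l * (233602 + l * (234476 + l * (233804 + l * (233353 +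
        l * (233267))))))))))))) +
      k ^ 3 * (l ^ 12 * (190512)) +
      k ^ 3 * t * (2470 + l * (16117 + l * (46381 + l * (91576 + l * (136076 + l * (167792 +
        l * (183718 + l * (189590 + l * (191078 + l * (190821 + l * (190549 +
        l * (190504)))))))))))) +
      k ^ 4 * (l ^ 11 * (99792)) +
      k ^ 4 * t * (2760 + l * (14837 + l * (37043 + l * (63584 + l * (83940 + l * (94930 +
        l * (98866 + l * (99854 + l * (99912 + l * (99795 + l * (99791))))))))))) +
      k ^ 5 * (l ^ 8 * (34776)) +
      k ^ 5 * t * (2018 + l * (8826 + l * (18682 + l * (27576 + l * (32534 + l * (34352 +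
        l * (34750 + l * (34798)))))))) +
      k ^ 6 * (l ^ 7 * (8064)) +
      k ^ 6 * t * (970 + l * (3350 + l * (5858 + l * (7410 + l * (7954 + l * (8056 +
        l * (8066))))))) +
      k ^ 7 * (296 + l * (470 + l * (314 + l * (106 + l * (14))))) +
      k ^ 8 * (52 + l * (40 + l * (12))) +
      k ^ 9 * (4)) := by
    rw [htl]
    simp only [crossSum, oneSameInF, oneSameOutF, oneSameInW, oneSameOutW, cA, cB, cS, cD, gapD, fHigh, fMidLoop, fMidPair, fLow, scaleLoop, scalePair, relN, relW, relK, wHigh, wMid, wLow]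
    ring
  rw [key]
  positivity

theorem crossSum_samePair_overlap_two_pos (l : ℝ) (hl : 0 < l) (hl1 : l < 1) :
    0 < crossSum 2 1 2 1 (oneSameInF 2 l) (oneSameOutF 2 l) (oneSameInW 2 l)
      (oneSameOutW 2 l) (wMid 2 l) (wLow 2 l) (l * (1 - l) * fMidPair 2 l)
      (l * (1 - l) * fLow 2 l) := by
  obtain ⟨t, ht, htl⟩ : ∃ t : ℝ, 0 < t ∧ t = 1 - l := ⟨1 - l, by linarith, rfl⟩
  have key : crossSum 2 1 2 1 (oneSameInF 2 l) (oneSameOutF 2 l) (oneSameInW 2 l)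
      (oneSameOutW 2 l) (wMid 2 l) (wLow 2 l) (l * (1 - l) * fMidPair 2 l)
      (l * (1 - l) * fLow 2 l) =
      l ^ 5 * t ^ 2 * ((l ^ 11 * (1024)) +
      t * (4 + l * (32 + l * (120 + l * (292 + l * (540 + l * (820 + l * (1044 + l * (1132 +
        l * (1104 + l * (1052 + l * (1028)))))))))))) := by
    rw [htl]
    simp only [crossSum, oneSameInF, oneSameOutF, oneSameInW, oneSameOutW, cA, cB, cS, cD, gapD, fHigh, fMidLoop, fMidPair, fLow, scaleLoop, scalePair, relN, relW, relK, wHigh, wMid, wLow]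
    ring
  rw [key]
  positivity

theorem crossSum_diffLoop_disjoint_pos (k : ℝ) (hk : 0 ≤ k) (l : ℝ) (hl : 0 < l) (hl1 : l < 1) :
    0 < crossSum (k + 3) 2 1 0 (oneDiffInF (k + 3) l) (oneDiffOutF (k + 3) l) (oneDiffInW (k +
        3) l)
      (oneDiffOutW (k + 3) l) (wHigh (k + 3) l) (wMid (k + 3) l) (l * (1 - l) * fHigh (k + 3) l)
      (l * (1 - l) * fMidLoop (k + 3) l) := by
  obtain ⟨t, ht, htl⟩ : ∃ t : ℝ, 0 < t ∧ t = 1 - l := ⟨1 - l, by linarith, rfl⟩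
  have key : crossSum (k + 3) 2 1 0 (oneDiffInF (k + 3) l) (oneDiffOutF (k +
        3) l) (oneDiffInW (k + 3) l)
      (oneDiffOutW (k + 3) l) (wHigh (k + 3) l) (wMid (k + 3) l) (l * (1 - l) * fHigh (k + 3) l)
      (l * (1 - l) * fMidLoop (k + 3) l) =
      l ^ 1 * t ^ 2 * ((l ^ 16 * (52488)) +
      t * (176 + l * (1448 + l * (6552 + l * (17568 + l * (33524 + l * (50248 + l * (62516 +
        l * (67716 + l * (66408 + l * (61864 + l * (57472 + l * (54624 + l * (53244 +
        l * (52708 + l * (52532 + l * (52492)))))))))))))))) +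
      k * (l ^ 15 * (166212)) +
      k * t * (1036 + l * (8208 + l * (32056 + l * (76300 + l * (131238 + l * (178096 +
        l * (202950 + l * (205182 + l * (194022 + l * (181100 + l * (172404 + l * (168170 +
        l * (166688 + l * (166284 + l * (166214))))))))))))))) +
      k ^ 2 * (l ^ 13 * (233280)) +
      k ^ 2 * t * (2794 + l * (20066 + l * (67510 + l * (141886 + l * (217774 + l * (266326 +
        l * (279418 + l * (269002 + l * (252748 + l * (241092 + l * (235496 + l * (233676 +
        l * (233316))))))))))))) +
      k ^ 3 * (l ^ 12 * (190512)) +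
      k ^ 3 * t * (4456 + l * (27738 + l * (79924 + l * (146852 + l * (199256 + l * (220036 +
        l * (216422 + l * (204914 + l * (196132 + l * (191926 + l * (190658 +
        l * (190518)))))))))))) +
      k ^ 4 * (l ^ 10 * (99792)) +
      k ^ 4 * t * (4568 + l * (23808 + l * (58102 + l * (92154 + l * (110046 + l * (111466 +
        l * (106350 + l * (102270 + l * (100342 + l * (99814)))))))))) +
      k ^ 5 * (l ^ 8 * (34776)) +
      k ^ 5 * t * (3092 + l * (13058 + l * (26558 + l * (35928 + l * (38092 + l * (36718 +
        l * (35410 + l * (34920)))))))) +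
      k ^ 6 * (l ^ 7 * (8064)) +
      k ^ 6 * t * (1372 + l * (4516 + l * (7512 + l * (8628 + l * (8436 + l * (8152 +
        l * (8088))))))) +
      k ^ 7 * (l ^ 6 * (1200)) +
      k ^ 7 * t * (382 + l * (930 + l * (1244 + l * (1244 + l * (1206 + l * (1202)))))) +
      k ^ 8 * (l ^ 3 * (104)) +
      k ^ 8 * t * (60 + l * (100 + l * (108))) +
      k ^ 9 * (4)) := by
    rw [htl]
    simp only [crossSum, oneDiffInF, oneDiffOutF, oneDiffInW, oneDiffOutW, cA, cB, cS, cD, gapD, fHigh, fMidLoop, fMidPair, fLow, scaleLoop, scalePair, relN, relW, relK, wHigh, wMid, wLow]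
    ring
  rw [key]
  positivity

theorem crossSum_diffLoop_overlap_pos (k : ℝ) (hk : 0 ≤ k) (l : ℝ) (hl : 0 < l) (hl1 : l < 1) :
    0 < crossSum (k + 3) 2 1 1 (oneDiffInF (k + 3) l) (oneDiffOutF (k + 3) l) (oneDiffInW (k +
        3) l)
      (oneDiffOutW (k + 3) l) (wHigh (k + 3) l) (wMid (k + 3) l) (l * (1 - l) * fHigh (k + 3) l)
      (l * (1 - l) * fMidLoop (k + 3) l) := by
  obtain ⟨t, ht, htl⟩ : ∃ t : ℝ, 0 < t ∧ t = 1 - l := ⟨1 - l, by linarith, rfl⟩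
  have key : crossSum (k + 3) 2 1 1 (oneDiffInF (k + 3) l) (oneDiffOutF (k +
        3) l) (oneDiffInW (k + 3) l)
      (oneDiffOutW (k + 3) l) (wHigh (k + 3) l) (wMid (k + 3) l) (l * (1 - l) * fHigh (k + 3) l)
      (l * (1 - l) * fMidLoop (k + 3) l) =
      l ^ 1 * t ^ 2 * ((l ^ 16 * (52488)) +
      t * (188 + l * (1376 + l * (5774 + l * (14994 + l * (28438 + l * (42220 + l * (52492 +
        l * (57684 + l * (58638 + l * (57292 + l * (55282 + l * (53728 + l * (52908 +
        l * (52592 + l * (52508 + l * (52490)))))))))))))))) +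
      k * (l ^ 15 * (166212)) +
      k * t * (1046 + l * (7492 + l * (27699 + l * (64871 + l * (111261 + l * (150982 +
        l * (174330 + l * (181794 + l * (179808 + l * (174550 + l * (169871 + l * (167361 +
        l * (166459 + l * (166242 + l * (166214))))))))))))))) +
      k ^ 2 * (l ^ 13 * (233280)) +
      k ^ 2 * t * (2682 + l * (17800 + l * (57734 + l * (120815 + l * (186129 + l * (230568 +
        l * (248802 + l * (249684 + l * (244044 + l * (238104 + l * (234644 + l * (233509 +
        l * (233293))))))))))))) +
      k ^ 3 * (l ^ 12 * (190512)) +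
      k ^ 3 * t * (4115 + l * (24161 + l * (68250 + l * (126200 + l * (173684 + l * (197056 +
        l * (201476 + l * (198284 + l * (194155 + l * (191469 + l * (190608 +
        l * (190510)))))))))))) +
      k ^ 4 * (l ^ 11 * (99792)) +
      k ^ 4 * t * (4112 + l * (20565 + l * (50041 + l * (80768 + l * (99120 + l * (104216 +
        l * (103236 + l * (101464 + l * (100236 + l * (99803 + l * (99791))))))))))) +
      k ^ 5 * (l ^ 9 * (34776)) +
      k ^ 5 * t * (2747 + l * (11310 + l * (23352 + l * (32518 + l * (35832 + l * (35776 +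
        l * (35238 + l * (34908 + l * (34775))))))))) +
      k ^ 6 * (l ^ 7 * (8064)) +
      k ^ 6 * t * (1218 + l * (3978 + l * (6836 + l * (8160 + l * (8274 + l * (8134 +
        l * (8088))))))) +
      k ^ 7 * (l ^ 6 * (1200)) +
      k ^ 7 * t * (344 + l * (848 + l * (1186 + l * (1230 + l * (1206 + l * (1202)))))) +
      k ^ 8 * (l ^ 3 * (104)) +
      k ^ 8 * t * (56 + l * (96 + l * (108))) +
      k ^ 9 * (4)) := by
    rw [htl]
    simp only [crossSum, oneDiffInF, oneDiffOutF, oneDiffInW, oneDiffOutW, cA, cB, cS, cD, gapD, fHigh, fMidLoop, fMidPair, fLow, scaleLoop, scalePair, relN, relW, relK, wHigh, wMid, wLow]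
    ring
  rw [key]
  positivity

theorem crossSum_diffLoop_overlap_two_pos (l : ℝ) (hl : 0 < l) (hl1 : l < 1) :
    0 < crossSum 2 2 1 1 (oneDiffInF 2 l) (oneDiffOutF 2 l) (oneDiffInW 2 l)
      (oneDiffOutW 2 l) (wHigh 2 l) (wMid 2 l) (l * (1 - l) * fHigh 2 l)
      (l * (1 - l) * fMidLoop 2 l) := by
  obtain ⟨t, ht, htl⟩ : ∃ t : ℝ, 0 < t ∧ t = 1 - l := ⟨1 - l, by linarith, rfl⟩
  have key : crossSum 2 2 1 1 (oneDiffInF 2 l) (oneDiffOutF 2 l) (oneDiffInW 2 l)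
      (oneDiffOutW 2 l) (wHigh 2 l) (wMid 2 l) (l * (1 - l) * fHigh 2 l)
      (l * (1 - l) * fMidLoop 2 l) =
      l ^ 3 * t ^ 2 * ((l ^ 14 * (1024)) +
      t * (2 + l * (18 + l * (78 + l * (222 + l * (474 + l * (810 + l * (1144 + l * (1368 +
        l * (1426 + l * (1346 + l * (1210 + l * (1098 + l * (1042 + l * (1026))))))))))))))) := by
    rw [htl]
    simp only [crossSum, oneDiffInF, oneDiffOutF, oneDiffInW, oneDiffOutW, cA, cB, cS, cD, gapD, fHigh, fMidLoop, fMidPair, fLow, scaleLoop, scalePair, relN, relW, relK, wHigh, wMid, wLow]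
    ring
  rw [key]
  positivity

theorem crossSum_diffPair_disjoint_pos (k : ℝ) (hk : 0 ≤ k) (l : ℝ) (hl : 0 < l) (hl1 : l < 1) :
    0 < crossSum (k + 3) 2 2 0 (oneDiffInF (k + 3) l) (oneDiffOutF (k + 3) l) (oneDiffInW (k +
        3) l)
      (oneDiffOutW (k + 3) l) (wMid (k + 3) l) (wLow (k + 3) l) (l * (1 - l) * fMidPair (k + 3) l)
      (l * (1 - l) * fLow (k + 3) l) := by
  obtain ⟨t, ht, htl⟩ : ∃ t : ℝ, 0 < t ∧ t = 1 - l := ⟨1 - l, by linarith, rfl⟩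
  have key : crossSum (k + 3) 2 2 0 (oneDiffInF (k + 3) l) (oneDiffOutF (k +
        3) l) (oneDiffInW (k + 3) l)
      (oneDiffOutW (k + 3) l) (wMid (k + 3) l) (wLow (k + 3) l) (l * (1 - l) * fMidPair (k + 3) l)
      (l * (1 - l) * fLow (k + 3) l) =
      l ^ 1 * t ^ 2 * ((l ^ 15 * (52488)) +
      t * (92 + l * (1124 + l * (5396 + l * (14716 + l * (28672 + l * (43348 + l * (54156 +
        l * (58908 + l * (58476 + l * (56152 + l * (54112 + l * (53152 + l * (52760 +
        l * (52556 + l * (52496))))))))))))))) +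
      k * (l ^ 14 * (166212)) +
      k * t * (686 + l * (6814 + l * (27406 + l * (66058 + l * (114340 + l * (155334 +
        l * (177390 + l * (181482 + l * (176328 + l * (170764 + l * (167804 + l * (166784 +
        l * (166358 + l * (166220)))))))))))))) +
      k ^ 2 * (l ^ 13 * (233280)) +
      k ^ 2 * t * (2152 + l * (17438 + l * (59666 + l * (125570 + l * (191830 + l * (234106 +
        l * (248008 + l * (245074 + l * (238660 + l * (234900 + l * (233726 + l * (233396 +
        l * (233282))))))))))))) +
      k ^ 3 * (l ^ 11 * (190512)) +
      k ^ 3 * t * (3764 + l * (24996 + l * (72492 + l * (131474 + l * (176670 + l * (195858 +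
        l * (197654 + l * (193950 + l * (191406 + l * (190638 + l * (190554))))))))))) +
      k ^ 4 * (l ^ 10 * (99792)) +
      k ^ 4 * t * (4088 + l * (22128 + l * (53514 + l * (82842 + l * (98470 + l * (101854 +
        l * (101038 + l * (100046 + l * (99782 + l * (99798)))))))))) +
      k ^ 5 * (l ^ 8 * (34776)) +
      k ^ 5 * t * (2880 + l * (12436 + l * (24552 + l * (32420 + l * (34856 + l * (34968 +
        l * (34804 + l * (34764)))))))) +
      k ^ 6 * (l ^ 7 * (8064)) +
      k ^ 6 * t * (1318 + l * (4364 + l * (6914 + l * (7920 + l * (8046 + l * (8064 +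
        l * (8062))))))) +
      k ^ 7 * (376 + l * (524 + l * (248 + l * (44 + l * (8))))) +
      k ^ 8 * (60 + l * (36 + l * (8))) +
      k ^ 9 * (4)) := by
    rw [htl]
    simp only [crossSum, oneDiffInF, oneDiffOutF, oneDiffInW, oneDiffOutW, cA, cB, cS, cD, gapD, fHigh, fMidLoop, fMidPair, fLow, scaleLoop, scalePair, relN, relW, relK, wHigh, wMid, wLow]
    ring
  rw [key]
  positivity

theorem crossSum_diffPair_overlap_pos (k : ℝ) (hk : 0 ≤ k) (l : ℝ) (hl : 0 < l) (hl1 : l < 1) :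
    0 < crossSum (k + 3) 2 2 2 (oneDiffInF (k + 3) l) (oneDiffOutF (k + 3) l) (oneDiffInW (k +
        3) l)
      (oneDiffOutW (k + 3) l) (wMid (k + 3) l) (wLow (k + 3) l) (l * (1 - l) * fMidPair (k + 3) l)
      (l * (1 - l) * fLow (k + 3) l) := by
  obtain ⟨t, ht, htl⟩ : ∃ t : ℝ, 0 < t ∧ t = 1 - l := ⟨1 - l, by linarith, rfl⟩
  have key : crossSum (k + 3) 2 2 2 (oneDiffInF (k + 3) l) (oneDiffOutF (k +
        3) l) (oneDiffInW (k + 3) l)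
      (oneDiffOutW (k + 3) l) (wMid (k + 3) l) (wLow (k + 3) l) (l * (1 - l) * fMidPair (k + 3) l)
      (l * (1 - l) * fLow (k + 3) l) =
      l ^ 1 * t ^ 2 * ((l ^ 14 * (52488)) +
      t * (116 + l * (940 + l * (4016 + l * (11244 + l * (21976 + l * (33708 + l * (43404 +
        l * (49572 + l * (52512 + l * (53092 + l * (52892 + l * (52648 + l * (52524 +
        l * (52496)))))))))))))) +
      k * (l ^ 14 * (166212)) +
      k * t * (698 + l * (5282 + l * (20520 + l * (50714 + l * (89312 + l * (125106 +
        l * (149910 + l * (162798 + l * (167100 + l * (167056 + l * (166558 + l * (166308 +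
        l * (166222 + l * (166216)))))))))))))) +
      k ^ 2 * (l ^ 13 * (233280)) +
      k ^ 2 * t * (1884 + l * (13110 + l * (45176 + l * (98110 + l * (154974 + l * (198474 +
        l * (222804 + l * (232482 + l * (234072 + l * (233508 + l * (233340 + l * (233296 +
        l * (233282))))))))))))) +
      k ^ 3 * (l ^ 11 * (190512)) +
      k ^ 3 * t * (3002 + l * (18728 + l * (55980 + l * (106250 + l * (149982 + l * (176514 +
        l * (187778 + l * (190758 + l * (190596 + l * (190482 + l * (190522))))))))))) +
      k ^ 4 * (l ^ 10 * (99792)) +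
      k ^ 4 * t * (3110 + l * (16824 + l * (42770 + l * (70458 + l * (88862 + l * (97210 +
        l * (99590 + l * (99838 + l * (99744 + l * (99794)))))))))) +
      k ^ 5 * (l ^ 8 * (34776)) +
      k ^ 5 * t * (2164 + l * (9764 + l * (20716 + l * (29392 + l * (33392 + l * (34616 +
        l * (34780 + l * (34760)))))))) +
      k ^ 6 * (l ^ 7 * (8064)) +
      k ^ 6 * t * (1006 + l * (3620 + l * (6274 + l * (7640 + l * (8006 + l * (8064 +
        l * (8062))))))) +
      k ^ 7 * (300 + l * (512 + l * (308 + l * (72 + l * (8))))) +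
      k ^ 8 * (52 + l * (44 + l * (8))) +
      k ^ 9 * (4)) := by
    rw [htl]
    simp only [crossSum, oneDiffInF, oneDiffOutF, oneDiffInW, oneDiffOutW, cA, cB, cS, cD, gapD, fHigh, fMidLoop, fMidPair, fLow, scaleLoop, scalePair, relN, relW, relK, wHigh, wMid, wLow]
    ring
  rw [key]
  positivity

theorem crossSum_diffPair_overlap_two_pos (l : ℝ) (hl : 0 < l) (hl1 : l < 1) :
    0 < crossSum 2 2 2 2 (oneDiffInF 2 l) (oneDiffOutF 2 l) (oneDiffInW 2 l)
      (oneDiffOutW 2 l) (wMid 2 l) (wLow 2 l) (l * (1 - l) * fMidPair 2 l)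
      (l * (1 - l) * fLow 2 l) := by
  obtain ⟨t, ht, htl⟩ : ∃ t : ℝ, 0 < t ∧ t = 1 - l := ⟨1 - l, by linarith, rfl⟩
  have key : crossSum 2 2 2 2 (oneDiffInF 2 l) (oneDiffOutF 2 l) (oneDiffInW 2 l)
      (oneDiffOutW 2 l) (wMid 2 l) (wLow 2 l) (l * (1 - l) * fMidPair 2 l)
      (l * (1 - l) * fLow 2 l) =
      l ^ 4 * t ^ 2 * ((l ^ 11 * (1024)) +
      t * (4 + l * (32 + l * (120 + l * (292 + l * (540 + l * (820 + l * (1044 + l * (1132 +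
        l * (1104 + l * (1052 + l * (1028)))))))))))) := by
    rw [htl]
    simp only [crossSum, oneDiffInF, oneDiffOutF, oneDiffInW, oneDiffOutW, cA, cB, cS, cD, gapD, fHigh, fMidLoop, fMidPair, fLow, scaleLoop, scalePair, relN, relW, relK, wHigh, wMid, wLow]
    ring
  rw [key]
  positivity

/-- The sum of `pathF` over the root colour when the outer colours agree: one colour inside, q - 1
outside. The next lemma is the case of distinct outer colours. -/
theorem pathSame_pos (k : ℝ) (hk : 0 ≤ k) (l : ℝ) (hl : 0 < l) (hl1 : l < 1) :
    0 < pathSameInF (k + 2) l + ((k + 2) - 1) * pathSameOutF (k + 2) l := by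
  obtain ⟨t, ht, htl⟩ : ∃ t : ℝ, 0 < t ∧ t = 1 - l := ⟨1 - l, by linarith, rfl⟩
  have key : pathSameInF (k + 2) l + ((k + 2) - 1) * pathSameOutF (k + 2) l =
      l ^ 1 * t ^ 2 * ((l ^ 2 * (2 + l * (16 + l * (62 + l * (152 + l * (260 + l * (336 +
        l * (364 + l * (352 + l * (282 + l * (160 + l * (54 + l * (8))))))))))))) +
      k * (l ^ 13 * (10240)) +
      k * t * (2 + l ^ 2 * (30 + l * (228 + l * (810 + l * (1974 + l * (3722 + l * (5758 +
        l * (7620 + l * (9010 + l * (9840 + l * (10166 + l * (10232)))))))))))) +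
      k ^ 2 * (l ^ 12 * (22528)) +
      k ^ 2 * t * (l ^ 11 * (126976)) +
      k ^ 2 * t ^ 2 * (10 + l * (8 + l * (234 + l * (1376 + l * (4742 + l * (12020 + l * (24090 +
        l * (40664 + l * (60512 + l * (82124 + l * (104460))))))))))) +
      k ^ 3 * (16 + l * (28 + l * (764 + l * (2306 + l * (4870 + l * (6648 + l * (6266 +
        l * (4520 + l * (2234 + l * (820 + l * (186 + l * (14)))))))))))) +
      k ^ 4 * (12 + l * (212 + l * (1428 + l * (3700 + l * (5874 + l * (5724 + l * (3898 +
        l * (1852 + l * (490 + l * (96 + l * (10))))))))))) +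
      k ^ 5 * (18 + l * (434 + l * (1736 + l * (3452 + l * (3530 + l * (2244 + l * (956 +
        l * (140 + l * (32 + l * (2)))))))))) +
      k ^ 6 * (40 + l * (476 + l * (1292 + l * (1524 + l * (856 + l * (268 + l * (20 +
        l * (4)))))))) +
      k ^ 7 * (48 + l * (300 + l * (442 + l * (200 + l * (34))))) +
      k ^ 8 * (30 + l * (84 + l * (22))) +
      k ^ 9 * (8)) := by
    rw [htl]
    simp only [pathSameInF, pathSameOutF, cA, cB, cS, cD, gapD, fHigh, fMidLoop, fMidPair, fLow, scaleLoop, scalePair, relN, relW, relK, wHigh, wMid, wLow]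
    ring
  rw [key]
  positivity

theorem pathDiff_pos (k : ℝ) (hk : 0 ≤ k) (l : ℝ) (hl : 0 < l) (hl1 : l < 1) :
    0 < 2 * pathDiffInF (k + 2) l + ((k + 2) - 2) * pathDiffOutF (k + 2) l := by
  obtain ⟨t, ht, htl⟩ : ∃ t : ℝ, 0 < t ∧ t = 1 - l := ⟨1 - l, by linarith, rfl⟩
  have key : 2 * pathDiffInF (k + 2) l + ((k + 2) - 2) * pathDiffOutF (k + 2) l =
      l ^ 1 * t ^ 2 * ((l ^ 14 * (2048)) +
      t * (l ^ 3 * (8 + l * (60 + l * (212 + l * (496 + l * (912 + l * (1416 + l * (1864 +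
        l * (2096 + l * (2120 + l * (2076 + l * (2052)))))))))))) +
      k * (l ^ 13 * (10240)) +
      k * t * (l * (2 + l * (20 + l * (166 + l * (722 + l * (2054 + l * (4178 + l * (6590 +
        l * (8750 + l * (10096 + l * (10402 + l * (10276 + l * (10232))))))))))))) +
      k ^ 2 * (l ^ 12 * (22528)) +
      k ^ 2 * t * (2 + l * (26 + l * (164 + l * (1020 + l * (3576 + l * (8128 + l * (13596 +
        l * (18468 + l * (21606 + l * (22566 + l * (22496 + l * (22496)))))))))))) +
      k ^ 3 * (14 + l * (76 + l * (610 + l * (2666 + l * (5550 + l * (7320 + l * (6554 +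
        l * (4224 + l * (1524 + l * (20 + l * (84 + l * (30)))))))))))) +
      k ^ 4 * (32 + l * (204 + l * (1560 + l * (4212 + l * (6296 + l * (5832 + l * (3636 +
        l * (1380 + l * (48 + l * (84 + l * (12))))))))))) +
      k ^ 5 * (46 + l * (446 + l * (2030 + l * (3564 + l * (3576 + l * (2096 + l * (718 +
        l * (36 + l * (30 + l * (2)))))))))) +
      k ^ 6 * (62 + l * (532 + l * (1364 + l * (1492 + l * (806 + l * (212 + l * (8 +
        l * (4)))))))) +
      k ^ 7 * (62 + l * (316 + l * (426 + l * (192 + l * (28))))) +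
      k ^ 8 * (34 + l * (80 + l * (22))) +
      k ^ 9 * (8)) := by
    rw [htl]
    simp only [pathDiffInF, pathDiffOutF, cA, cB, cS, cD, gapD, fHigh, fMidLoop, fMidPair, fLow, scaleLoop, scalePair, relN, relW, relK, wHigh, wMid, wLow]
    ring
  rw [key]
  positivity

theorem clique_pos (k : ℝ) (hk : 0 ≤ k) (l : ℝ) (hl : 0 < l) (hl1 : l < 1) :
    0 < cliqueF (k + 2) l := by
  obtain ⟨t, ht, htl⟩ : ∃ t : ℝ, 0 < t ∧ t = 1 - l := ⟨1 - l, by linarith, rfl⟩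
  have key : cliqueF (k + 2) l =
      l ^ 1 * t ^ 2 * ((l ^ 3 * (6 + l * (36 + l * (96 + l * (168 + l * (252 + l * (336 +
        l * (336 + l * (216 + l * (78 + l * (12))))))))))) +
      k * (l ^ 2 * (18 + l * (102 + l * (336 + l * (792 + l * (1248 + l * (1452 + l * (1428 +
        l * (1032 + l * (414 + l * (78 + l * (12)))))))))))) +
      k ^ 2 * (l * (18 + l * (120 + l * (510 + l * (1500 + l * (2550 + l * (2976 + l * (2802 +
        l * (1932 + l * (840 + l * (192))))))))))) +
      k ^ 3 * (l ^ 10 * (14784)) +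
      k ^ 3 * t * (6 + l * (84 + l * (480 + l * (2010 + l * (4992 + l * (8562 + l * (11700 +
        l * (13770 + l * (14646 + l * (14790)))))))))) +
      k ^ 4 * (24 + l * (168 + l * (900 + l * (2178 + l * (2724 + l * (2220 + l * (1356 +
        l * (474 + l * (36))))))))) +
      k ^ 5 * (42 + l * (276 + l * (1038 + l * (1338 + l * (1038 + l * (516 + l * (114 +
        l * (6)))))))) +
      k ^ 6 * (48 + l * (270 + l * (468 + l * (282 + l * (96 + l * (12)))))) +
      k ^ 7 * (36 + l * (102 + l * (36 + l * (6)))) +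
      k ^ 8 * (12)) := by
    rw [htl]
    simp only [cliqueF, cA, cB, cS, cD, gapD, fHigh, fMidLoop, fMidPair, fLow, scaleLoop, scalePair, relN, relW, relK, wHigh, wMid, wLow]
    ring
  rw [key]
  positivity

/-- Needed to divide: `cS` multiplies the energy in the summed inequality. -/
theorem cS_pos (k : ℝ) (hk : 0 ≤ k) (l : ℝ) (hl : 0 < l) (hl1 : l < 1) :
    0 < cS (k + 2) l := by
  obtain ⟨t, ht, htl⟩ : ∃ t : ℝ, 0 < t ∧ t = 1 - l := ⟨1 - l, by linarith, rfl⟩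
  have key : cS (k + 2) l =
      ((l ^ 2 * (2 + l * (4 + l * (2 + l * (12 + l * (42 + l * (66 + l * (66 + l * (42 +
        l * (12 + l * (2 + l * (4 + l * (2))))))))))))) +
      k * (l * (4 + l * (8 + l * (26 + l * (28 + l * (114 + l * (288 + l * (258 + l * (108 +
        l * (42 + l * (16 + l * (4)))))))))))) +
      k ^ 2 * (l ^ 9 * (1344)) +
      k ^ 2 * t * (2 + l * (10 + l * (64 + l * (60 + l * (268 + l * (742 + l * (1108 +
        l * (1300 + l * (1342))))))))) +
      k ^ 3 * (l ^ 6 * (1120)) +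
      k ^ 3 * t * (4 + l * (42 + l * (34 + l * (230 + l * (610 + l * (1000)))))) +
      k ^ 4 * (10 + l * (16 + l * (54 + l * (262 + l * (200 + l * (18)))))) +
      k ^ 5 * (8 + l * (4 + l * (114 + l * (40 + l * (2))))) +
      k ^ 6 * (2 + l * (22 + l * (4))) +
      k ^ 7 * (2)) := by
    rw [htl]
    simp only [cA, cB, cS, cD, gapD, fHigh, fMidLoop, fMidPair, fLow, scaleLoop, scalePair, relN, relW, relK, wHigh, wMid, wLow]
    ring
  rw [key]
  positivity

/-- Makes a colour at which all three leaf values are positive harmless once q ≥ 4. -/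
theorem fLow_sub_fMidLoop_pos (k : ℝ) (hk : 0 ≤ k) (l : ℝ) (hl : 0 < l) (hl1 : l < 1) :
    0 < 2 * wLow (k + 4) l * fLow (k + 4) l - (wMid (k + 4) l + wLow (k + 4) l) * fMidLoop (k +
        4) l := by
  obtain ⟨t, ht, htl⟩ : ∃ t : ℝ, 0 < t ∧ t = 1 - l := ⟨1 - l, by linarith, rfl⟩
  have key : 2 * wLow (k + 4) l * fLow (k + 4) l - (wMid (k + 4) l + wLow (k +
        4) l) * fMidLoop (k + 4) l =
      t ^ 1 * ((420 + l * (1800 + l * (2370 + l * (4992 + l * (9858 + l * (13692 + l * (12942 +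
        l * (9192 + l * (5624 + l * (2984 + l * (1214 + l * (344 + l * (82 + l * (20 +
        l * (2))))))))))))))) +
      k * (1802 + l * (5436 + l * (7438 + l * (14360 + l * (22378 + l * (24748 + l * (18708 +
        l * (10924 + l * (5694 + l * (2392 + l * (670 + l * (124 + l * (14))))))))))))) +
      k ^ 2 * (2936 + l * (6748 + l * (9218 + l * (15284 + l * (18958 + l * (16376 + l * (9478 +
        l * (4516 + l * (1898 + l * (532 + l * (72))))))))))) +
      k ^ 3 * (2498 + l * (4472 + l * (5730 + l * (7836 + l * (7534 + l * (4800 + l * (1974 +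
        l * (764 + l * (216 + l * (16)))))))))) +
      k ^ 4 * (1234 + l * (1676 + l * (1870 + l * (2020 + l * (1400 + l * (564 + l * (150 +
        l * (44 + l * (2))))))))) +
      k ^ 5 * (360 + l * (336 + l * (300 + l * (236 + l * (96 + l * (12 + l * (4))))))) +
      k ^ 6 * (58 + l * (28 + l * (18 + l * (8)))) +
      k ^ 7 * (4)) := by
    rw [htl]
    simp only [cA, cB, cS, cD, gapD, fHigh, fMidLoop, fMidPair, fLow, scaleLoop, scalePair, relN, relW, relK, wHigh, wMid, wLow]
    ring
  rw [key]
  positivity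

theorem fMidPair_sub_fHigh_pos (k : ℝ) (hk : 0 ≤ k) (l : ℝ) (hl : 0 < l) (hl1 : l < 1) :
    0 < fMidPair (k + 3) l - fHigh (k + 3) l := by
  obtain ⟨t, ht, htl⟩ : ∃ t : ℝ, 0 < t ∧ t = 1 - l := ⟨1 - l, by linarith, rfl⟩
  have key : fMidPair (k + 3) l - fHigh (k + 3) l =
      ((8 + l * (56 + l * (134 + l * (402 + l * (762 + l * (978 + l * (954 + l * (630 +
        l * (342 + l * (94 + l * (10 + l * (4)))))))))))) +
      k * (l ^ 11 * (10206)) +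
      k * t * (40 + l * (252 + l * (833 + l * (2256 + l * (4555 + l * (6986 + l * (8853 +
        l * (9802 + l * (10163 + l * (10208 + l * (10204))))))))))) +
      k ^ 2 * (l ^ 9 * (10206)) +
      k ^ 2 * t * (76 + l * (442 + l * (1429 + l * (3490 + l * (6175 + l * (8428 + l * (9673 +
        l * (10132 + l * (10213))))))))) +
      k ^ 3 * (l ^ 8 * (5670)) +
      k ^ 3 * t * (75 + l * (438 + l * (1305 + l * (2872 + l * (4369 + l * (5304 + l * (5609 +
        l * (5678)))))))) +
      k ^ 4 * (l ^ 7 * (1890)) +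
      k ^ 4 * t * (43 + l * (256 + l * (699 + l * (1340 + l * (1725 + l * (1876 +
        l * (1891))))))) +
      k ^ 5 * (14 + l * (74 + l * (136 + l * (118 + l * (34 + l * (2)))))) +
      k ^ 6 * (2 + l * (16 + l * (20 + l * (4)))) +
      k ^ 7 * (l * (2))) := by
    rw [htl]
    simp only [cA, cB, cS, cD, gapD, fHigh, fMidLoop, fMidPair, fLow, scaleLoop, scalePair, relN, relW, relK, wHigh, wMid, wLow]
    ring
  rw [key]
  positivity

/-! ### Levels of a leaf and the compensation for three colours -/

/-- Levels are numbered so that the weight increases and the leaf value decreases. Levels 1 and 2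
share a weight but not a value: they differ in whether the outer colours agree. -/
noncomputable def wLevel (q l : ℝ) : Fin 4 → ℝ := ![wLow q l, wMid q l, wMid q l, wHigh q l]

noncomputable def fLevel (q l : ℝ) : Fin 4 → ℝ :=
  ![fLow q l, fMidLoop q l, fMidPair q l, fHigh q l]

/-- The excess of `∑ fᵢ pⱼ pₖ` over its diagonal counterpart `∑ fᵢ pᵢ ^ 2`. -/
def surplus (p f : Fin 4 → ℝ) (i j k : Fin 4) : ℝ :=
  f i * (p j * p k - p i ^ 2) + f j * (p i * p k - p j ^ 2) + f k * (p i * p j - p k ^ 2)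

/-- For q = 3 the surplus at a critical colour need not be handled alone: this and the next two
lemmas add the surplus at a second colour, in the three level patterns that arise. -/
theorem surplus_001_add_surplus_223_pos (l : ℝ) (hl : 0 < l) (hl1 : l < 1) :
    0 < surplus (wLevel 3 l) (fLevel 3 l) 0 0 1 +
      surplus (wLevel 3 l) (fLevel 3 l) 2 2 3 := by
  obtain ⟨t, ht, htl⟩ : ∃ t : ℝ, 0 < t ∧ t = 1 - l := ⟨1 - l, by linarith, rfl⟩
  have key : surplus (wLevel 3 l) (fLevel 3 l) 0 0 1 +
      surplus (wLevel 3 l) (fLevel 3 l) 2 2 3 =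
      t ^ 2 * ((8 + l * (224 + l * (768 + l * (1968 + l * (4708 + l * (7848 + l * (9724 +
        l * (9444 + l * (7614 + l * (5398 + l * (3028 + l * (1248 + l * (396 + l * (92 +
        l * (18 + l * (2))))))))))))))))) := by
    rw [htl]
    simp only [surplus, wLevel, fLevel, Matrix.cons_val, cA, cB, cS, cD, gapD, fHigh, fMidLoop, fMidPair, fLow, scaleLoop, scalePair, relN, relW, relK, wHigh, wMid, wLow]
    ring
  rw [key]
  positivity

theorem surplus_011_add_surplus_233_pos (l : ℝ) (hl : 0 < l) (hl1 : l < 1) :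
    0 < surplus (wLevel 3 l) (fLevel 3 l) 0 1 1 +
      surplus (wLevel 3 l) (fLevel 3 l) 2 3 3 := by
  obtain ⟨t, ht, htl⟩ : ∃ t : ℝ, 0 < t ∧ t = 1 - l := ⟨1 - l, by linarith, rfl⟩
  have key : surplus (wLevel 3 l) (fLevel 3 l) 0 1 1 +
      surplus (wLevel 3 l) (fLevel 3 l) 2 3 3 =
      t ^ 2 * ((28 + l * (284 + l * (794 + l * (2430 + l * (5206 + l * (7978 + l * (9188 +
        l * (8508 + l * (6960 + l * (5168 + l * (3328 + l * (1738 + l * (678 + l * (170 +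
        l * (26 + l * (4))))))))))))))))) := by
    rw [htl]
    simp only [surplus, wLevel, fLevel, Matrix.cons_val, cA, cB, cS, cD, gapD, fHigh, fMidLoop, fMidPair, fLow, scaleLoop, scalePair, relN, relW, relK, wHigh, wMid, wLow]
    ring
  rw [key]
  positivity

theorem surplus_011_add_surplus_123_pos (l : ℝ) (hl : 0 < l) (hl1 : l < 1) :
    0 < surplus (wLevel 3 l) (fLevel 3 l) 0 1 1 +
      surplus (wLevel 3 l) (fLevel 3 l) 1 2 3 := by
  obtain ⟨t, ht, htl⟩ : ∃ t : ℝ, 0 < t ∧ t = 1 - l := ⟨1 - l, by linarith, rfl⟩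
  have key : surplus (wLevel 3 l) (fLevel 3 l) 0 1 1 +
      surplus (wLevel 3 l) (fLevel 3 l) 1 2 3 =
      t ^ 2 * ((36 + l * (340 + l * (1306 + l * (3818 + l * (7678 + l * (11744 + l * (13984 +
        l * (13552 + l * (11058 + l * (7590 + l * (4394 + l * (2066 + l * (802 + l * (278 +
        l * (70 + l * (14 + l * (2)))))))))))))))))) := by
    rw [htl]
    simp only [surplus, wLevel, fLevel, Matrix.cons_val, cA, cB, cS, cD, gapD, fHigh, fMidLoop, fMidPair, fLow, scaleLoop, scalePair, relN, relW, relK, wHigh, wMid, wLow]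
    ring
  rw [key]
  positivity

theorem fMidLoop_lt_fLow (k : ℝ) (hk : 0 ≤ k) (l : ℝ) (hl : 0 < l) (hl1 : l < 1) :
    0 < fLow (k + 3) l - fMidLoop (k + 3) l := by
  obtain ⟨t, ht, htl⟩ : ∃ t : ℝ, 0 < t ∧ t = 1 - l := ⟨1 - l, by linarith, rfl⟩
  have key : fLow (k + 3) l - fMidLoop (k + 3) l =
      t ^ 1 * ((l ^ 12 * (1458)) +
      t * (12 + l * (52 + l * (44 + l * (84 + l * (264 + l * (576 + l * (912 + l * (1152 +
        l * (1326 + l * (1422 + l * (1448 + l * (1456)))))))))))) +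
      k * (62 + l * (108 + l * (64 + l * (252 + l * (590 + l * (724 + l * (540 + l * (320 +
        l * (184 + l * (64 + l * (8))))))))))) +
      k ^ 2 * (116 + l * (132 + l * (190 + l * (404 + l * (618 + l * (532 + l * (254 + l * (132 +
        l * (52))))))))) +
      k ^ 3 * (108 + l * (100 + l * (174 + l * (256 + l * (256 + l * (132 + l * (38 +
        l * (16)))))))) +
      k ^ 4 * (56 + l * (44 + l * (64 + l * (64 + l * (36 + l * (4 + l * (2))))))) +
      k ^ 5 * (16 + l * (8 + l * (8 + l * (4)))) +
      k ^ 6 * (2)) := by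
    rw [htl]
    simp only [cA, cB, cS, cD, gapD, fHigh, fMidLoop, fMidPair, fLow, scaleLoop, scalePair, relN, relW, relK, wHigh, wMid, wLow]
    ring
  rw [key]
  positivity


/-! ### Signs of the coefficients -/

section Signs

variable {q l : ℝ}

theorem wMid_pos (hq : 2 ≤ q) (hl : 0 < l) : 0 < wMid q l := by
  unfold wMid; nlinarith [sq_nonneg l]

theorem wHigh_pos (hq : 2 ≤ q) (hl : 0 < l) : 0 < wHigh q l := by
  unfold wHigh; have := pow_pos hl 3; linarith

theorem wLow_pos (hq : 3 ≤ q) (hl : 0 < l) : 0 < wLow q l := by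
  unfold wLow; linarith

theorem wLow_lt_wMid (hl1 : l < 1) : wLow q l < wMid q l := by
  have : 0 < (1 - l) ^ 2 := by have : 0 < 1 - l := by linarith
                               positivity
  unfold wLow wMid; linarith

theorem wMid_lt_wHigh (hl : 0 < l) (hl1 : l < 1) : wMid q l < wHigh q l := by
  have : 0 < (1 - l) ^ 2 * (1 + l) := by have : 0 < 1 - l := by linarith
                                         positivity
  unfold wHigh wMid; linarith

theorem relW_pos (hq : 2 ≤ q) (hl : 0 < l) : 0 < relW q l := by
  have : 0 < q - 1 := by linarith
  unfold relW; positivity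

theorem relN_pos (hq : 2 ≤ q) (hl : 0 < l) : 0 < relN q l := by
  unfold relN; linarith

theorem relK_pos (hq : 2 ≤ q) (hl : 0 < l) : 0 < relK q l := by
  have : 0 < q - 1 := by linarith
  unfold relK; positivity

theorem scaleLoop_pos (hq : 2 ≤ q) (hl : 0 < l) : 0 < scaleLoop q l := by
  have h1 := relK_pos hq hl
  have h2 := relW_pos hq hl
  have h3 := wMid_pos hq hl
  have : 0 ≤ q - 2 := by linarith
  unfold scaleLoop; positivity

theorem scalePair_pos (hq : 2 ≤ q) (hl : 0 < l) : 0 < scalePair q l := by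
  have h1 := relN_pos hq hl
  have h2 := relW_pos hq hl
  have h3 := wMid_pos hq hl
  have h4 := wHigh_pos hq hl
  have : 0 < q - 1 := by linarith
  unfold scalePair; positivity

theorem fHigh_neg (hq : 2 ≤ q) (hl : 0 < l) : fHigh q l < 0 := by
  have h1 := scaleLoop_pos hq hl
  have h3 := wMid_pos hq hl
  have : 0 < q - 1 := by linarith
  unfold fHigh
  rw [neg_lt_zero]; positivity

theorem fMidLoop_pos (hq : 2 ≤ q) (hl : 0 < l) : 0 < fMidLoop q l := by
  have h1 := scaleLoop_pos hq hl
  have h3 := wHigh_pos hq hl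
  unfold fMidLoop; positivity

theorem fMidPair_nonpos (hq : 2 ≤ q) (hl : 0 < l) : fMidPair q l ≤ 0 := by
  have h1 := scalePair_pos hq hl
  have : 0 ≤ q - 2 := by linarith
  unfold fMidPair
  rw [neg_nonpos]; positivity

theorem fMidPair_neg (hq : 3 ≤ q) (hl : 0 < l) : fMidPair q l < 0 := by
  have h1 := scalePair_pos (q := q) (by linarith) hl
  have h2 := wLow_pos hq hl
  have : 0 < q - 2 := by linarith
  unfold fMidPair
  rw [neg_lt_zero]; positivity

theorem fLow_pos (hq : 2 ≤ q) (hl : 0 < l) : 0 < fLow q l := by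
  have h1 := scalePair_pos hq hl
  have h3 := wMid_pos hq hl
  unfold fLow; positivity

theorem fHigh_le_fMidPair (hq : q = 2 ∨ 3 ≤ q) (hl : 0 < l) (hl1 : l < 1) :
    fHigh q l ≤ fMidPair q l := by
  rcases hq with rfl | hq
  · have h0 : fMidPair 2 l = 0 := by unfold fMidPair; ring
    rw [h0]; exact (fHigh_neg le_rfl hl).le
  · have h := fMidPair_sub_fHigh_pos (q - 3) (by linarith) l hl hl1
    rw [sub_add_cancel] at h
    linarith

/-- Comparison of the two positive levels. -/
theorem two_mul_wLow_mul_fLow (hq : 4 ≤ q) (hl : 0 < l) (hl1 : l < 1) :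
    (wMid q l + wLow q l) * fMidLoop q l < 2 * wLow q l * fLow q l := by
  have h := fLow_sub_fMidLoop_pos (q - 4) (by linarith) l hl hl1
  rw [sub_add_cancel] at h
  linarith

end Signs

/-! ### The pointwise inequality -/

/-- A Chebyshev-type inequality for oppositely ordered triples. The brackets multiplying f₁ and f₃
are nonnegative and negative; the middle one has no definite sign and is absorbed by Abel summation,
in a way that depends on the sign of f₂. -/
theorem surplus_pos_of_sorted {p₁ p₂ p₃ f₁ f₂ f₃ : ℝ} (h0 : 0 < p₁) (h12 : p₁ ≤ p₂) (h23 : p₂ ≤ p₃)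
    (h13 : p₁ < p₃) (g12 : f₂ ≤ f₁) (g23 : f₃ ≤ f₂) (g3 : f₃ < 0) :
    0 < f₁ * (p₂ * p₃ - p₁ ^ 2) + f₂ * (p₁ * p₃ - p₂ ^ 2) + f₃ * (p₁ * p₂ - p₃ ^ 2) := by
  have b1 : 0 ≤ p₂ * p₃ - p₁ ^ 2 := by nlinarith
  have b3 : p₁ * p₂ - p₃ ^ 2 < 0 := by nlinarith
  rcases lt_trichotomy f₂ 0 with h | h | h
  · have hs : 0 < (p₁ - p₃) ^ 2 := by
      have : p₁ - p₃ ≠ 0 := by linarith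
      positivity
    -- The three brackets add up to minus half the sum of the squared differences, so it pays to
    -- pull f₂ < 0 out of all of them.
    have e : f₁ * (p₂ * p₃ - p₁ ^ 2) + f₂ * (p₁ * p₃ - p₂ ^ 2) + f₃ * (p₁ * p₂ - p₃ ^ 2) =
        (f₁ - f₂) * (p₂ * p₃ - p₁ ^ 2) + (f₂ - f₃) * (-(p₁ * p₂ - p₃ ^ 2)) +
          (-f₂) * (((p₁ - p₂) ^ 2 + (p₂ - p₃) ^ 2 + (p₁ - p₃) ^ 2) / 2) := by ring
    rw [e]
    have t1 : 0 ≤ (f₁ - f₂) * (p₂ * p₃ - p₁ ^ 2) := mul_nonneg (by linarith) b1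
    have t2 : 0 ≤ (f₂ - f₃) * (-(p₁ * p₂ - p₃ ^ 2)) := mul_nonneg (by linarith) (by linarith)
    have t3 : 0 < (-f₂) * (((p₁ - p₂) ^ 2 + (p₂ - p₃) ^ 2 + (p₁ - p₃) ^ 2) / 2) := by
      apply mul_pos (by linarith)
      nlinarith [sq_nonneg (p₁ - p₂), sq_nonneg (p₂ - p₃)]
    linarith
  · subst h
    have t1 : 0 ≤ f₁ * (p₂ * p₃ - p₁ ^ 2) := mul_nonneg (by linarith) b1
    have t2 : 0 < f₃ * (p₁ * p₂ - p₃ ^ 2) := mul_pos_of_neg_of_neg g3 b3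
    linarith
  -- For f₂ > 0 only the first two brackets are merged; their sum is nonnegative.
  · have e : f₁ * (p₂ * p₃ - p₁ ^ 2) + f₂ * (p₁ * p₃ - p₂ ^ 2) + f₃ * (p₁ * p₂ - p₃ ^ 2) =
        (f₁ - f₂) * (p₂ * p₃ - p₁ ^ 2) + f₂ * (p₁ * (p₃ - p₁) + p₂ * (p₃ - p₂)) +
          f₃ * (p₁ * p₂ - p₃ ^ 2) := by ring
    rw [e]
    have t1 : 0 ≤ (f₁ - f₂) * (p₂ * p₃ - p₁ ^ 2) := mul_nonneg (by linarith) b1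
    have t2 : 0 ≤ f₂ * (p₁ * (p₃ - p₁) + p₂ * (p₃ - p₂)) := by
      apply mul_nonneg h.le
      have := mul_nonneg h0.le (sub_nonneg.2 h13.le)
      have := mul_nonneg (h0.le.trans h12) (sub_nonneg.2 h23)
      linarith
    have t3 : 0 < f₃ * (p₁ * p₂ - p₃ ^ 2) := mul_pos_of_neg_of_neg g3 b3
    linarith

theorem surplus_swap₁₂ (p f : Fin 4 → ℝ) (i j k : Fin 4) :
    surplus p f j i k = surplus p f i j k := by unfold surplus; ring

theorem surplus_swap₂₃ (p f : Fin 4 → ℝ) (i j k : Fin 4) :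
    surplus p f i k j = surplus p f i j k := by unfold surplus; ring

theorem surplus_eq_zero {p f : Fin 4 → ℝ} {i j k : Fin 4} (h : p i = p j) (h' : p j = p k) :
    surplus p f i j k = 0 := by
  unfold surplus; rw [h, h']; ring

/-- A colour is critical for three levels if each of them is one of the two positive levels, and
both occur. -/
def Critical (i j k : Fin 4) : Prop :=
  (i ≤ 1 ∧ j ≤ 1 ∧ k ≤ 1) ∧ (i = 0 ∨ j = 0 ∨ k = 0) ∧ (i = 1 ∨ j = 1 ∨ k = 1)

instance (i j k : Fin 4) : Decidable (Critical i j k) := by unfold Critical; infer_instance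

theorem critical_swap₁₂ (i j k : Fin 4) : Critical j i k ↔ Critical i j k := by
  unfold Critical; tauto

theorem critical_swap₂₃ (i j k : Fin 4) : Critical i k j ↔ Critical i j k := by
  unfold Critical; tauto

section Pointwise

variable {q l : ℝ}

theorem wLevel_mono (hl : 0 < l) (hl1 : l < 1) : Monotone (wLevel q l) := by
  have h1 := wLow_lt_wMid (q := q) hl1
  have h2 := wMid_lt_wHigh (q := q) hl hl1
  intro i j hij
  fin_cases i <;> fin_cases j <;> simp [wLevel] at hij ⊢ <;> linarith

/-- Level 0 is excluded for q = 2: it needs three different colours, and `wLow 2 l` may even be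
negative. -/
theorem fLevel_anti (hq : q = 2 ∨ 3 ≤ q) (hl : 0 < l) (hl1 : l < 1) {i j : Fin 4}
    (hij : i ≤ j) (h : q = 2 → i ≠ 0) : fLevel q l j ≤ fLevel q l i := by
  have hq2 : 2 ≤ q := by rcases hq with h | h <;> linarith
  have h1 := fHigh_neg hq2 hl
  have h2 := fHigh_le_fMidPair hq hl hl1
  have h3 := fMidPair_nonpos hq2 hl
  have h4 := fMidLoop_pos hq2 hl
  have h5 := fLow_pos hq2 hl
  by_cases hc : i = 0 ∧ j = 1
  · obtain ⟨rfl, rfl⟩ := hc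
    rcases hq with hq | hq
    · exact absurd rfl (h hq)
    · have h6 := fMidLoop_lt_fLow (q - 3) (by linarith) l hl hl1
      rw [sub_add_cancel] at h6
      simp [fLevel]; linarith
  · fin_cases i <;> fin_cases j <;> simp [fLevel] at hij hc ⊢ <;> linarith

/-- `surplus_pos_of_sorted` needs a negative value at the top level. Given that the extreme weights
differ, this fails only for bottom level 0 and top level 1, where q ≥ 4 is assumed and the surplus
is factored explicitly. -/
theorem surplus_sorted_pos (hq : q = 2 ∨ 3 ≤ q) (hl : 0 < l) (hl1 : l < 1) {i j k : Fin 4}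
    (hij : i ≤ j) (hjk : j ≤ k) (hi : q = 2 → i ≠ 0) (hne : wLevel q l i ≠ wLevel q l k)
    (hc : q < 4 → ¬ (i = 0 ∧ k = 1)) : 0 < surplus (wLevel q l) (fLevel q l) i j k := by
  have hq2 : 2 ≤ q := by rcases hq with h | h <;> linarith
  have hlt : wLevel q l i < wLevel q l k :=
    lt_of_le_of_ne (wLevel_mono hl hl1 (hij.trans hjk)) hne
  by_cases hik : i = 0 ∧ k = 1
  · have hq4 : 4 ≤ q := by
      by_contra h
      exact hc (not_le.1 h) hik
    obtain ⟨rfl, rfl⟩ := hik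
    have h0 := wLow_pos (q := q) (by linarith) hl
    have h1 := wLow_lt_wMid (q := q) hl1
    have hcmp := two_mul_wLow_mul_fLow hq4 hl hl1
    have hf := fLow_pos hq2 hl
    have hf1 := fMidLoop_pos hq2 hl
    have hj : j = 0 ∨ j = 1 := by
      revert hij hjk; revert j; decide
    have hd : 0 < wMid q l - wLow q l := by linarith
    rcases hj with rfl | rfl
    · have e : surplus (wLevel q l) (fLevel q l) 0 0 1 = (wMid q l - wLow q l) *
          (2 * wLow q l * fLow q l - (wMid q l + wLow q l) * fMidLoop q l) := by
        simp [surplus, wLevel, fLevel]; ring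
      rw [e]
      exact mul_pos hd (by linarith)
    · have e : surplus (wLevel q l) (fLevel q l) 0 1 1 = (wMid q l - wLow q l) *
          (fLow q l * (wLow q l + wMid q l) - 2 * fMidLoop q l * wMid q l) := by
        simp [surplus, wLevel, fLevel]; ring
      rw [e]
      apply mul_pos hd
      -- Multiply `hcmp` by `wMid + wLow` and use (wMid + wLow)² ≥ 4 wMid wLow.
      have hm : 0 < 2 * wLow q l *
          (fLow q l * (wLow q l + wMid q l) - 2 * fMidLoop q l * wMid q l) := by
        nlinarith [mul_lt_mul_of_pos_right hcmp (by linarith : 0 < wMid q l + wLow q l),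
          mul_nonneg hf1.le (sq_nonneg (wMid q l - wLow q l))]
      exact pos_of_mul_pos_right hm (by linarith)
  · have hp : 0 < wLevel q l i := by
      have hm := wMid_pos hq2 hl
      have hh := wHigh_pos hq2 hl
      rcases hq with hq | hq
      · have := hi hq
        fin_cases i <;> simp [wLevel] at this ⊢ <;> linarith
      · have := wLow_pos hq hl
        fin_cases i <;> simp [wLevel] <;> linarith
    have hk : fLevel q l k < 0 := by
      have h1 := fHigh_neg hq2 hl
      have hik' : i ≤ k := hij.trans hjk
      fin_cases k
      · have : i = 0 := by simpa using hik'
        subst this; exact absurd rfl hne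
      · fin_cases i
        · simp at hik
        · exact absurd rfl hne
        · simp at hik'
        · simp at hik'
      · fin_cases i
        · rcases hq with hq | hq
          · exact absurd rfl (hi hq)
          · exact fMidPair_neg hq hl
        · exact absurd rfl hne
        · exact absurd rfl hne
        · simp at hik'
      · exact h1
    have hj : q = 2 → j ≠ 0 := by
      rintro h rfl
      exact hi h (by simpa using hij)
    exact surplus_pos_of_sorted hp (wLevel_mono hl hl1 hij) (wLevel_mono hl hl1 hjk) hlt
      (fLevel_anti hq hl hl1 hij hi) (fLevel_anti hq hl hl1 hjk hj) hk

/-- All hypotheses and the surplus are symmetric in the three levels, so sorting them by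
transpositions suffices. -/
theorem surplus_pos (hq : q = 2 ∨ 3 ≤ q) (hl : 0 < l) (hl1 : l < 1) {i j k : Fin 4}
    (h0 : q = 2 → i ≠ 0 ∧ j ≠ 0 ∧ k ≠ 0)
    (hne : ¬ (wLevel q l i = wLevel q l j ∧ wLevel q l j = wLevel q l k))
    (hc : q < 4 → ¬ Critical i j k) : 0 < surplus (wLevel q l) (fLevel q l) i j k := by
  have main : ∀ {i j k : Fin 4}, i ≤ j → j ≤ k → (q = 2 → i ≠ 0 ∧ j ≠ 0 ∧ k ≠ 0) →
      ¬ (wLevel q l i = wLevel q l j ∧ wLevel q l j = wLevel q l k) →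
      (q < 4 → ¬ Critical i j k) → 0 < surplus (wLevel q l) (fLevel q l) i j k := by
    intro i j k hij hjk h0 hne hc
    refine surplus_sorted_pos hq hl hl1 hij hjk (fun h => (h0 h).1) ?_ ?_
    · intro h
      have h1 := wLevel_mono (q := q) hl hl1 hij
      have h2 := wLevel_mono (q := q) hl hl1 hjk
      exact hne ⟨by linarith, by linarith⟩
    · rintro h ⟨rfl, rfl⟩
      exact hc h ⟨⟨by decide, hjk, le_rfl⟩, Or.inl rfl, Or.inr (Or.inr rfl)⟩
  have s12 : ∀ {i j k : Fin 4}, ((q = 2 → i ≠ 0 ∧ j ≠ 0 ∧ k ≠ 0) →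
      ¬ (wLevel q l i = wLevel q l j ∧ wLevel q l j = wLevel q l k) →
      (q < 4 → ¬ Critical i j k) → 0 < surplus (wLevel q l) (fLevel q l) i j k) →
      ((q = 2 → j ≠ 0 ∧ i ≠ 0 ∧ k ≠ 0) →
      ¬ (wLevel q l j = wLevel q l i ∧ wLevel q l i = wLevel q l k) →
      (q < 4 → ¬ Critical j i k) → 0 < surplus (wLevel q l) (fLevel q l) j i k) := by
    intro i j k H h0 hne hc
    rw [surplus_swap₁₂]
    exact H (fun h => ⟨(h0 h).2.1, (h0 h).1, (h0 h).2.2⟩)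
      (fun h => hne ⟨h.1.symm, h.1.trans h.2⟩) (fun h hcr => hc h ((critical_swap₁₂ _ _ _).2 hcr))
  have s23 : ∀ {i j k : Fin 4}, ((q = 2 → i ≠ 0 ∧ j ≠ 0 ∧ k ≠ 0) →
      ¬ (wLevel q l i = wLevel q l j ∧ wLevel q l j = wLevel q l k) →
      (q < 4 → ¬ Critical i j k) → 0 < surplus (wLevel q l) (fLevel q l) i j k) →
      ((q = 2 → i ≠ 0 ∧ k ≠ 0 ∧ j ≠ 0) →
      ¬ (wLevel q l i = wLevel q l k ∧ wLevel q l k = wLevel q l j) →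
      (q < 4 → ¬ Critical i k j) → 0 < surplus (wLevel q l) (fLevel q l) i k j) := by
    intro i j k H h0 hne hc
    rw [surplus_swap₂₃]
    exact H (fun h => ⟨(h0 h).1, (h0 h).2.2, (h0 h).2.1⟩)
      (fun h => hne ⟨h.1.trans h.2, h.2.symm⟩) (fun h hcr => hc h ((critical_swap₂₃ _ _ _).2 hcr))
  rcases le_total i j with hij | hij <;> rcases le_total j k with hjk | hjk <;>
    rcases le_total i k with hik | hik
  · exact main hij hjk h0 hne hc
  · exact main hij hjk h0 hne hc
  · exact s23 (main hik hjk) h0 hne hc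
  · exact s23 (s12 (main hik hij)) h0 hne hc
  · exact s12 (main hij hik) h0 hne hc
  · exact s12 (s23 (main hjk hik)) h0 hne hc
  · exact s12 (s23 (s12 (main hjk hij))) h0 hne hc
  · exact s12 (s23 (s12 (main hjk hij))) h0 hne hc

end Pointwise

/-! ### Sums over colours -/

/-- The indicator of an edge being monochromatic. -/
def ind {q : ℕ} (a b : Fin q) : ℝ := if a = b then 1 else 0

/-- The Boltzmann weight of an edge, `l` if it is monochromatic and `1` otherwise. -/
def ew {q : ℕ} (l : ℝ) (a b : Fin q) : ℝ := if a = b then l else 1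

section ColourSums

variable {q : ℕ} {l : ℝ}

theorem ind_self (a : Fin q) : ind a a = 1 := if_pos rfl

theorem ind_of_ne {a b : Fin q} (h : a ≠ b) : ind a b = 0 := if_neg h

theorem ind_comm (a b : Fin q) : ind a b = ind b a := by simp only [ind, eq_comm]

theorem ew_self (a : Fin q) : ew l a a = l := if_pos rfl

theorem ew_of_ne {a b : Fin q} (h : a ≠ b) : ew l a b = 1 := if_neg h

theorem ew_comm (a b : Fin q) : ew l a b = ew l b a := by simp only [ew, eq_comm]

theorem sum_eq_of_const_off (S : Finset (Fin q)) (F : Fin q → ℝ) (k : ℝ) (h : ∀ z ∉ S, F z = k) :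
    ∑ z, F z = ∑ z ∈ S, F z + ((q : ℝ) - S.card) * k := by
  have h1 : ∑ z, (F z - k) = ∑ z ∈ S, (F z - k) := by
    symm
    apply Finset.sum_subset (Finset.subset_univ S)
    intro z _ hz
    rw [h z hz, sub_self]
  simp only [Finset.sum_sub_distrib, Finset.sum_const, Finset.card_univ, Fintype.card_fin,
    nsmul_eq_mul] at h1
  linarith

theorem sum_eq_one_off (a : Fin q) (F : Fin q → ℝ) (k : ℝ) (h : ∀ z, z ≠ a → F z = k) :
    ∑ z, F z = F a + ((q : ℝ) - 1) * k := by
  rw [sum_eq_of_const_off {a} F k (fun z hz => h z (by simpa using hz))]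
  simp

theorem sum_eq_two_off {a b : Fin q} (hab : a ≠ b) (F : Fin q → ℝ) (k : ℝ)
    (h : ∀ z, z ≠ a → z ≠ b → F z = k) : ∑ z, F z = F a + F b + ((q : ℝ) - 2) * k := by
  rw [sum_eq_of_const_off {a, b} F k (fun z hz => by
    simp only [Finset.mem_insert, Finset.mem_singleton, not_or] at hz
    exact h z hz.1 hz.2), Finset.sum_pair hab, Finset.card_pair hab]
  norm_num

theorem sum_eq_three_off {a b c : Fin q} (hab : a ≠ b) (hac : a ≠ c) (hbc : b ≠ c)
    (F : Fin q → ℝ) (k : ℝ) (h : ∀ z, z ≠ a → z ≠ b → z ≠ c → F z = k) :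
    ∑ z, F z = F a + F b + F c + ((q : ℝ) - 3) * k := by
  rw [sum_eq_of_const_off {a, b, c} F k (fun z hz => by
    simp only [Finset.mem_insert, Finset.mem_singleton, not_or] at hz
    exact h z hz.1 hz.2.1 hz.2.2), Finset.card_eq_three.2 ⟨a, b, c, hab, hac, hbc, rfl⟩,
    Finset.sum_insert (by simp [hab, hac]), Finset.sum_pair hbc]
  push_cast
  ring

/-- Unnormalized expectation of a sum of functions of independent variables. -/
theorem sum_mul_add {ι κ : Type*} [Fintype ι] [Fintype κ] (A f : ι → ℝ) (B g : κ → ℝ) :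
    ∑ a, ∑ b, A a * B b * (f a + g b) =
      (∑ a, A a * f a) * (∑ b, B b) + (∑ a, A a) * (∑ b, B b * g b) := by
  simp only [Finset.sum_mul_sum, ← Finset.sum_add_distrib]
  exact Finset.sum_congr rfl fun a _ => Finset.sum_congr rfl fun b _ => by ring

theorem sum_mul_mul_add (A B D f g h : Fin q → ℝ) :
    ∑ a, ∑ b, ∑ d, A a * B b * D d * (f a + g b + h d) =
      (∑ a, A a * f a) * ((∑ b, B b) * ∑ d, D d) + (∑ b, B b * g b) * ((∑ a, A a) * ∑ d, D d) +
        (∑ d, D d * h d) * ((∑ a, A a) * ∑ b, B b) := by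
  have h1 := sum_mul_add A f (fun p : Fin q × Fin q => B p.1 * D p.2) (fun p => g p.1 + h p.2)
  have h2 := sum_mul_add B g D h
  simp only [Fintype.sum_prod_type] at h1
  rw [h2, ← Finset.sum_mul_sum] at h1
  refine Eq.trans ?_ (h1.trans ?_)
  · exact Finset.sum_congr rfl fun a _ => Finset.sum_congr rfl fun b _ =>
      Finset.sum_congr rfl fun d _ => by ring
  · ring

/-- The total weight of a vertex whose three neighbours have colours `a`, `b`, `c`. -/
noncomputable def triW (l : ℝ) (a b c : Fin q) : ℝ := ∑ z, ew l z a * ew l z b * ew l z c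

/-- The weighted sum of a vertex whose three neighbours have colours `a`, `b`, `c`, where
monochromatic edges to the neighbours contribute `x`, `y`, `z`. -/
noncomputable def triF (l x y z : ℝ) (a b c : Fin q) : ℝ :=
  ∑ s, ew l s a * ew l s b * ew l s c * (x * ind s a + y * ind s b + z * ind s c)

theorem triW_same (a : Fin q) : triW l a a a = wHigh q l := by
  unfold triW
  rw [sum_eq_one_off a _ 1 (fun z hz => by simp [ew_of_ne hz])]
  simp only [ew_self, wHigh]; ring

theorem triW_pair {a b : Fin q} (h : a ≠ b) : triW l a a b = wMid q l := by
  unfold triW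
  rw [sum_eq_two_off h _ 1 (fun z hz hz' => by simp [ew_of_ne hz, ew_of_ne hz'])]
  simp only [ew_self, ew_of_ne h, ew_of_ne h.symm, wMid]; ring

theorem triW_pair' {a b : Fin q} (h : a ≠ b) : triW l a b a = wMid q l := by
  rw [← triW_pair h]; unfold triW; exact Finset.sum_congr rfl fun z _ => by ring

theorem triW_pair'' {a b : Fin q} (h : a ≠ b) : triW l b a a = wMid q l := by
  rw [← triW_pair h]; unfold triW; exact Finset.sum_congr rfl fun z _ => by ring

theorem triW_distinct {a b c : Fin q} (hab : a ≠ b) (hac : a ≠ c) (hbc : b ≠ c) :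
    triW l a b c = wLow q l := by
  unfold triW
  rw [sum_eq_three_off hab hac hbc _ 1
    (fun z h1 h2 h3 => by simp [ew_of_ne h1, ew_of_ne h2, ew_of_ne h3])]
  simp only [ew_self, ew_of_ne hab, ew_of_ne hab.symm, ew_of_ne hac, ew_of_ne hac.symm,
    ew_of_ne hbc, ew_of_ne hbc.symm, wLow]
  ring

theorem triF_eq (x y z : ℝ) (a b c : Fin q) :
    triF l x y z a b c = x * (l * ew l a b * ew l a c) + y * (l * ew l b a * ew l b c) +
      z * (l * ew l c a * ew l c b) := by
  have key : ∀ d : Fin q, ∑ s, ew l s a * ew l s b * ew l s c * ind s d =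
      ew l d a * ew l d b * ew l d c := by
    intro d; simp [ind]
  have : triF l x y z a b c = x * ∑ s, ew l s a * ew l s b * ew l s c * ind s a +
      y * ∑ s, ew l s a * ew l s b * ew l s c * ind s b +
      z * ∑ s, ew l s a * ew l s b * ew l s c * ind s c := by
    simp only [triF, Finset.mul_sum, ← Finset.sum_add_distrib]
    exact Finset.sum_congr rfl fun s _ => by ring
  rw [this, key, key, key, ew_self, ew_self, ew_self]
  ring

/-! ### Leaves of a star -/

/-- The level of a colour `c` with respect to the two outer colours `x`, `y` of a leaf. -/
def level (x y c : Fin q) : Fin 4 :=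
  if x = y then (if c = x then 3 else 1) else (if c = x ∨ c = y then 2 else 0)

/-- The contribution of a leaf with outer colours `x`, `y` to the lower bound functional. -/
noncomputable def leafF (l : ℝ) (x y c : Fin q) : ℝ :=
  triF l (cA q l) (cB q l) (cB q l) c x y - cD q l * triW l c x y

theorem triW_level (x y c : Fin q) : triW l c x y = wLevel q l (level x y c) := by
  unfold level
  split_ifs with h1 h2 h3
  · subst h1; subst h2; exact triW_same _
  · subst h1; exact triW_pair'' (fun h => h2 h.symm)
  · rcases h3 with rfl | rfl
    · exact triW_pair h1
    · exact triW_pair' (fun h => h1 h.symm)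
  · push Not at h3
    exact triW_distinct h3.1 h3.2 h1

theorem leafF_level (x y c : Fin q) :
    leafF l x y c = l * (1 - l) * fLevel q l (level x y c) := by
  unfold leafF
  rw [triW_level, triF_eq]
  unfold level
  split_ifs with h1 h2 h3
  · subst h1; subst h2
    simp only [ew_self, wLevel, fLevel, Matrix.cons_val, ← fHigh_eq]; ring
  · subst h1
    simp only [ew_self, ew_of_ne h2, ew_of_ne (Ne.symm h2), wLevel, fLevel, Matrix.cons_val,
      ← fMidLoop_eq]; ring
  · rcases h3 with rfl | rfl
    · simp only [ew_self, ew_of_ne h1, ew_of_ne (Ne.symm h1), wLevel, fLevel, Matrix.cons_val,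
        ← fMidPair_eq]; ring
    · simp only [ew_self, ew_of_ne h1, ew_of_ne (Ne.symm h1), wLevel, fLevel, Matrix.cons_val,
        ← fMidPair_eq]; ring
  · push Not at h3
    simp only [ew_self, ew_of_ne h1, ew_of_ne (Ne.symm h1), ew_of_ne h3.1, ew_of_ne h3.1.symm,
      ew_of_ne h3.2, ew_of_ne h3.2.symm, wLevel, fLevel, Matrix.cons_val, ← fLow_eq]; ring

/-- The tightness condition that dictated the shape of the four values. -/
theorem sum_fLevel_mul_sq (x y : Fin q) :
    ∑ c, fLevel q l (level x y c) * wLevel q l (level x y c) ^ 2 = 0 := by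
  by_cases h : x = y
  · subst h
    rw [sum_eq_one_off x _ (fMidLoop q l * wMid q l ^ 2)
      (fun z hz => by simp [level, hz, fLevel, wLevel])]
    simp [level, fLevel, wLevel, fHigh, fMidLoop]; ring
  · rw [sum_eq_two_off h _ (fLow q l * wLow q l ^ 2)
      (fun z hz hz' => by simp [level, h, hz, hz', fLevel, wLevel])]
    simp [level, h, fLevel, wLevel, fMidPair, fLow]; ring

/-- The conditional expectation of the lower bound functional at a vertex whose neighbourhood
spans no edge, up to a positive factor. -/
noncomputable def starSum (l : ℝ) (x₁ y₁ x₂ y₂ x₃ y₃ : Fin q) : ℝ :=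
  ∑ c, ∑ c₁, ∑ c₂, ∑ c₃,
    (ew l c₁ c * ew l c₁ x₁ * ew l c₁ y₁) * (ew l c₂ c * ew l c₂ x₂ * ew l c₂ y₂) *
      (ew l c₃ c * ew l c₃ x₃ * ew l c₃ y₃) *
      (cA q l * (ind c₁ c + ind c₂ c + ind c₃ c) +
        cB q l * (ind c₁ x₁ + ind c₁ y₁ + (ind c₂ x₂ + ind c₂ y₂) + (ind c₃ x₃ + ind c₃ y₃)) -
        3 * cD q l)

/-- Given the root colour the leaves are independent, and the functional is a sum of one term per
leaf. -/
theorem starSum_eq_leaf (x₁ y₁ x₂ y₂ x₃ y₃ : Fin q) :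
    starSum l x₁ y₁ x₂ y₂ x₃ y₃ = ∑ c,
      (leafF l x₁ y₁ c * (triW l c x₂ y₂ * triW l c x₃ y₃) +
        leafF l x₂ y₂ c * (triW l c x₁ y₁ * triW l c x₃ y₃) +
        leafF l x₃ y₃ c * (triW l c x₁ y₁ * triW l c x₂ y₂)) := by
  unfold starSum
  refine Finset.sum_congr rfl fun c _ => ?_
  have hl : ∀ x y : Fin q, leafF l x y c = ∑ s, ew l s c * ew l s x * ew l s y *
      (cA q l * ind s c + cB q l * ind s x + cB q l * ind s y - cD q l) := by
    intro x y
    simp only [leafF, triF, triW, Finset.mul_sum, ← Finset.sum_sub_distrib]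
    exact Finset.sum_congr rfl fun s _ => by ring
  rw [hl, hl, hl]
  unfold triW
  have h := sum_mul_mul_add (fun s => ew l s c * ew l s x₁ * ew l s y₁)
    (fun s => ew l s c * ew l s x₂ * ew l s y₂) (fun s => ew l s c * ew l s x₃ * ew l s y₃)
    (fun s => cA q l * ind s c + cB q l * ind s x₁ + cB q l * ind s y₁ - cD q l)
    (fun s => cA q l * ind s c + cB q l * ind s x₂ + cB q l * ind s y₂ - cD q l)
    (fun s => cA q l * ind s c + cB q l * ind s x₃ + cB q l * ind s y₃ - cD q l)
  refine Eq.trans ?_ (h.trans ?_)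
  · refine Finset.sum_congr rfl fun a _ => Finset.sum_congr rfl fun b _ =>
      Finset.sum_congr rfl fun d _ => ?_
    ring
  · ring

/-- The subtracted terms fᵢ pᵢ² vanish after summation over the colours, one leaf at a time, by
`sum_fLevel_mul_sq`. -/
theorem starSum_eq (x₁ y₁ x₂ y₂ x₃ y₃ : Fin q) :
    starSum l x₁ y₁ x₂ y₂ x₃ y₃ = l * (1 - l) * ∑ c,
      surplus (wLevel q l) (fLevel q l) (level x₁ y₁ c) (level x₂ y₂ c) (level x₃ y₃ c) := by
  rw [starSum_eq_leaf]
  simp only [triW_level, leafF_level]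
  have h1 := sum_fLevel_mul_sq (l := l) x₁ y₁
  have h2 := sum_fLevel_mul_sq (l := l) x₂ y₂
  have h3 := sum_fLevel_mul_sq (l := l) x₃ y₃
  have e : ∀ c, surplus (wLevel q l) (fLevel q l) (level x₁ y₁ c) (level x₂ y₂ c)
      (level x₃ y₃ c) =
      (fLevel q l (level x₁ y₁ c) * (wLevel q l (level x₂ y₂ c) * wLevel q l (level x₃ y₃ c)) +
      fLevel q l (level x₂ y₂ c) * (wLevel q l (level x₁ y₁ c) * wLevel q l (level x₃ y₃ c)) +
      fLevel q l (level x₃ y₃ c) * (wLevel q l (level x₁ y₁ c) * wLevel q l (level x₂ y₂ c))) -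
      fLevel q l (level x₁ y₁ c) * wLevel q l (level x₁ y₁ c) ^ 2 -
      fLevel q l (level x₂ y₂ c) * wLevel q l (level x₂ y₂ c) ^ 2 -
      fLevel q l (level x₃ y₃ c) * wLevel q l (level x₃ y₃ c) ^ 2 := by
    intro c; unfold surplus; ring
  simp only [e, Finset.sum_sub_distrib, h1, h2, h3, sub_zero, Finset.mul_sum]
  exact Finset.sum_congr rfl fun c _ => by ring

theorem level_ne_zero_of_two {x y c : Fin q} (hq : q = 2) : level x y c ≠ 0 := by
  subst hq
  revert x y c; unfold level; decide

theorem surplus_pos_nat (hl : 0 < l) (hl1 : l < 1) (hq : 2 ≤ q) {x₁ y₁ x₂ y₂ x₃ y₃ c : Fin q}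
    (hne : ¬ (wLevel q l (level x₁ y₁ c) = wLevel q l (level x₂ y₂ c) ∧
      wLevel q l (level x₂ y₂ c) = wLevel q l (level x₃ y₃ c)))
    (hc : q = 3 → ¬ Critical (level x₁ y₁ c) (level x₂ y₂ c) (level x₃ y₃ c)) :
    0 < surplus (wLevel q l) (fLevel q l) (level x₁ y₁ c) (level x₂ y₂ c) (level x₃ y₃ c) := by
  refine surplus_pos ?_ hl hl1 ?_ hne ?_
  · rcases hq.eq_or_lt with h | h
    · left; exact_mod_cast h.symm
    · right; exact_mod_cast h
  · intro h
    have h : q = 2 := by exact_mod_cast h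
    exact ⟨level_ne_zero_of_two h, level_ne_zero_of_two h, level_ne_zero_of_two h⟩
  · intro h hcr
    have h : q < 4 := by exact_mod_cast h
    obtain h2 | h3 : q = 2 ∨ q = 3 := by omega
    · rcases hcr.2.1 with h | h | h <;> exact level_ne_zero_of_two h2 h
    · exact hc h3 hcr

theorem surplus_nonneg_nat (hl : 0 < l) (hl1 : l < 1) (hq : 2 ≤ q) {x₁ y₁ x₂ y₂ x₃ y₃ c : Fin q}
    (hc : q = 3 → ¬ Critical (level x₁ y₁ c) (level x₂ y₂ c) (level x₃ y₃ c)) :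
    0 ≤ surplus (wLevel q l) (fLevel q l) (level x₁ y₁ c) (level x₂ y₂ c) (level x₃ y₃ c) := by
  by_cases h : wLevel q l (level x₁ y₁ c) = wLevel q l (level x₂ y₂ c) ∧
      wLevel q l (level x₂ y₂ c) = wLevel q l (level x₃ y₃ c)
  · exact (surplus_eq_zero h.1 h.2).ge
  · exact (surplus_pos_nat hl hl1 hq h hc).le

/-- With three colours, level 0 at c means that the outer colours are exactly the other two. -/
theorem level_three_of_zero : ∀ {x y c d : Fin 3}, level x y c = 0 → d ≠ c → level x y d = 2 := by
  unfold level; decide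

theorem level_three_of_one :
    ∀ {x y c : Fin 3}, level x y c = 1 → x ≠ c ∧ level x y x = 3 := by
  unfold level; decide

theorem level_three_of_one' :
    ∀ {x y c d : Fin 3}, level x y c = 1 → d ≠ c → level x y d = 1 ∨ level x y d = 3 := by
  unfold level; decide

/-- Among three colours, a critical colour is outweighed by another one. -/
theorem sum_surplus_pos_of_zero_one (hl : 0 < l) (hl1 : l < 1) {x₁ y₁ x₂ y₂ x₃ y₃ c : Fin 3}
    (h1 : level x₁ y₁ c = 0) (h2 : level x₂ y₂ c = 1) (h3 : level x₃ y₃ c ≤ 1) :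
    0 < ∑ c, surplus (wLevel 3 l) (fLevel 3 l) (level x₁ y₁ c) (level x₂ y₂ c)
      (level x₃ y₃ c) := by
  obtain ⟨hac, ha2⟩ := level_three_of_one h2
  set a := x₂ with ha
  -- The colour `a` seen by the second leaf compensates for `c`: there the first two leaves have
  -- levels 2 and 3. All colours other than `c` are noncritical, because the first leaf has level 2
  -- at them.
  have ha1 := level_three_of_zero h1 hac
  have hcast : ((3 : ℕ) : ℝ) = 3 := by norm_num
  have hrest : ∀ d, d ≠ c → 0 ≤ surplus (wLevel 3 l) (fLevel 3 l) (level x₁ y₁ d)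
      (level a y₂ d) (level x₃ y₃ d) := by
    intro d hd
    have := surplus_nonneg_nat hl hl1 (by norm_num : 2 ≤ 3) (x₁ := x₁) (y₁ := y₁) (x₂ := a)
      (y₂ := y₂) (x₃ := x₃) (y₃ := y₃) (c := d) (by
        intro _ hcr
        have := hcr.1.1
        rw [level_three_of_zero h1 hd] at this
        exact absurd this (by decide))
    rwa [hcast] at this
  have hpair : 0 < surplus (wLevel 3 l) (fLevel 3 l) (level x₁ y₁ c) (level a y₂ c)
        (level x₃ y₃ c) +
      surplus (wLevel 3 l) (fLevel 3 l) (level x₁ y₁ a) (level a y₂ a) (level x₃ y₃ a) := by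
    rw [h1, h2, ha1, ha2]
    obtain h | h : level x₃ y₃ c = 0 ∨ level x₃ y₃ c = 1 := by
      revert h3; generalize level x₃ y₃ c = z; revert z; decide
    · rw [h, level_three_of_zero h hac, surplus_swap₂₃ _ _ 0 0 1, surplus_swap₂₃ _ _ 2 2 3]
      exact surplus_001_add_surplus_223_pos l hl hl1
    · rw [h]
      rcases level_three_of_one' h hac with h | h <;> rw [h]
      · rw [surplus_swap₂₃ _ _ 2 1 3, ← surplus_swap₁₂ _ _ 2 1 3]
        exact surplus_011_add_surplus_123_pos l hl hl1
      · exact surplus_011_add_surplus_233_pos l hl hl1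
  rw [← Finset.sum_sdiff (Finset.subset_univ {c, a}), Finset.sum_pair hac.symm]
  refine add_pos_of_nonneg_of_pos (Finset.sum_nonneg fun d hd => hrest d ?_) hpair
  rintro rfl
  simp at hd

theorem sum_surplus_pos_of_critical (hl : 0 < l) (hl1 : l < 1) {x₁ y₁ x₂ y₂ x₃ y₃ c : Fin 3}
    (h : Critical (level x₁ y₁ c) (level x₂ y₂ c) (level x₃ y₃ c)) :
    0 < ∑ c, surplus (wLevel 3 l) (fLevel 3 l) (level x₁ y₁ c) (level x₂ y₂ c)
      (level x₃ y₃ c) := by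
  obtain ⟨⟨b1, b2, b3⟩, h0 | h0 | h0, h1 | h1 | h1⟩ := h
  · rw [h0] at h1; exact absurd h1 (by decide)
  · exact sum_surplus_pos_of_zero_one hl hl1 h0 h1 b3
  · simpa only [surplus_swap₂₃ _ _ (level x₁ y₁ _)] using
      sum_surplus_pos_of_zero_one hl hl1 h0 h1 b2
  · simpa only [surplus_swap₁₂ _ _ (level x₁ y₁ _)] using
      sum_surplus_pos_of_zero_one hl hl1 h0 h1 b3
  · rw [h0] at h1; exact absurd h1 (by decide)
  · have := sum_surplus_pos_of_zero_one hl hl1 h0 h1 b1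
    refine this.trans_eq (Finset.sum_congr rfl fun d _ => ?_)
    rw [surplus_swap₂₃, surplus_swap₁₂]
  · have := sum_surplus_pos_of_zero_one hl hl1 h0 h1 b2
    refine this.trans_eq (Finset.sum_congr rfl fun d _ => ?_)
    rw [surplus_swap₁₂, surplus_swap₂₃]
  · have := sum_surplus_pos_of_zero_one hl hl1 h0 h1 b1
    refine this.trans_eq (Finset.sum_congr rfl fun d _ => ?_)
    rw [surplus_swap₁₂, surplus_swap₂₃, surplus_swap₁₂]
  · rw [h0] at h1; exact absurd h1 (by decide)

theorem sum_surplus_nonneg (hl : 0 < l) (hl1 : l < 1) (hq : 2 ≤ q) (x₁ y₁ x₂ y₂ x₃ y₃ : Fin q) :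
    0 ≤ ∑ c, surplus (wLevel q l) (fLevel q l) (level x₁ y₁ c) (level x₂ y₂ c)
      (level x₃ y₃ c) := by
  by_cases hcr : q = 3 ∧ ∃ c, Critical (level x₁ y₁ c) (level x₂ y₂ c) (level x₃ y₃ c)
  · obtain ⟨rfl, c, hc⟩ := hcr
    exact_mod_cast (sum_surplus_pos_of_critical hl hl1 hc).le
  · exact Finset.sum_nonneg fun c _ =>
      surplus_nonneg_nat hl hl1 hq fun h hc => hcr ⟨h, c, hc⟩

theorem sum_surplus_pos (hl : 0 < l) (hl1 : l < 1) (hq : 2 ≤ q) {x₁ y₁ x₂ y₂ x₃ y₃ : Fin q}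
    (h : ∃ c, ¬ (wLevel q l (level x₁ y₁ c) = wLevel q l (level x₂ y₂ c) ∧
      wLevel q l (level x₂ y₂ c) = wLevel q l (level x₃ y₃ c))) :
    0 < ∑ c, surplus (wLevel q l) (fLevel q l) (level x₁ y₁ c) (level x₂ y₂ c)
      (level x₃ y₃ c) := by
  by_cases hcr : q = 3 ∧ ∃ c, Critical (level x₁ y₁ c) (level x₂ y₂ c) (level x₃ y₃ c)
  · obtain ⟨rfl, c, hc⟩ := hcr
    exact_mod_cast sum_surplus_pos_of_critical hl hl1 hc
  · obtain ⟨c, hc⟩ := h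
    exact Finset.sum_pos' (fun c _ =>
      surplus_nonneg_nat hl hl1 hq fun h hc => hcr ⟨h, c, hc⟩)
      ⟨c, Finset.mem_univ _, surplus_pos_nat hl hl1 hq hc fun h hc => hcr ⟨h, c, hc⟩⟩

theorem starSum_nonneg (hl : 0 < l) (hl1 : l < 1) (hq : 2 ≤ q) (x₁ y₁ x₂ y₂ x₃ y₃ : Fin q) :
    0 ≤ starSum l x₁ y₁ x₂ y₂ x₃ y₃ := by
  rw [starSum_eq]
  exact mul_nonneg (mul_nonneg hl.le (by linarith)) (sum_surplus_nonneg hl hl1 hq _ _ _ _ _ _)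

theorem starSum_same (x y : Fin q) : starSum l x y x y x y = 0 := by
  rw [starSum_eq, Finset.sum_eq_zero fun c _ => surplus_eq_zero rfl rfl, mul_zero]

/-- The star sum is positive if one leaf sees a monochromatic boundary and another one sees a
boundary with two colours. -/
theorem starSum_pos (hl : 0 < l) (hl1 : l < 1) (hq : 2 ≤ q) {a x₁ y₁ x₂ y₂ x₃ y₃ : Fin q}
    (h1 : level x₁ y₁ a = 3) (h2 : level x₂ y₂ a = 2 ∨ level x₃ y₃ a = 2) :
    0 < starSum l x₁ y₁ x₂ y₂ x₃ y₃ := by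
  rw [starSum_eq]
  refine mul_pos (mul_pos hl (by linarith)) (sum_surplus_pos hl hl1 hq ⟨a, ?_⟩)
  have h := wMid_lt_wHigh (q := q) hl hl1
  rintro ⟨e1, e2⟩
  rcases h2 with h2 | h2
  · rw [h1, h2] at e1; simp [wLevel] at e1; linarith
  · rw [← e1, h1, h2] at e2; simp [wLevel] at e2; linarith

end ColourSums

/-! ### Roots lying on a triangle -/

section Triangles

variable {q : ℕ} {l : ℝ}

/-! ### Neighbourhoods spanning exactly one edge -/

/-- The weight of two adjacent neighbours of the root, with outer colours `a` and `b`. -/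
noncomputable def pairW (l : ℝ) (a b c : Fin q) : ℝ := ∑ x, ew l x c * ew l x a * triW l c b x

/-- The functional of the two adjacent leaves, x being the colour of the first. The edge between
them carries 2 `cB` since it is counted at both ends, and 2 `cD` is their share of the constant. -/
noncomputable def pairF (l : ℝ) (a b c : Fin q) : ℝ :=
  ∑ x, ew l x c * ew l x a * ((cA q l * ind x c + cB q l * ind x a - 2 * cD q l) * triW l c b x +
    triF l (cA q l) (cB q l) (2 * cB q l) c b x)

theorem pairW_same_in (a : Fin q) : pairW l a a a = oneSameInW q l := by
  unfold pairW
  rw [sum_eq_one_off a _ (wMid q l) fun z hz => by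
    simp only [ew_of_ne hz, triW_pair hz.symm, one_mul]]
  simp only [ew_self, triW_same, oneSameInW, wHigh, wMid]; ring

theorem pairF_same_in (a : Fin q) : pairF l a a a = oneSameInF q l := by
  unfold pairF
  simp only [triF_eq]
  rw [sum_eq_one_off a _ ((- 2 * cD q l) * wMid q l + (cA q l + cB q l) * l ^ 2 +
    2 * cB q l * l) fun z hz => by
    simp only [ew_of_ne hz, ew_of_ne hz.symm, ew_self, ind_of_ne hz, triW_pair hz.symm]; ring]
  simp only [ew_self, ind_self, triW_same, oneSameInF, oneSameInW, wHigh, wMid]; ring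

theorem pairW_same_out {a c : Fin q} (h : a ≠ c) : pairW l a a c = oneSameOutW q l := by
  unfold pairW
  rw [sum_eq_two_off h _ (wLow q l) fun z hz hz' => by
    simp only [ew_of_ne hz, ew_of_ne hz', triW_distinct h.symm hz'.symm hz.symm, one_mul]]
  simp only [ew_self, ew_of_ne h, ew_of_ne h.symm, triW_pair' h.symm, triW_pair'' h, oneSameOutW,
    wLow, wMid]
  ring

theorem pairF_same_out {a c : Fin q} (h : a ≠ c) : pairF l a a c = oneSameOutF q l := by
  unfold pairF
  simp only [triF_eq]
  rw [sum_eq_two_off h _ ((- 2 * cD q l) * wLow q l + cA q l * l + cB q l * l +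
    2 * cB q l * l) fun z hz hz' => by
    simp only [ew_of_ne hz, ew_of_ne hz.symm, ew_of_ne hz', ew_of_ne hz'.symm, ew_of_ne h,
      ew_of_ne h.symm, ew_self, ind_of_ne hz, ind_of_ne hz',
      triW_distinct h.symm hz'.symm hz.symm]; ring]
  simp only [ew_self, ind_self, ew_of_ne h, ew_of_ne h.symm, ind_of_ne h, ind_of_ne h.symm,
    triW_pair' h.symm, triW_pair'' h, oneSameOutF, oneSameOutW, wLow, wMid]
  ring

theorem pairW_diff_in_left {a b : Fin q} (h : a ≠ b) : pairW l a b a = oneDiffInW q l := by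
  unfold pairW
  rw [sum_eq_two_off h _ (wLow q l) fun z hz hz' => by
    simp only [ew_of_ne hz, ew_of_ne hz', triW_distinct h hz.symm hz'.symm, one_mul]]
  simp only [ew_self, ew_of_ne h, ew_of_ne h.symm, triW_pair' h, triW_pair'' h.symm, oneDiffInW,
    wLow, wMid]
  ring

theorem pairF_diff_in_left {a b : Fin q} (h : a ≠ b) : pairF l a b a = oneDiffInF q l := by
  unfold pairF
  simp only [triF_eq]
  rw [sum_eq_two_off h _ ((- 2 * cD q l) * wLow q l + cA q l * l + cB q l * l +
    2 * cB q l * l) fun z hz hz' => by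
    simp only [ew_of_ne hz, ew_of_ne hz.symm, ew_of_ne hz', ew_of_ne hz'.symm, ew_of_ne h,
      ew_of_ne h.symm, ew_self, ind_of_ne hz, ind_of_ne hz',
      triW_distinct h hz.symm hz'.symm]; ring]
  simp only [ew_self, ind_self, ew_of_ne h, ew_of_ne h.symm, ind_of_ne h, ind_of_ne h.symm,
    triW_pair' h, triW_pair'' h.symm, oneDiffInF, oneDiffInW, wLow, wMid]
  ring

theorem pairW_diff_in_right {a b : Fin q} (h : a ≠ b) : pairW l a b b = oneDiffInW q l := by
  unfold pairW
  rw [sum_eq_two_off h _ (wMid q l) fun z hz hz' => by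
    simp only [ew_of_ne hz, ew_of_ne hz', triW_pair hz'.symm, one_mul]]
  simp only [ew_self, ew_of_ne h, ew_of_ne h.symm, triW_pair h.symm, triW_same, oneDiffInW,
    wHigh, wMid]
  ring

theorem pairF_diff_in_right {a b : Fin q} (h : a ≠ b) : pairF l a b b = oneDiffInF q l := by
  unfold pairF
  simp only [triF_eq]
  rw [sum_eq_two_off h _ ((- 2 * cD q l) * wMid q l + (cA q l + cB q l) * l ^ 2 +
    2 * cB q l * l) fun z hz hz' => by
    simp only [ew_of_ne hz, ew_of_ne hz.symm, ew_of_ne hz', ew_of_ne hz'.symm, ew_of_ne h,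
      ew_of_ne h.symm, ew_self, ind_of_ne hz, ind_of_ne hz', triW_pair hz'.symm]; ring]
  simp only [ew_self, ind_self, ew_of_ne h, ew_of_ne h.symm, ind_of_ne h, ind_of_ne h.symm,
    triW_pair h.symm, triW_same, oneDiffInF, oneDiffInW, wHigh, wMid]
  ring

theorem pairW_diff_out {a b c : Fin q} (h : a ≠ b) (hac : a ≠ c) (hbc : b ≠ c) :
    pairW l a b c = oneDiffOutW q l := by
  unfold pairW
  rw [sum_eq_three_off h hac hbc _ (wLow q l) fun z hz hz' hz'' => by
    simp only [ew_of_ne hz, ew_of_ne hz'', triW_distinct hbc.symm hz''.symm hz'.symm, one_mul]]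
  simp only [ew_self, ew_of_ne h, ew_of_ne h.symm, ew_of_ne hac, ew_of_ne hac.symm, ew_of_ne hbc,
    triW_distinct hbc.symm hac.symm h.symm, triW_pair' hbc.symm, triW_pair'' hbc, oneDiffOutW,
    wLow, wMid]
  ring

theorem pairF_diff_out {a b c : Fin q} (h : a ≠ b) (hac : a ≠ c) (hbc : b ≠ c) :
    pairF l a b c = oneDiffOutF q l := by
  unfold pairF
  simp only [triF_eq]
  rw [sum_eq_three_off h hac hbc _ ((- 2 * cD q l) * wLow q l + cA q l * l + cB q l * l +
    2 * cB q l * l) fun z hz hz' hz'' => by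
    simp only [ew_of_ne hz, ew_of_ne hz.symm, ew_of_ne hz', ew_of_ne hz'.symm, ew_of_ne hz'',
      ew_of_ne hz''.symm, ew_of_ne hbc, ew_of_ne hbc.symm, ew_self, ind_of_ne hz, ind_of_ne hz'',
      triW_distinct hbc.symm hz''.symm hz'.symm]; ring]
  simp only [ew_self, ind_self, ew_of_ne h, ew_of_ne h.symm, ew_of_ne hac, ew_of_ne hac.symm,
    ew_of_ne hbc, ew_of_ne hbc.symm, ind_of_ne h, ind_of_ne h.symm, ind_of_ne hac,
    ind_of_ne hac.symm, ind_of_ne hbc, ind_of_ne hbc.symm,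
    triW_distinct hbc.symm hac.symm h.symm, triW_pair' hbc.symm, triW_pair'' hbc, oneDiffOutF,
    oneDiffOutW, wLow, wMid]
  ring

/-- A sum of products of two-valued functions. -/
theorem sum_eq_crossSum (S T : Finset (Fin q)) (A B p f : Fin q → ℝ)
    {Ai Ao Bi Bo pi po fi fo : ℝ} (hA : ∀ c, A c = if c ∈ S then Ai else Ao)
    (hB : ∀ c, B c = if c ∈ S then Bi else Bo) (hp : ∀ c, p c = if c ∈ T then pi else po)
    (hf : ∀ c, f c = if c ∈ T then fi else fo) :
    ∑ c, (A c * p c + B c * f c) =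
      crossSum q S.card T.card (S ∩ T).card Ai Ao Bi Bo pi po fi fo := by
  have ind_sum : ∀ U : Finset (Fin q), ∑ c, (if c ∈ U then (1 : ℝ) else 0) = U.card := by
    intro U; simp
  have e : ∀ c, A c * p c + B c * f c = (Ao * po + Bo * fo) * 1 +
      ((Ai - Ao) * po + (Bi - Bo) * fo) * (if c ∈ S then (1 : ℝ) else 0) +
      (Ao * (pi - po) + Bo * (fi - fo)) * (if c ∈ T then (1 : ℝ) else 0) +
      ((Ai - Ao) * (pi - po) + (Bi - Bo) * (fi - fo)) * (if c ∈ S ∩ T then (1 : ℝ) else 0) := by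
    intro c
    rw [hA, hB, hp, hf]
    by_cases h1 : c ∈ S <;> by_cases h2 : c ∈ T <;> simp [h1, h2] <;> ring
  simp only [e, Finset.sum_add_distrib, ← Finset.mul_sum, ind_sum]
  simp [crossSum]; ring

/-- `crossSum` is affine in the size r of the intersection, so only the extreme intersections have
to be certified, even if one of them is not realized by colours. -/
theorem crossSum_pos_of_ends {x n m r R Ai Ao Bi Bo pi po fi fo : ℝ} (hr : 0 ≤ r) (hR : r ≤ R)
    (h0 : 0 < crossSum x n m 0 Ai Ao Bi Bo pi po fi fo)
    (h1 : 0 < crossSum x n m R Ai Ao Bi Bo pi po fi fo) :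
    0 < crossSum x n m r Ai Ao Bi Bo pi po fi fo := by
  unfold crossSum at *
  rcases hr.eq_or_lt with rfl | hr
  · exact h0
  · have hR' : 0 < R := by linarith
    have e : R * (x * (Ao * po + Bo * fo) + n * ((Ai - Ao) * po + (Bi - Bo) * fo) +
        m * (Ao * (pi - po) + Bo * (fi - fo)) +
        r * ((Ai - Ao) * (pi - po) + (Bi - Bo) * (fi - fo))) =
        (R - r) * (x * (Ao * po + Bo * fo) + n * ((Ai - Ao) * po + (Bi - Bo) * fo) +
        m * (Ao * (pi - po) + Bo * (fi - fo)) +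
        0 * ((Ai - Ao) * (pi - po) + (Bi - Bo) * (fi - fo))) +
        r * (x * (Ao * po + Bo * fo) + n * ((Ai - Ao) * po + (Bi - Bo) * fo) +
        m * (Ao * (pi - po) + Bo * (fi - fo)) +
        R * ((Ai - Ao) * (pi - po) + (Bi - Bo) * (fi - fo))) := by ring
    refine pos_of_mul_pos_right (a := R) ?_ hR'.le
    rw [e]
    exact add_pos_of_nonneg_of_pos (mul_nonneg (by linarith) h0.le) (mul_pos hr h1)

/-- The conditional expectation of the lower bound functional at a vertex exactly two of whose
neighbours are adjacent, up to a positive factor. -/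
noncomputable def pairStarSum (l : ℝ) (a b d e : Fin q) : ℝ :=
  ∑ c, ∑ c₁, ∑ c₂, ∑ c₃,
    (ew l c₁ c * ew l c₁ a) * (ew l c₂ c * ew l c₂ b * ew l c₂ c₁) *
      (ew l c₃ c * ew l c₃ d * ew l c₃ e) *
      (cA q l * (ind c₁ c + ind c₂ c + ind c₃ c) +
        cB q l * (ind c₁ a + ind c₂ b + 2 * ind c₂ c₁ + (ind c₃ d + ind c₃ e)) - 3 * cD q l)

/-- Given the root colour, the adjacent pair of leaves is independent of the third leaf. -/
theorem pairStarSum_eq (a b d e : Fin q) :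
    pairStarSum l a b d e =
      ∑ c, (pairF l a b c * triW l c d e + pairW l a b c * leafF l d e c) := by
  unfold pairStarSum
  refine Finset.sum_congr rfl fun c _ => ?_
  have h := sum_mul_add
    (fun p : Fin q × Fin q => (ew l p.1 c * ew l p.1 a) * (ew l p.2 c * ew l p.2 b * ew l p.2 p.1))
    (fun p : Fin q × Fin q => cA q l * (ind p.1 c + ind p.2 c) +
      cB q l * (ind p.1 a + ind p.2 b + 2 * ind p.2 p.1) - 2 * cD q l)
    (fun s => ew l s c * ew l s d * ew l s e)
    (fun s => cA q l * ind s c + cB q l * ind s d + cB q l * ind s e - cD q l)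
  simp only [Fintype.sum_prod_type] at h
  refine Eq.trans ?_ (h.trans ?_)
  · exact Finset.sum_congr rfl fun x _ => Finset.sum_congr rfl fun y _ =>
      Finset.sum_congr rfl fun z _ => by ring
  · congr 1
    · congr 1
      unfold pairF triF triW
      refine Finset.sum_congr rfl fun x _ => ?_
      simp only [Finset.mul_sum, ← Finset.sum_add_distrib]
      exact Finset.sum_congr rfl fun y _ => by ring
    · congr 1
      · unfold pairW triW
        simp only [Finset.mul_sum]
      · simp only [leafF, triF, triW, Finset.mul_sum, ← Finset.sum_sub_distrib]
        exact Finset.sum_congr rfl fun s _ => by ring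

theorem pairW_pairF_same (a c : Fin q) :
    pairF l a a c = (if c ∈ ({a} : Finset (Fin q)) then oneSameInF q l else oneSameOutF q l) ∧
    pairW l a a c = (if c ∈ ({a} : Finset (Fin q)) then oneSameInW q l else oneSameOutW q l) := by
  by_cases h : c = a
  · subst h; simp [pairF_same_in, pairW_same_in]
  · simp [h, pairF_same_out (Ne.symm h), pairW_same_out (Ne.symm h)]

theorem pairW_pairF_diff {a b : Fin q} (hab : a ≠ b) (c : Fin q) :
    pairF l a b c = (if c ∈ ({a, b} : Finset (Fin q)) then oneDiffInF q l else oneDiffOutF q l) ∧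
    pairW l a b c = (if c ∈ ({a, b} : Finset (Fin q)) then oneDiffInW q l else oneDiffOutW q l) := by
  by_cases h : c = a
  · subst h; simp [pairF_diff_in_left hab, pairW_diff_in_left hab]
  · by_cases h' : c = b
    · subst h'; simp [pairF_diff_in_right hab, pairW_diff_in_right hab]
    · simp [h, h', pairF_diff_out hab (Ne.symm h) (Ne.symm h'),
        pairW_diff_out hab (Ne.symm h) (Ne.symm h')]

theorem triW_leafF_loop (d c : Fin q) :
    triW l c d d = (if c ∈ ({d} : Finset (Fin q)) then wHigh q l else wMid q l) ∧
    leafF l d d c = (if c ∈ ({d} : Finset (Fin q)) then l * (1 - l) * fHigh q l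
      else l * (1 - l) * fMidLoop q l) := by
  rw [triW_level, leafF_level]
  by_cases h : c = d <;> simp [level, h, wLevel, fLevel]

theorem triW_leafF_pair {d e : Fin q} (hde : d ≠ e) (c : Fin q) :
    triW l c d e = (if c ∈ ({d, e} : Finset (Fin q)) then wMid q l else wLow q l) ∧
    leafF l d e c = (if c ∈ ({d, e} : Finset (Fin q)) then l * (1 - l) * fMidPair q l
      else l * (1 - l) * fLow q l) := by
  rw [triW_level, leafF_level]
  by_cases h : c = d ∨ c = e <;> simp [level, hde, h, wLevel, fLevel]

theorem pairStarSum_pos (hl : 0 < l) (hl1 : l < 1) (hq : 2 ≤ q) (a b d e : Fin q) :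
    0 < pairStarSum l a b d e := by
  rw [pairStarSum_eq]
  have hk : q ≠ 2 → (0 : ℝ) ≤ (q : ℝ) - 3 := by
    intro h
    have : 3 ≤ q := by omega
    have : (3 : ℝ) ≤ q := by exact_mod_cast this
    linarith
  by_cases hab : a = b <;> by_cases hde : d = e
  · subst hab; subst hde
    rw [sum_eq_crossSum {a} {d} _ _ _ _ (fun c => (pairW_pairF_same a c).1)
      (fun c => (pairW_pairF_same a c).2) (fun c => (triW_leafF_loop d c).1)
      (fun c => (triW_leafF_loop d c).2), Finset.card_singleton, Finset.card_singleton]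
    have hr : ((({a} ∩ {d} : Finset (Fin q)).card : ℕ) : ℝ) ≤ 1 := by
      exact_mod_cast (Finset.card_le_card Finset.inter_subset_left).trans
        (Finset.card_singleton a).le
    by_cases h2 : q = 2
    · subst h2
      exact crossSum_pos_of_ends (Nat.cast_nonneg _) hr
        (by exact_mod_cast crossSum_sameLoop_disjoint_two_pos l hl hl1)
        (by exact_mod_cast crossSum_sameLoop_overlap_two_pos l hl hl1)
    · have h0 := crossSum_sameLoop_disjoint_pos _ (hk h2) l hl hl1
      have h1 := crossSum_sameLoop_overlap_pos _ (hk h2) l hl hl1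
      rw [sub_add_cancel] at h0 h1
      exact crossSum_pos_of_ends (Nat.cast_nonneg _) hr (by exact_mod_cast h0)
        (by exact_mod_cast h1)
  · subst hab
    rw [sum_eq_crossSum {a} {d, e} _ _ _ _ (fun c => (pairW_pairF_same a c).1)
      (fun c => (pairW_pairF_same a c).2) (fun c => (triW_leafF_pair hde c).1)
      (fun c => (triW_leafF_pair hde c).2), Finset.card_singleton, Finset.card_pair hde]
    have hr : ((({a} ∩ {d, e} : Finset (Fin q)).card : ℕ) : ℝ) ≤ 1 := by
      exact_mod_cast (Finset.card_le_card Finset.inter_subset_left).trans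
        (Finset.card_singleton a).le
    by_cases h2 : q = 2
    · subst h2
      exact crossSum_pos_of_ends (Nat.cast_nonneg _) hr
        (by exact_mod_cast crossSum_samePair_disjoint_two_pos l hl hl1)
        (by exact_mod_cast crossSum_samePair_overlap_two_pos l hl hl1)
    · have h0 := crossSum_samePair_disjoint_pos _ (hk h2) l hl hl1
      have h1 := crossSum_samePair_overlap_pos _ (hk h2) l hl hl1
      rw [sub_add_cancel] at h0 h1
      exact crossSum_pos_of_ends (Nat.cast_nonneg _) hr (by exact_mod_cast h0)
        (by exact_mod_cast h1)
  · subst hde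
    rw [sum_eq_crossSum {a, b} {d} _ _ _ _ (fun c => (pairW_pairF_diff hab c).1)
      (fun c => (pairW_pairF_diff hab c).2) (fun c => (triW_leafF_loop d c).1)
      (fun c => (triW_leafF_loop d c).2), Finset.card_singleton, Finset.card_pair hab]
    have hr : ((({a, b} ∩ {d} : Finset (Fin q)).card : ℕ) : ℝ) ≤ 1 := by
      exact_mod_cast (Finset.card_le_card Finset.inter_subset_right).trans
        (Finset.card_singleton d).le
    by_cases h2 : q = 2
    · subst h2
      -- With two colours {a, b} is everything, so the disjoint configuration does not occur.
      have hc : (({a, b} ∩ {d} : Finset (Fin 2)).card) = 1 := by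
        clear hr
        revert a b d; decide
      rw [hc]
      exact_mod_cast crossSum_diffLoop_overlap_two_pos l hl hl1
    · have h0 := crossSum_diffLoop_disjoint_pos _ (hk h2) l hl hl1
      have h1 := crossSum_diffLoop_overlap_pos _ (hk h2) l hl hl1
      rw [sub_add_cancel] at h0 h1
      exact crossSum_pos_of_ends (Nat.cast_nonneg _) hr (by exact_mod_cast h0)
        (by exact_mod_cast h1)
  · rw [sum_eq_crossSum {a, b} {d, e} _ _ _ _ (fun c => (pairW_pairF_diff hab c).1)
      (fun c => (pairW_pairF_diff hab c).2) (fun c => (triW_leafF_pair hde c).1)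
      (fun c => (triW_leafF_pair hde c).2), Finset.card_pair hab, Finset.card_pair hde]
    have hr : ((({a, b} ∩ {d, e} : Finset (Fin q)).card : ℕ) : ℝ) ≤ 2 := by
      exact_mod_cast (Finset.card_le_card Finset.inter_subset_left).trans
        (Finset.card_pair hab).le
    by_cases h2 : q = 2
    · subst h2
      have hc : (({a, b} ∩ {d, e} : Finset (Fin 2)).card) = 2 := by
        clear hr
        revert a b d e; decide
      rw [hc]
      exact_mod_cast crossSum_diffPair_overlap_two_pos l hl hl1
    · have h0 := crossSum_diffPair_disjoint_pos _ (hk h2) l hl hl1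
      have h1 := crossSum_diffPair_overlap_pos _ (hk h2) l hl hl1
      rw [sub_add_cancel] at h0 h1
      exact crossSum_pos_of_ends (Nat.cast_nonneg _) hr (by exact_mod_cast h0)
        (by exact_mod_cast h1)

/-! ### Neighbourhoods spanning a path -/

/-- Here y colours the middle vertex of the path; once c and y are fixed, the two end vertices are
independent. -/
noncomputable def pathF (l : ℝ) (a b c : Fin q) : ℝ :=
  ∑ y, ew l y c * ((cA q l * ind y c - 3 * cD q l) * (triW l c a y * triW l c b y) +
    triF l (cA q l) (cB q l) (2 * cB q l) c a y * triW l c b y +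
    triF l (cA q l) (cB q l) (2 * cB q l) c b y * triW l c a y)

theorem pathF_same_in (a : Fin q) : pathF l a a a = pathSameInF q l := by
  unfold pathF
  simp only [triF_eq]
  rw [sum_eq_one_off a _ ((- 3 * cD q l) * wMid q l ^ 2 +
    2 * ((cA q l + cB q l) * l ^ 2 + 2 * cB q l * l) * wMid q l) fun z hz => by
    simp only [ew_of_ne hz, ew_of_ne hz.symm, ew_self, ind_of_ne hz, triW_pair hz.symm]; ring]
  simp only [ew_self, ind_self, triW_same, pathSameInF, wHigh, wMid]; ring

theorem pathF_same_out {a c : Fin q} (h : a ≠ c) : pathF l a a c = pathSameOutF q l := by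
  unfold pathF
  simp only [triF_eq]
  rw [sum_eq_two_off h _ ((- 3 * cD q l) * wLow q l ^ 2 +
    2 * (cA q l * l + cB q l * l + 2 * cB q l * l) * wLow q l) fun z hz hz' => by
    simp only [ew_of_ne hz, ew_of_ne hz.symm, ew_of_ne hz', ew_of_ne hz'.symm, ew_of_ne h,
      ew_of_ne h.symm, ew_self, ind_of_ne hz, ind_of_ne hz',
      triW_distinct h.symm hz'.symm hz.symm]; ring]
  simp only [ew_self, ind_self, ew_of_ne h, ew_of_ne h.symm, ind_of_ne h, ind_of_ne h.symm,
    triW_pair' h.symm, triW_pair'' h, pathSameOutF, wLow, wMid]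
  ring

theorem pathF_symm (a b c : Fin q) : pathF l a b c = pathF l b a c := by
  unfold pathF
  exact Finset.sum_congr rfl fun y _ => by ring

theorem pathF_diff_in {a b : Fin q} (h : a ≠ b) : pathF l a b a = pathDiffInF q l := by
  unfold pathF
  simp only [triF_eq]
  rw [sum_eq_two_off h _ ((- 3 * cD q l) * (wMid q l * wLow q l) +
    ((cA q l + cB q l) * l ^ 2 + 2 * cB q l * l) * wLow q l +
    (cA q l * l + cB q l * l + 2 * cB q l * l) * wMid q l) fun z hz hz' => by
    simp only [ew_of_ne hz, ew_of_ne hz.symm, ew_of_ne hz', ew_of_ne hz'.symm, ew_of_ne h,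
      ew_of_ne h.symm, ew_self, ind_of_ne hz, ind_of_ne hz', triW_pair hz.symm,
      triW_distinct h hz.symm hz'.symm]; ring]
  simp only [ew_self, ind_self, ew_of_ne h, ew_of_ne h.symm, ind_of_ne h, ind_of_ne h.symm,
    triW_same, triW_pair h, triW_pair' h, triW_pair'' h.symm, pathDiffInF, wHigh, wLow, wMid]
  ring

theorem pathF_diff_out {a b c : Fin q} (h : a ≠ b) (hac : a ≠ c) (hbc : b ≠ c) :
    pathF l a b c = pathDiffOutF q l := by
  unfold pathF
  simp only [triF_eq]
  rw [sum_eq_three_off h hac hbc _ ((- 3 * cD q l) * wLow q l ^ 2 +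
    2 * (cA q l * l + cB q l * l + 2 * cB q l * l) * wLow q l) fun z hz hz' hz'' => by
    simp only [ew_of_ne hz, ew_of_ne hz.symm, ew_of_ne hz', ew_of_ne hz'.symm, ew_of_ne hz'',
      ew_of_ne hz''.symm, ew_of_ne hbc, ew_of_ne hbc.symm, ew_of_ne hac, ew_of_ne hac.symm,
      ew_self, ind_of_ne hz'', triW_distinct hbc.symm hz''.symm hz'.symm,
      triW_distinct hac.symm hz''.symm hz.symm]; ring]
  simp only [ew_self, ind_self, ew_of_ne h, ew_of_ne h.symm, ew_of_ne hac, ew_of_ne hac.symm,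
    ew_of_ne hbc, ew_of_ne hbc.symm, ind_of_ne hac, ind_of_ne hac.symm, ind_of_ne hbc,
    ind_of_ne hbc.symm, triW_distinct hbc.symm hac.symm h.symm,
    triW_distinct hac.symm hbc.symm h, triW_pair' hbc.symm, triW_pair'' hbc,
    triW_pair' hac.symm, triW_pair'' hac, pathDiffOutF, wLow, wMid]
  ring

/-- The conditional expectation of the lower bound functional at a vertex whose neighbourhood
spans a path with middle vertex coloured `c₂`, up to a positive factor. -/
noncomputable def pathStarSum (l : ℝ) (a b : Fin q) : ℝ :=
  ∑ c, ∑ c₂, ∑ c₁, ∑ c₃,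
    ew l c₂ c * ((ew l c₁ c * ew l c₁ a * ew l c₁ c₂) * (ew l c₃ c * ew l c₃ b * ew l c₃ c₂)) *
      (cA q l * (ind c₁ c + ind c₂ c + ind c₃ c) +
        cB q l * (ind c₁ a + ind c₃ b + 2 * ind c₁ c₂ + 2 * ind c₃ c₂) - 3 * cD q l)

theorem pathStarSum_eq (a b : Fin q) : pathStarSum l a b = ∑ c, pathF l a b c := by
  unfold pathStarSum pathF
  refine Finset.sum_congr rfl fun c _ => Finset.sum_congr rfl fun y _ => ?_
  have h := sum_mul_add (fun x => ew l x c * ew l x a * ew l x y)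
    (fun x => cA q l * ind x c + cB q l * ind x a + 2 * cB q l * ind x y)
    (fun x => ew l x c * ew l x b * ew l x y)
    (fun x => cA q l * ind x c + cB q l * ind x b + 2 * cB q l * ind x y)
  have h' : triW l c a y * triW l c b y = ∑ x, ∑ z, (ew l x c * ew l x a * ew l x y) *
      (ew l z c * ew l z b * ew l z y) := by
    unfold triW; rw [Finset.sum_mul_sum]
  have e : ew l y c * ((cA q l * ind y c - 3 * cD q l) * (triW l c a y * triW l c b y) +
      triF l (cA q l) (cB q l) (2 * cB q l) c a y * triW l c b y +
      triF l (cA q l) (cB q l) (2 * cB q l) c b y * triW l c a y) =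
      ew l y c * ((cA q l * ind y c - 3 * cD q l) * (triW l c a y * triW l c b y) +
      (triF l (cA q l) (cB q l) (2 * cB q l) c a y * triW l c b y +
      triW l c a y * triF l (cA q l) (cB q l) (2 * cB q l) c b y)) := by ring
  rw [e, h']
  unfold triF triW
  rw [← h]
  simp only [Finset.mul_sum, ← Finset.sum_add_distrib]
  exact Finset.sum_congr rfl fun x _ => Finset.sum_congr rfl fun z _ => by ring

theorem pathStarSum_pos (hl : 0 < l) (hl1 : l < 1) (hq : 2 ≤ q) (a b : Fin q) :
    0 < pathStarSum l a b := by
  rw [pathStarSum_eq]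
  have hk : (0 : ℝ) ≤ (q : ℝ) - 2 := by
    have : (2 : ℝ) ≤ q := by exact_mod_cast hq
    linarith
  by_cases hab : a = b
  · subst hab
    rw [sum_eq_one_off a _ (pathSameOutF q l) fun z hz => pathF_same_out (Ne.symm hz),
      pathF_same_in]
    have h := pathSame_pos _ hk l hl hl1
    rwa [sub_add_cancel] at h
  · rw [sum_eq_two_off hab _ (pathDiffOutF q l)
      fun z hz hz' => pathF_diff_out hab (Ne.symm hz) (Ne.symm hz'), pathF_diff_in hab,
      pathF_symm, pathF_diff_in (Ne.symm hab)]
    have h := pathDiff_pos _ hk l hl hl1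
    rw [sub_add_cancel] at h
    linarith

/-! ### Complete neighbourhoods -/

/-- The expectation of the lower bound functional at a vertex whose neighbours are pairwise
adjacent, up to a positive factor. -/
noncomputable def cliqueStarSum (q : ℕ) (l : ℝ) : ℝ :=
  ∑ c : Fin q, ∑ c₁ : Fin q, ∑ c₂ : Fin q, ∑ c₃ : Fin q,
    ew l c₁ c * (ew l c₂ c * ew l c₂ c₁) * (ew l c₃ c * ew l c₃ c₁ * ew l c₃ c₂) *
      (cA q l * (ind c₁ c + ind c₂ c + ind c₃ c) +
        cB q l * (2 * ind c₂ c₁ + 2 * ind c₃ c₁ + 2 * ind c₃ c₂) - 3 * cD q l)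

/-- There is no boundary, so by colour symmetry each root colour contributes the same amount. -/
theorem cliqueStarSum_eq : cliqueStarSum q l = q * cliqueF q l := by
  have hc : ∀ c : Fin q, ∑ c₁ : Fin q, ∑ c₂ : Fin q, ∑ c₃ : Fin q,
    ew l c₁ c * (ew l c₂ c * ew l c₂ c₁) * (ew l c₃ c * ew l c₃ c₁ * ew l c₃ c₂) *
      (cA q l * (ind c₁ c + ind c₂ c + ind c₃ c) +
        cB q l * (2 * ind c₂ c₁ + 2 * ind c₃ c₁ + 2 * ind c₃ c₂) - 3 * cD q l) = cliqueF q l := by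
    intro c
    have h1 : ∀ x y : Fin q, ∑ c₃ : Fin q,
        ew l x c * (ew l y c * ew l y x) * (ew l c₃ c * ew l c₃ x * ew l c₃ y) *
        (cA q l * (ind x c + ind y c + ind c₃ c) +
          cB q l * (2 * ind y x + 2 * ind c₃ x + 2 * ind c₃ y) - 3 * cD q l) =
        ew l x c * (ew l y c * ew l y x) * ((cA q l * (ind x c + ind y c) +
          cB q l * (2 * ind y x) - 3 * cD q l) * triW l c x y +
          triF l (cA q l) (2 * cB q l) (2 * cB q l) c x y) := by
      intro x y
      unfold triW triF
      simp only [Finset.mul_sum, ← Finset.sum_add_distrib]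
      exact Finset.sum_congr rfl fun z _ => by ring
    simp only [h1, triF_eq]
    have h2 : ∀ x : Fin q, x ≠ c → ∑ y : Fin q, ew l x c * (ew l y c * ew l y x) *
        ((cA q l * (ind x c + ind y c) + cB q l * (2 * ind y x) - 3 * cD q l) * triW l c x y +
          (cA q l * (l * ew l c x * ew l c y) + 2 * cB q l * (l * ew l x c * ew l x y) +
          2 * cB q l * (l * ew l y c * ew l y x))) =
        l * ((2 * cB q l - 3 * cD q l) * wMid q l + cA q l * l + 4 * cB q l * l ^ 2) +
        l * ((cA q l - 3 * cD q l) * wMid q l + cA q l * l ^ 2 + 2 * cB q l * (l + l ^ 2)) +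
        ((q : ℝ) - 2) * ((-3 * cD q l) * wLow q l + cA q l * l + 4 * cB q l * l) := by
      intro x h
      rw [sum_eq_two_off h _ ((-3 * cD q l) * wLow q l + cA q l * l + 4 * cB q l * l)
        fun z hz hz' => by
          simp only [ew_of_ne hz, ew_of_ne hz.symm, ew_of_ne hz', ew_of_ne hz'.symm, ew_of_ne h,
            ew_of_ne h.symm, ind_of_ne h, ind_of_ne hz, ind_of_ne hz',
            triW_distinct h.symm hz'.symm hz.symm]; ring]
      simp only [ew_self, ind_self, ew_of_ne h, ew_of_ne h.symm, ind_of_ne h, ind_of_ne h.symm,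
        triW_pair' h.symm, triW_pair'' h]
      ring
    rw [sum_eq_one_off c _ _ h2, sum_eq_one_off c _ (l * ((cA q l - 3 * cD q l) * wMid q l +
      cA q l * l ^ 2 + 2 * cB q l * (l + l ^ 2))) fun z hz => by
        simp only [ew_self, ind_self, ew_of_ne hz, ew_of_ne hz.symm, ind_of_ne hz,
          triW_pair hz.symm]; ring]
    simp only [ew_self, ind_self, triW_same, cliqueF, wHigh, wMid, wLow]
    ring
  unfold cliqueStarSum
  simp only [hc, Finset.sum_const, Finset.card_univ, Fintype.card_fin, nsmul_eq_mul]

theorem cliqueStarSum_pos (hl : 0 < l) (hl1 : l < 1) (hq : 2 ≤ q) : 0 < cliqueStarSum q l := by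
  rw [cliqueStarSum_eq]
  have hk : (2 : ℝ) ≤ q := by exact_mod_cast hq
  have h := clique_pos ((q : ℝ) - 2) (by linarith) l hl hl1
  rw [sub_add_cancel] at h
  exact mul_pos (by linarith) h

end Triangles

/-! ### The upper bound functional on an edge -/

/-- `uD`, `uA`, `uC` solve two homogeneous linear equations, `edgeForm_loop_loop_same` and
`edgeForm_pair_pair_same`: the edge functional must vanish for equal boundaries of either kind. -/
def uD (q l : ℝ) : ℝ :=
  (4 * l) * q ^ 2 + ((-12) * l + 4 * l ^ 2 + 8 * l ^ 3) * q + (8 * l + (-4) * l ^ 2 +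
        (-8) * l ^ 3 + 4 * l ^ 6)

def uA (q l : ℝ) : ℝ :=
  (4) * q ^ 3 + ((-20) + 12 * l + 4 * l ^ 2 + 4 * l ^ 3) * q ^ 2 + (32 + (-36) * l +
        (-8) * l ^ 2 + (-4) * l ^ 3 + 16 * l ^ 4) * q + ((-16) + 24 * l + 4 * l ^ 2 +
        (-24) * l ^ 4 + 8 * l ^ 5 + 4 * l ^ 6)

def uC (q l : ℝ) : ℝ :=
  ((-1) + 3 * l + (-1) * l ^ 2 + (-1) * l ^ 3) * q ^ 2 + (3 + (-9) * l + 5 * l ^ 2 + 5 * l ^ 3 +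
        (-4) * l ^ 4) * q + ((-2) + 6 * l + (-4) * l ^ 2 + (-4) * l ^ 3 + 6 * l ^ 4 +
        (-2) * l ^ 5)

/-- The value of the upper bound functional on an edge whose ends have boundaries of `n` and `m`
colours, `r` of them common; `s` and `s'` are the boundary weights of these colours, `e` and `e'`
the weighted numbers of monochromatic boundary edges. -/
def edgeForm (q l n m r s e s' e' : ℝ) : ℝ :=
  uD q l * ((q + n * (s - 1)) * (q + m * (s' - 1))) -
    uC q l * (n * e * (q + m * (s' - 1)) + (q + n * (s - 1)) * (m * e')) +
    crossSum q n m r (-((1 - l) * uD q l + l * uA q l) * s + (1 - l) * uC q l * e)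
      (-((1 - l) * uD q l + l * uA q l)) ((1 - l) * uC q l * s) ((1 - l) * uC q l) s' 1 e' 0

theorem edgeForm_loop_loop_disjoint_pos (k : ℝ) (hk : 0 ≤ k) (l : ℝ) (hl : 0 < l) (hl1 : l < 1) :
    0 < edgeForm (k + 2) l 1 1 0 (l ^ 2) (2 * l ^ 2) (l ^ 2) (2 * l ^ 2) := by
  obtain ⟨t, ht, htl⟩ : ∃ t : ℝ, 0 < t ∧ t = 1 - l := ⟨1 - l, by linarith, rfl⟩
  have key : edgeForm (k + 2) l 1 1 0 (l ^ 2) (2 * l ^ 2) (l ^ 2) (2 * l ^ 2) =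
      l ^ 1 * t ^ 2 * ((l * (4 + l * (16 + l * (28 + l * (32 + l * (28 + l * (16 +
        l * (4)))))))) +
      k * (4 + l * (16 + l * (48 + l * (56 + l * (44 + l * (24)))))) +
      k ^ 2 * (8 + l * (20 + l * (36 + l * (28 + l * (4))))) +
      k ^ 3 * (4 + l * (8 + l * (4)))) := by
    rw [htl]
    simp only [edgeForm, crossSum, uD, uA, uC]
    ring
  rw [key]
  positivity

theorem edgeForm_pair_pair_disjoint_pos (k : ℝ) (hk : 0 ≤ k) (l : ℝ) (hl : 0 < l) (hl1 : l < 1) :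
    0 < edgeForm (k + 2) l 2 2 0 l l l l := by
  obtain ⟨t, ht, htl⟩ : ∃ t : ℝ, 0 < t ∧ t = 1 - l := ⟨1 - l, by linarith, rfl⟩
  have key : edgeForm (k + 2) l 2 2 0 l l l l =
      l ^ 1 * t ^ 2 * ((l * (8 + l * (24 + l * (8 + l * (8 + l * (16)))))) +
      k * (4 + l * (36 + l * (28 + l * (12 + l * (16))))) +
      k ^ 2 * (12 + l * (28 + l * (4 + l * (4)))) +
      k ^ 3 * (8)) := by
    rw [htl]
    simp only [edgeForm, crossSum, uD, uA, uC]
    ring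
  rw [key]
  positivity

/-- The form is affine in the intersection size and vanishes at 2, so this is half the disjoint
value. -/
theorem edgeForm_pair_pair_one_pos (k : ℝ) (hk : 0 ≤ k) (l : ℝ) (hl : 0 < l) (hl1 : l < 1) :
    0 < edgeForm (k + 2) l 2 2 1 l l l l := by
  obtain ⟨t, ht, htl⟩ : ∃ t : ℝ, 0 < t ∧ t = 1 - l := ⟨1 - l, by linarith, rfl⟩
  have key : edgeForm (k + 2) l 2 2 1 l l l l =
      l ^ 1 * t ^ 2 * ((l * (4 + l * (12 + l * (4 + l * (4 + l * (8)))))) +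
      k * (2 + l * (18 + l * (14 + l * (6 + l * (8))))) +
      k ^ 2 * (6 + l * (14 + l * (2 + l * (2)))) +
      k ^ 3 * (4)) := by
    rw [htl]
    simp only [edgeForm, crossSum, uD, uA, uC]
    ring
  rw [key]
  positivity

theorem edgeForm_loop_pair_disjoint_pos (k : ℝ) (hk : 0 ≤ k) (l : ℝ) (hl : 0 < l) (hl1 : l < 1) :
    0 < edgeForm (k + 2) l 1 2 0 (l ^ 2) (2 * l ^ 2) l l := by
  obtain ⟨t, ht, htl⟩ : ∃ t : ℝ, 0 < t ∧ t = 1 - l := ⟨1 - l, by linarith, rfl⟩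
  have key : edgeForm (k + 2) l 1 2 0 (l ^ 2) (2 * l ^ 2) l l =
      l ^ 1 * t ^ 2 * ((l * (4 + l * (16 + l * (24 + l * (24 + l * (20 + l * (8))))))) +
      k * (4 + l * (20 + l * (40 + l * (40 + l * (36 + l * (4)))))) +
      k ^ 2 * (10 + l * (20 + l * (26 + l * (16)))) +
      k ^ 3 * (6 + l * (4 + l * (2)))) := by
    rw [htl]
    simp only [edgeForm, crossSum, uD, uA, uC]
    ring
  rw [key]
  positivity

theorem edgeForm_loop_pair_overlap_pos (k : ℝ) (hk : 0 ≤ k) (l : ℝ) (hl : 0 < l) (hl1 : l < 1) :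
    0 < edgeForm (k + 2) l 1 2 1 (l ^ 2) (2 * l ^ 2) l l := by
  obtain ⟨t, ht, htl⟩ : ∃ t : ℝ, 0 < t ∧ t = 1 - l := ⟨1 - l, by linarith, rfl⟩
  have key : edgeForm (k + 2) l 1 2 1 (l ^ 2) (2 * l ^ 2) l l =
      l ^ 1 * t ^ 2 * ((l ^ 2 * (2 + l * (8 + l * (12 + l * (8 + l * (2)))))) +
      k * (1 + l * (4 + l * (6 + l * (20 + l * (17))))) +
      k ^ 2 * (l ^ 4 * (24)) +
      k ^ 2 * t * (3 + l * (7 + l * (13 + l * (25)))) +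
      k ^ 3 * (2 + l ^ 2 * (2))) := by
    rw [htl]
    simp only [edgeForm, crossSum, uD, uA, uC]
    ring
  rw [key]
  positivity

/-- The coefficient of the energy in the summed upper bound, by which one divides. -/
theorem uA_add_four_uC_pos (k : ℝ) (hk : 0 ≤ k) (l : ℝ) (hl : 0 < l) (hl1 : l < 1) :
    0 < uA (k + 3) l + 4 * uC (k + 3) l := by
  have key : uA (k + 3) l + 4 * uC (k + 3) l =
      ((l * (48 + l * (24 + l * (32 + l ^ 3 * (4))))) +
      k * (8 + l * (72 + l * (12 + l * (16)))) +
      k ^ 2 * (12 + l * (24)) +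
      k ^ 3 * (4)) := by
    simp only [uD, uA, uC]
    ring
  rw [key]
  positivity

theorem uA_add_four_uC_two_pos (l : ℝ) (hl : 0 < l) (hl1 : l < 1) :
    0 < uA 2 l + 4 * uC 2 l := by
  have key : uA 2 l + 4 * uC 2 l =
      l ^ 2 * ((12 + l * (16 + l ^ 3 * (4)))) := by
    simp only [uD, uA, uC]
    ring
  rw [key]
  positivity

theorem edgeForm_loop_loop_same (q l : ℝ) :
    edgeForm q l 1 1 1 (l ^ 2) (2 * l ^ 2) (l ^ 2) (2 * l ^ 2) = 0 := by
  simp only [edgeForm, crossSum, uD, uA, uC]; ring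

theorem edgeForm_pair_pair_same (q l : ℝ) : edgeForm q l 2 2 2 l l l l = 0 := by
  simp only [edgeForm, crossSum, uD, uA, uC]; ring

section Edge

variable {q : ℕ} {l : ℝ}

/-- The conditional expectation of the upper bound functional on an edge, up to a positive
factor. -/
noncomputable def edgeSum (l : ℝ) (x₁ y₁ x₂ y₂ : Fin q) : ℝ :=
  ∑ a, ∑ b, ew l b a * (ew l a x₁ * ew l a y₁) * (ew l b x₂ * ew l b y₂) *
    (uD q l - uA q l * ind b a -
      uC q l * (ind a x₁ + ind a y₁ + (ind b x₂ + ind b y₂)))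

theorem edgeSum_symm (x₁ y₁ x₂ y₂ : Fin q) : edgeSum l x₁ y₁ x₂ y₂ = edgeSum l x₂ y₂ x₁ y₁ := by
  unfold edgeSum
  rw [Finset.sum_comm]
  refine Finset.sum_congr rfl fun a _ => Finset.sum_congr rfl fun b _ => ?_
  rw [ew_comm a b, ind_comm a b]; ring

/-- First treat the two ends as if the edge between them had weight 1 and no energy; the sum then
factors. The correction lives on equal end colours and is a `crossSum`. -/
theorem edgeSum_eq (x₁ y₁ x₂ y₂ : Fin q) {s e s' e' : ℝ} (S T : Finset (Fin q))
    (hs : ∀ c, ew l c x₁ * ew l c y₁ = if c ∈ S then s else 1)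
    (he : ∀ c, ew l c x₁ * ew l c y₁ * (ind c x₁ + ind c y₁) = if c ∈ S then e else 0)
    (hs' : ∀ c, ew l c x₂ * ew l c y₂ = if c ∈ T then s' else 1)
    (he' : ∀ c, ew l c x₂ * ew l c y₂ * (ind c x₂ + ind c y₂) = if c ∈ T then e' else 0) :
    edgeSum l x₁ y₁ x₂ y₂ = edgeForm q l S.card T.card (S ∩ T).card s e s' e' := by
  set w : Fin q → ℝ := fun c => ew l c x₁ * ew l c y₁ with hw
  set v : Fin q → ℝ := fun c => w c * (ind c x₁ + ind c y₁) with hv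
  set w' : Fin q → ℝ := fun c => ew l c x₂ * ew l c y₂ with hw'
  set v' : Fin q → ℝ := fun c => w' c * (ind c x₂ + ind c y₂) with hv'
  have hsum : ∀ (U : Finset (Fin q)) (i o : ℝ), ∑ c, (if c ∈ U then i else o) =
      (q : ℝ) * o + U.card * (i - o) := by
    intro U i o
    have : ∀ c, (if c ∈ U then i else o) = o + (i - o) * (if c ∈ U then (1 : ℝ) else 0) := by
      intro c; split_ifs <;> ring
    simp only [this, Finset.sum_add_distrib, ← Finset.mul_sum]
    simp; ring
  have e1 : ∑ c, w c = q + S.card * (s - 1) := by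
    rw [Finset.sum_congr rfl fun c _ => hs c, hsum]; ring
  have e2 : ∑ c, v c = S.card * e := by
    rw [Finset.sum_congr rfl fun c _ => he c, hsum]; ring
  have e3 : ∑ c, w' c = q + T.card * (s' - 1) := by
    rw [Finset.sum_congr rfl fun c _ => hs' c, hsum]; ring
  have e4 : ∑ c, v' c = T.card * e' := by
    rw [Finset.sum_congr rfl fun c _ => he' c, hsum]; ring
  have hcross := sum_eq_crossSum S T
    (fun c => -((1 - l) * uD q l + l * uA q l) * w c + (1 - l) * uC q l * v c)
    (fun c => (1 - l) * uC q l * w c) w' v'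
    (Ai := -((1 - l) * uD q l + l * uA q l) * s + (1 - l) * uC q l * e)
    (Ao := -((1 - l) * uD q l + l * uA q l)) (Bi := (1 - l) * uC q l * s)
    (Bo := (1 - l) * uC q l) (pi := s') (po := 1) (fi := e') (fo := 0)
    (fun c => by
      have h1 : w c = if c ∈ S then s else 1 := hs c
      have h2 : v c = if c ∈ S then e else 0 := he c
      simp only [h1, h2]; split_ifs <;> ring)
    (fun c => by simp only [hw, hs]; split_ifs <;> ring) hs' he'
  have hinner : ∀ a, ∑ b, ew l b a * w a * w' b * (uD q l - uA q l * ind b a -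
      uC q l * (ind a x₁ + ind a y₁ + (ind b x₂ + ind b y₂))) =
      (uD q l * w a - uC q l * v a) * ∑ b, w' b - uC q l * w a * ∑ b, v' b +
      ((-((1 - l) * uD q l + l * uA q l) * w a + (1 - l) * uC q l * v a) * w' a +
        (1 - l) * uC q l * w a * v' a) := by
    intro a
    have hb : ∀ b, ew l b a * w a * w' b * (uD q l - uA q l * ind b a -
        uC q l * (ind a x₁ + ind a y₁ + (ind b x₂ + ind b y₂))) =
        ((uD q l * w a - uC q l * v a) * w' b - uC q l * w a * v' b) +
        (if b = a then ((-((1 - l) * uD q l + l * uA q l) * w b + (1 - l) * uC q l * v b) * w' b +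
        (1 - l) * uC q l * w b * v' b) else 0) := by
      intro b
      by_cases h : b = a
      · subst h
        simp only [ew_self, ind_self, if_true, hv, hv']; ring
      · simp only [ew_of_ne h, ind_of_ne h, if_neg h, hv, hv']; ring
    simp only [hb, Finset.sum_add_distrib, Finset.sum_sub_distrib, ← Finset.mul_sum,
      Finset.sum_ite_eq', Finset.mem_univ, if_true]
  have hmain : edgeSum l x₁ y₁ x₂ y₂ = ∑ a, ∑ b, ew l b a * w a * w' b *
      (uD q l - uA q l * ind b a - uC q l * (ind a x₁ + ind a y₁ + (ind b x₂ + ind b y₂))) := rfl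
  rw [hmain, Finset.sum_congr rfl fun a _ => hinner a, Finset.sum_add_distrib, hcross,
    Finset.sum_sub_distrib, ← Finset.sum_mul, ← Finset.sum_mul, Finset.sum_sub_distrib,
    ← Finset.mul_sum, ← Finset.mul_sum, ← Finset.mul_sum, e1, e2, e3, e4]
  unfold edgeForm
  ring

theorem boundary_loop (x c : Fin q) :
    ew l c x * ew l c x = (if c ∈ ({x} : Finset (Fin q)) then l ^ 2 else 1) ∧
    ew l c x * ew l c x * (ind c x + ind c x) =
      (if c ∈ ({x} : Finset (Fin q)) then 2 * l ^ 2 else 0) := by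
  by_cases h : c = x
  · subst h; simp only [ew_self, ind_self, Finset.mem_singleton, if_true]; constructor <;> ring
  · simp [ew_of_ne h, ind_of_ne h, h]

theorem boundary_pair {x y : Fin q} (hxy : x ≠ y) (c : Fin q) :
    ew l c x * ew l c y = (if c ∈ ({x, y} : Finset (Fin q)) then l else 1) ∧
    ew l c x * ew l c y * (ind c x + ind c y) =
      (if c ∈ ({x, y} : Finset (Fin q)) then l else 0) := by
  by_cases h : c = x
  · subst h; simp [ew_self, ind_self, ew_of_ne hxy, ind_of_ne hxy]
  · by_cases h' : c = y
    · subst h'; simp [ew_self, ind_self, ew_of_ne h, ind_of_ne h]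
    · simp [ew_of_ne h, ind_of_ne h, ew_of_ne h', ind_of_ne h', h, h']

theorem edgeSum_same (x y : Fin q) : edgeSum l x y x y = 0 := by
  by_cases h : x = y
  · subst h
    rw [edgeSum_eq x x x x {x} {x} (fun c => (boundary_loop x c).1)
      (fun c => (boundary_loop x c).2) (fun c => (boundary_loop x c).1)
      (fun c => (boundary_loop x c).2), Finset.inter_self, Finset.card_singleton, Nat.cast_one]
    exact edgeForm_loop_loop_same _ _
  · rw [edgeSum_eq x y x y {x, y} {x, y} (fun c => (boundary_pair h c).1)
      (fun c => (boundary_pair h c).2) (fun c => (boundary_pair h c).1)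
      (fun c => (boundary_pair h c).2), Finset.inter_self, Finset.card_pair h, Nat.cast_ofNat]
    exact edgeForm_pair_pair_same _ _

theorem edgeSum_loop_pair_pos (hl : 0 < l) (hl1 : l < 1) (hq : 2 ≤ q) (x : Fin q) {y z : Fin q}
    (h : y ≠ z) : 0 < edgeSum l x x y z := by
  have hk : (0 : ℝ) ≤ (q : ℝ) - 2 := by
    have : (2 : ℝ) ≤ q := by exact_mod_cast hq
    linarith
  have h0 := edgeForm_loop_pair_disjoint_pos _ hk l hl hl1
  have h1 := edgeForm_loop_pair_overlap_pos _ hk l hl hl1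
  rw [sub_add_cancel] at h0 h1
  rw [edgeSum_eq x x y z {x} {y, z} (fun c => (boundary_loop x c).1)
    (fun c => (boundary_loop x c).2) (fun c => (boundary_pair h c).1)
    (fun c => (boundary_pair h c).2), Finset.card_singleton, Finset.card_pair h]
  have hr : (({x} ∩ {y, z} : Finset (Fin q)).card) ≤ 1 :=
    (Finset.card_le_card Finset.inter_subset_left).trans (Finset.card_singleton x).le
  interval_cases (({x} ∩ {y, z} : Finset (Fin q)).card)
  · exact_mod_cast h0
  · exact_mod_cast h1

theorem edgeSum_nonneg (hl : 0 < l) (hl1 : l < 1) (hq : 2 ≤ q) (x y z w : Fin q) :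
    0 ≤ edgeSum l x y z w := by
  have hk : (0 : ℝ) ≤ (q : ℝ) - 2 := by
    have : (2 : ℝ) ≤ q := by exact_mod_cast hq
    linarith
  by_cases h : x = y <;> by_cases h' : z = w
  · subst h; subst h'
    by_cases hxz : x = z
    · subst hxz; exact (edgeSum_same x x).ge
    · have h0 := edgeForm_loop_loop_disjoint_pos _ hk l hl hl1
      rw [sub_add_cancel] at h0
      rw [edgeSum_eq x x z z {x} {z} (fun c => (boundary_loop x c).1)
        (fun c => (boundary_loop x c).2) (fun c => (boundary_loop z c).1)
        (fun c => (boundary_loop z c).2), Finset.card_singleton, Finset.card_singleton,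
        Finset.singleton_inter_of_notMem (by simpa using hxz), Finset.card_empty]
      exact_mod_cast h0.le
  · subst h; exact (edgeSum_loop_pair_pos hl hl1 hq x h').le
  · subst h'; rw [edgeSum_symm]; exact (edgeSum_loop_pair_pos hl hl1 hq z h).le
  · have h0 := edgeForm_pair_pair_disjoint_pos _ hk l hl hl1
    have h1 := edgeForm_pair_pair_one_pos _ hk l hl hl1
    rw [sub_add_cancel] at h0 h1
    rw [edgeSum_eq x y z w {x, y} {z, w} (fun c => (boundary_pair h c).1)
      (fun c => (boundary_pair h c).2) (fun c => (boundary_pair h' c).1)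
      (fun c => (boundary_pair h' c).2), Finset.card_pair h, Finset.card_pair h']
    have hr : (({x, y} ∩ {z, w} : Finset (Fin q)).card) ≤ 2 :=
      (Finset.card_le_card Finset.inter_subset_left).trans (Finset.card_pair h).le
    interval_cases (({x, y} ∩ {z, w} : Finset (Fin q)).card)
    · exact_mod_cast h0.le
    · exact_mod_cast h1.le
    · exact_mod_cast (edgeForm_pair_pair_same (q : ℝ) l).ge

theorem uA_add_four_mul_uC_pos (hl : 0 < l) (hl1 : l < 1) (hq : 2 ≤ q) :
    0 < uA q l + 4 * uC q l := by
  rcases hq.eq_or_lt with h | h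
  · subst h; exact_mod_cast uA_add_four_uC_two_pos l hl hl1
  · have : (3 : ℝ) ≤ q := by exact_mod_cast h
    have h0 := uA_add_four_uC_pos ((q : ℝ) - 3) (by linarith) l hl hl1
    rwa [sub_add_cancel] at h0

end Edge

/-! ### Local energies -/

section Energy

open scoped Classical

variable {V : Type*} [Fintype V] {G : SimpleGraph V} {q : ℕ}

/-- The number of monochromatic edges at `x`. -/
noncomputable def localMono (G : SimpleGraph V) (σ : V → Fin q) (x : V) : ℝ :=
  ∑ y, if G.Adj x y then ind (σ x) (σ y) else 0

theorem two_mul_monoEdges (G : SimpleGraph V) (σ : V → Fin q) :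
    2 * (monoEdges G σ : ℝ) = ∑ x, localMono G σ x := by
  -- Handshake lemma for the subgraph of monochromatic edges.
  let H : SimpleGraph V :=
    { Adj := fun x y => G.Adj x y ∧ σ x = σ y
      symm := ⟨fun _ _ h => ⟨h.1.symm, h.2.symm⟩⟩
      loopless := ⟨fun _ h => G.irrefl h.1⟩ }
  have h1 : monoEdges G σ = H.edgeFinset.card := by
    unfold monoEdges
    congr 1
    ext e
    induction e using Sym2.ind with
    | _ x y => simp [H]
  have h2 : ∀ x, localMono G σ x = H.degree x := by
    intro x
    unfold localMono
    rw [← SimpleGraph.card_neighborFinset_eq_degree, Finset.card_eq_sum_ones, Nat.cast_sum,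
      SimpleGraph.neighborFinset_eq_filter, Finset.sum_filter]
    refine Finset.sum_congr rfl fun y _ => ?_
    by_cases h : G.Adj x y <;> by_cases h' : σ x = σ y <;> simp [H, h, h', ind]
  rw [h1, Finset.sum_congr rfl fun x _ => h2 x, ← Nat.cast_sum, H.sum_degrees_eq_twice_card_edges]
  push_cast
  ring

/-- The number of monochromatic edges meeting `s`. -/
noncomputable def touching (G : SimpleGraph V) (s : Finset V) (σ : V → Fin q) : ℝ :=
  ∑ x ∈ s, localMono G σ x -
    (∑ x ∈ s, ∑ y ∈ s, if G.Adj x y then ind (σ x) (σ y) else 0) / 2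

theorem monoEdges_sub_touching (G : SimpleGraph V) (s : Finset V) (σ : V → Fin q) :
    2 * ((monoEdges G σ : ℝ) - touching G s σ) =
      ∑ x ∈ sᶜ, ∑ y ∈ sᶜ, if G.Adj x y then ind (σ x) (σ y) else 0 := by
  set a : V → V → ℝ := fun x y => if G.Adj x y then ind (σ x) (σ y) else 0 with ha
  have hsymm : ∀ x y, a x y = a y x := by
    intro x y; simp only [ha, G.adj_comm x y, ind_comm (σ x)]
  have h1 : ∑ x, ∑ y, a x y = ∑ x ∈ s, ∑ y, a x y + ∑ x ∈ sᶜ, ∑ y, a x y :=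
    (Finset.sum_add_sum_compl s _).symm
  have h2 : ∑ x ∈ sᶜ, ∑ y, a x y = ∑ x ∈ sᶜ, ∑ y ∈ s, a x y + ∑ x ∈ sᶜ, ∑ y ∈ sᶜ, a x y := by
    rw [← Finset.sum_add_distrib]
    exact Finset.sum_congr rfl fun x _ => (Finset.sum_add_sum_compl s _).symm
  have h3 : ∑ x ∈ sᶜ, ∑ y ∈ s, a x y = ∑ y ∈ s, ∑ x ∈ sᶜ, a y x := by
    rw [Finset.sum_comm]
    exact Finset.sum_congr rfl fun y _ => Finset.sum_congr rfl fun x _ => hsymm x y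
  have h4 : ∑ x ∈ s, ∑ y, a x y = ∑ x ∈ s, ∑ y ∈ s, a x y + ∑ x ∈ s, ∑ y ∈ sᶜ, a x y := by
    rw [← Finset.sum_add_distrib]
    exact Finset.sum_congr rfl fun x _ => (Finset.sum_add_sum_compl s _).symm
  have h5 : 2 * (monoEdges G σ : ℝ) = ∑ x, ∑ y, a x y := two_mul_monoEdges G σ
  have h6 : touching G s σ = ∑ x ∈ s, ∑ y, a x y - (∑ x ∈ s, ∑ y ∈ s, a x y) / 2 := rfl
  rw [h6, mul_sub, h5]
  linarith

/-- The edges not meeting `s` see only colours outside `s`; hence the Boltzmann weight splits into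
an outer factor and a local one. -/
theorem monoEdges_sub_touching_congr (G : SimpleGraph V) {s : Finset V} {σ τ : V → Fin q}
    (h : ∀ x ∉ s, σ x = τ x) :
    (monoEdges G σ : ℝ) - touching G s σ = monoEdges G τ - touching G s τ := by
  have h1 := monoEdges_sub_touching G s σ
  have h2 := monoEdges_sub_touching G s τ
  have h3 : (∑ x ∈ sᶜ, ∑ y ∈ sᶜ, if G.Adj x y then ind (σ x) (σ y) else 0) =
      ∑ x ∈ sᶜ, ∑ y ∈ sᶜ, if G.Adj x y then ind (τ x) (τ y) else 0 := by
    refine Finset.sum_congr rfl fun x hx => Finset.sum_congr rfl fun y hy => ?_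
    rw [h x (Finset.mem_compl.1 hx), h y (Finset.mem_compl.1 hy)]
  linarith

/-- The Boltzmann weight of a colouring. -/
noncomputable def boltz (G : SimpleGraph V) (β : ℝ) (σ : V → Fin q) : ℝ :=
  Real.exp (-β * (monoEdges G σ : ℝ))

theorem ew_eq_exp (β : ℝ) (a b : Fin q) : ew (Real.exp (-β)) a b = Real.exp (-β * ind a b) := by
  unfold ew ind; split_ifs <;> simp

theorem boltz_eq (G : SimpleGraph V) (β : ℝ) {s : Finset V} {σ τ : V → Fin q}
    (h : ∀ x ∉ s, σ x = τ x) :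
    boltz G β σ = Real.exp (-β * ((monoEdges G τ : ℝ) - touching G s τ)) *
      Real.exp (-β * touching G s σ) := by
  rw [boltz, ← Real.exp_add, ← monoEdges_sub_touching_congr G h]
  ring_nf

/-! ### Resampling -/

/-- Summation over the colour of one vertex. -/
noncomputable def resample (v : V) (g : (V → Fin q) → ℝ) (τ : V → Fin q) : ℝ :=
  ∑ c, g (Function.update τ v c)

/-- Exchanging the colour of v with the extra colour is an involution on pairs. Resampling a set
this way replaces conditioning on the outside, at the cost of a power of q. -/
theorem sum_resample (v : V) (g : (V → Fin q) → ℝ) : ∑ τ, resample v g τ = q * ∑ τ, g τ := by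
  unfold resample
  have h : ∑ p : (V → Fin q) × Fin q, g (Function.update p.1 v p.2) =
      ∑ p : (V → Fin q) × Fin q, g p.1 := by
    refine Fintype.sum_equiv
      { toFun := fun p => (Function.update p.1 v p.2, p.1 v)
        invFun := fun p => (Function.update p.1 v p.2, p.1 v)
        left_inv := fun p => by simp
        right_inv := fun p => by simp } _ _ fun p => rfl
  rw [Fintype.sum_prod_type, Fintype.sum_prod_type] at h
  rw [h]
  simp [Finset.mul_sum]

/-! ### Neighbourhoods in cubic graphs -/

/-- The vertex `v` has exactly the three neighbours `a`, `b`, `c`. -/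
structure Nbrs (G : SimpleGraph V) (v a b c : V) : Prop where
  ab : a ≠ b
  ac : a ≠ c
  bc : b ≠ c
  adj : ∀ x, G.Adj v x ↔ x = a ∨ x = b ∨ x = c

namespace Nbrs

variable {v a b c : V}

theorem swap₁₂ (h : Nbrs G v a b c) : Nbrs G v b a c :=
  ⟨h.ab.symm, h.bc, h.ac, fun x => by rw [h.adj]; tauto⟩

theorem swap₂₃ (h : Nbrs G v a b c) : Nbrs G v a c b :=
  ⟨h.ac, h.ab, h.bc.symm, fun x => by rw [h.adj]; tauto⟩

theorem rot (h : Nbrs G v a b c) : Nbrs G v b c a := h.swap₁₂.swap₂₃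

theorem adj₁ (h : Nbrs G v a b c) : G.Adj v a := (h.adj a).2 (Or.inl rfl)

theorem adj₂ (h : Nbrs G v a b c) : G.Adj v b := h.swap₁₂.adj₁

theorem adj₃ (h : Nbrs G v a b c) : G.Adj v c := h.rot.adj₂

theorem sum_adj (h : Nbrs G v a b c) (f : V → ℝ) :
    (∑ y, if G.Adj v y then f y else 0) = f a + f b + f c := by
  have : (Finset.univ.filter fun y => G.Adj v y) = {a, b, c} := by
    ext y; simp [h.adj]
  rw [← Finset.sum_filter, this, Finset.sum_insert (by simp [h.ab, h.ac]), Finset.sum_pair h.bc,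
    add_assoc]

theorem localMono (h : Nbrs G v a b c) (σ : V → Fin q) :
    localMono G σ v = ind (σ v) (σ a) + ind (σ v) (σ b) + ind (σ v) (σ c) :=
  h.sum_adj fun y => ind (σ v) (σ y)

end Nbrs

/-- Every vertex has exactly three neighbours. -/
def Cubic (G : SimpleGraph V) : Prop := ∀ v, ∃ a b c, Nbrs G v a b c

theorem Cubic.exists_one (hG : Cubic G) {v a : V} (h : G.Adj v a) : ∃ x y, Nbrs G v a x y := by
  obtain ⟨b, c, d, hv⟩ := hG v
  rcases (hv.adj a).1 h with rfl | rfl | rfl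
  · exact ⟨_, _, hv⟩
  · exact ⟨_, _, hv.swap₁₂⟩
  · exact ⟨_, _, hv.rot.rot⟩

theorem Cubic.exists_two (hG : Cubic G) {v a b : V} (h : G.Adj v a) (h' : G.Adj v b)
    (hab : a ≠ b) : ∃ x, Nbrs G v a b x := by
  obtain ⟨x, y, hv⟩ := hG.exists_one h
  rcases (hv.adj b).1 h' with rfl | rfl | rfl
  · exact absurd rfl hab
  · exact ⟨_, hv⟩
  · exact ⟨_, hv.swap₂₃⟩

theorem Cubic.nbrs (hG : Cubic G) {v a b c : V} (h : G.Adj v a) (h' : G.Adj v b)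
    (h'' : G.Adj v c) (hab : a ≠ b) (hac : a ≠ c) (hbc : b ≠ c) : Nbrs G v a b c := by
  obtain ⟨x, hv⟩ := hG.exists_two h h' hab
  rcases (hv.adj c).1 h'' with rfl | rfl | rfl
  · exact absurd rfl hac
  · exact absurd rfl hbc
  · exact hv

end Energy

/-! ### Local inequalities -/

section Local

open scoped Classical

variable {V : Type*} [Fintype V] {G : SimpleGraph V} {q : ℕ}

/-- The part of the Boltzmann weight that does not depend on the colours in `s`. -/
noncomputable def outer (G : SimpleGraph V) (β : ℝ) (s : Finset V) (τ : V → Fin q) : ℝ :=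
  Real.exp (-β * ((monoEdges G τ : ℝ) - touching G s τ))

theorem outer_pos (G : SimpleGraph V) (β : ℝ) (s : Finset V) (τ : V → Fin q) :
    0 < outer G β s τ := Real.exp_pos _

/-- The local functional at a vertex, controlling the energy from below. -/
noncomputable def starEnergy (G : SimpleGraph V) (l : ℝ) (v : V) (σ : V → Fin q) : ℝ :=
  cA q l * localMono G σ v +
    cB q l * ((∑ u, if G.Adj v u then localMono G σ u else 0) - localMono G σ v) - 3 * cD q l

/-- The local functional at a pair of vertices, controlling the energy from above. -/
noncomputable def edgeEnergy (G : SimpleGraph V) (l : ℝ) (u v : V) (σ : V → Fin q) : ℝ :=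
  uD q l - uA q l * ind (σ v) (σ u) -
    uC q l * (localMono G σ u + localMono G σ v - 2 * ind (σ v) (σ u))

/-- The Gibbs sum is decomposed over outside colourings τ: a positive outer factor times a sum over
the colours of u and v. `sum_sum_eq_four` does the same for a star. -/
theorem sum_sum_eq_two {β : ℝ} {u v : V} (huv : u ≠ v)
    (F : (V → Fin q) → ℝ) (T : (V → Fin q) → Fin q → Fin q → ℝ)
    (h : ∀ τ σ : V → Fin q, (∀ x ∉ ({u, v} : Finset V), σ x = τ x) →
      Real.exp (-β * touching G {u, v} σ) * F σ = T τ (σ u) (σ v)) :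
    (q : ℝ) ^ 2 * ∑ σ : V → Fin q, boltz G β σ * F σ =
      ∑ τ : V → Fin q, outer G β {u, v} τ * ∑ a, ∑ b, T τ a b := by
  have h1 : (q : ℝ) ^ 2 * ∑ σ : V → Fin q, boltz G β σ * F σ =
      ∑ τ, resample u (resample v fun σ => boltz G β σ * F σ) τ := by
    rw [sum_resample, sum_resample]; ring
  rw [h1]
  refine Finset.sum_congr rfl fun τ _ => ?_
  simp only [resample, Finset.mul_sum]
  refine Finset.sum_congr rfl fun a _ => Finset.sum_congr rfl fun b _ => ?_
  set σ := Function.update (Function.update τ u a) v b with hσ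
  have hs : ∀ x ∉ ({u, v} : Finset V), σ x = τ x := by
    intro x hx
    simp only [Finset.mem_insert, Finset.mem_singleton, not_or] at hx
    simp [hσ, Function.update_apply, hx]
  have hT := h τ σ hs
  rw [boltz_eq G β hs, mul_assoc, hT, outer]
  simp [hσ, Function.update_apply, huv]

theorem sum_sum_eq_four {β : ℝ} {v a b c : V} (hN : Nbrs G v a b c)
    (F : (V → Fin q) → ℝ) (T : (V → Fin q) → Fin q → Fin q → Fin q → Fin q → ℝ)
    (h : ∀ τ σ : V → Fin q, (∀ x ∉ ({v, a, b, c} : Finset V), σ x = τ x) →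
      Real.exp (-β * touching G {v, a, b, c} σ) * F σ = T τ (σ v) (σ a) (σ b) (σ c)) :
    (q : ℝ) ^ 4 * ∑ σ : V → Fin q, boltz G β σ * F σ =
      ∑ τ : V → Fin q, outer G β {v, a, b, c} τ * ∑ i, ∑ j, ∑ k, ∑ m, T τ i j k m := by
  have h1 : (q : ℝ) ^ 4 * ∑ σ : V → Fin q, boltz G β σ * F σ =
      ∑ τ, resample v (resample a (resample b (resample c fun σ => boltz G β σ * F σ))) τ := by
    rw [sum_resample, sum_resample, sum_resample, sum_resample]; ring
  have va := hN.adj₁.ne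
  have vb := hN.adj₂.ne
  have vc := hN.adj₃.ne
  rw [h1]
  refine Finset.sum_congr rfl fun τ _ => ?_
  simp only [resample, Finset.mul_sum]
  refine Finset.sum_congr rfl fun i _ => Finset.sum_congr rfl fun j _ =>
    Finset.sum_congr rfl fun k _ => Finset.sum_congr rfl fun m _ => ?_
  set σ := Function.update (Function.update (Function.update (Function.update τ v i) a j) b k) c m
    with hσ
  have hs : ∀ x ∉ ({v, a, b, c} : Finset V), σ x = τ x := by
    intro x hx
    simp only [Finset.mem_insert, Finset.mem_singleton, not_or] at hx
    simp [hσ, Function.update_apply, hx]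
  have hT := h τ σ hs
  rw [boltz_eq G β hs, mul_assoc, hT, outer]
  simp [hσ, Function.update_apply, va, vb, vc, hN.ab, hN.ac, hN.bc]

theorem touching_pair {u v : V} (h : G.Adj u v) (σ : V → Fin q) :
    touching G {u, v} σ = localMono G σ u + localMono G σ v - ind (σ v) (σ u) := by
  unfold touching
  rw [Finset.sum_pair h.ne, Finset.sum_pair h.ne, Finset.sum_pair h.ne, Finset.sum_pair h.ne]
  simp [h, h.symm, ind_comm (σ u) (σ v)]

theorem touching_star {v a b c : V} (h : Nbrs G v a b c) (σ : V → Fin q) :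
    touching G {v, a, b, c} σ = localMono G σ a + localMono G σ b + localMono G σ c
      - (if G.Adj a b then ind (σ a) (σ b) else 0) - (if G.Adj a c then ind (σ a) (σ c) else 0)
      - (if G.Adj b c then ind (σ b) (σ c) else 0) := by
  have va := h.adj₁
  have vb := h.adj₂
  have vc := h.adj₃
  have hs : ∀ f : V → ℝ, ∑ x ∈ ({v, a, b, c} : Finset V), f x = f v + f a + f b + f c := by
    intro f
    rw [Finset.sum_insert (by simp [va.ne, vb.ne, vc.ne]),
      Finset.sum_insert (by simp [h.ab, h.ac]), Finset.sum_pair h.bc]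
    ring
  unfold touching
  simp only [hs, h.localMono σ, va, vb, vc, va.symm, vb.symm, vc.symm, if_true, G.irrefl, if_false,
    G.adj_comm b a, G.adj_comm c a, G.adj_comm c b, ind_comm (σ a) (σ v), ind_comm (σ b) (σ v),
    ind_comm (σ c) (σ v), ind_comm (σ b) (σ a), ind_comm (σ c) (σ a), ind_comm (σ c) (σ b)]
  ring

/-- The expected local functional at a pair of vertices, unnormalized. -/
noncomputable def edgeTotal (G : SimpleGraph V) (q : ℕ) (β : ℝ) (u v : V) : ℝ :=
  ∑ σ : V → Fin q, boltz G β σ * edgeEnergy G (Real.exp (-β)) u v σ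

/-- The expected local functional at a vertex, unnormalized. -/
noncomputable def starTotal (G : SimpleGraph V) (q : ℕ) (β : ℝ) (v : V) : ℝ :=
  ∑ σ : V → Fin q, boltz G β σ * starEnergy G (Real.exp (-β)) v σ

theorem edgeTotal_eq {β : ℝ} {u v x₁ y₁ x₂ y₂ : V} (hu : Nbrs G u v x₁ y₁)
    (hv : Nbrs G v u x₂ y₂) :
    (q : ℝ) ^ 2 * edgeTotal G q β u v = ∑ τ : V → Fin q, outer G β {u, v} τ *
      edgeSum (Real.exp (-β)) (τ x₁) (τ y₁) (τ x₂) (τ y₂) := by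
  refine sum_sum_eq_two hu.adj₁.ne _ (fun τ a b =>
    ew (Real.exp (-β)) b a * (ew (Real.exp (-β)) a (τ x₁) * ew (Real.exp (-β)) a (τ y₁)) *
      (ew (Real.exp (-β)) b (τ x₂) * ew (Real.exp (-β)) b (τ y₂)) *
      (uD q (Real.exp (-β)) - uA q (Real.exp (-β)) * ind b a - uC q (Real.exp (-β)) *
        (ind a (τ x₁) + ind a (τ y₁) + (ind b (τ x₂) + ind b (τ y₂))))) ?_
  intro τ σ h
  have e1 := h x₁ (by simp [hu.adj₂.ne', hu.ab.symm])
  have e2 := h y₁ (by simp [hu.adj₃.ne', hu.ac.symm])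
  have e3 := h x₂ (by simp [hv.adj₂.ne', hv.ab.symm])
  have e4 := h y₂ (by simp [hv.adj₃.ne', hv.ac.symm])
  rw [edgeEnergy, touching_pair hu.adj₁, hu.localMono, hv.localMono, ← e1, ← e2, ← e3, ← e4,
    ind_comm (σ u) (σ v)]
  simp only [ew_eq_exp, ← Real.exp_add]
  congr 1
  · congr 1; ring
  · ring

/-- The six outer vertices may coincide with one another, which is why `starSum` is studied for
arbitrary boundary colours. -/
theorem starTotal_eq {β : ℝ} {v u₁ u₂ u₃ x₁ y₁ x₂ y₂ x₃ y₃ : V} (h : Nbrs G v u₁ u₂ u₃)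
    (h₁ : Nbrs G u₁ v x₁ y₁) (h₂ : Nbrs G u₂ v x₂ y₂) (h₃ : Nbrs G u₃ v x₃ y₃)
    (h₁₂ : ¬ G.Adj u₁ u₂) (h₁₃ : ¬ G.Adj u₁ u₃) (h₂₃ : ¬ G.Adj u₂ u₃) :
    (q : ℝ) ^ 4 * starTotal G q β v = ∑ τ : V → Fin q, outer G β {v, u₁, u₂, u₃} τ *
      starSum (Real.exp (-β)) (τ x₁) (τ y₁) (τ x₂) (τ y₂) (τ x₃) (τ y₃) := by
  refine sum_sum_eq_four h _ (fun τ c c₁ c₂ c₃ =>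
    (ew (Real.exp (-β)) c₁ c * ew (Real.exp (-β)) c₁ (τ x₁) * ew (Real.exp (-β)) c₁ (τ y₁)) *
    (ew (Real.exp (-β)) c₂ c * ew (Real.exp (-β)) c₂ (τ x₂) * ew (Real.exp (-β)) c₂ (τ y₂)) *
    (ew (Real.exp (-β)) c₃ c * ew (Real.exp (-β)) c₃ (τ x₃) * ew (Real.exp (-β)) c₃ (τ y₃)) *
    (cA q (Real.exp (-β)) * (ind c₁ c + ind c₂ c + ind c₃ c) + cB q (Real.exp (-β)) *
      (ind c₁ (τ x₁) + ind c₁ (τ y₁) + (ind c₂ (τ x₂) + ind c₂ (τ y₂)) +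
        (ind c₃ (τ x₃) + ind c₃ (τ y₃))) - 3 * cD q (Real.exp (-β)))) ?_
  intro τ σ hs
  have h₂₁ : ¬ G.Adj u₂ u₁ := fun k => h₁₂ k.symm
  have h₃₁ : ¬ G.Adj u₃ u₁ := fun k => h₁₃ k.symm
  have h₃₂ : ¬ G.Adj u₃ u₂ := fun k => h₂₃ k.symm
  -- As the leaves are pairwise nonadjacent, their outer neighbours lie outside the resampled star.
  have key : ∀ x, x ≠ v → (G.Adj u₁ x ∨ G.Adj u₂ x ∨ G.Adj u₃ x) → σ x = τ x := by
    intro x hx k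
    apply hs
    simp only [Finset.mem_insert, Finset.mem_singleton, not_or]
    refine ⟨hx, ?_, ?_, ?_⟩ <;> rintro rfl <;> simp_all
  rw [starEnergy, touching_star h, h.sum_adj, h.localMono, h₁.localMono, h₂.localMono,
    h₃.localMono, if_neg h₁₂, if_neg h₁₃, if_neg h₂₃,
    ← key x₁ h₁.ab.symm (Or.inl h₁.adj₂), ← key y₁ h₁.ac.symm (Or.inl h₁.adj₃),
    ← key x₂ h₂.ab.symm (Or.inr (Or.inl h₂.adj₂)), ← key y₂ h₂.ac.symm (Or.inr (Or.inl h₂.adj₃)),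
    ← key x₃ h₃.ab.symm (Or.inr (Or.inr h₃.adj₂)), ← key y₃ h₃.ac.symm (Or.inr (Or.inr h₃.adj₃)),
    ind_comm (σ v) (σ u₁), ind_comm (σ v) (σ u₂), ind_comm (σ v) (σ u₃)]
  simp only [ew_eq_exp, ← Real.exp_add]
  congr 1
  · congr 1; ring
  · ring

theorem starTotal_eq_pair {β : ℝ} {v u₁ u₂ u₃ a b d e : V} (h : Nbrs G v u₁ u₂ u₃)
    (h₁ : Nbrs G u₁ v u₂ a) (h₂ : Nbrs G u₂ v u₁ b) (h₃ : Nbrs G u₃ v d e)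
    (h₁₃ : ¬ G.Adj u₁ u₃) (h₂₃ : ¬ G.Adj u₂ u₃) :
    (q : ℝ) ^ 4 * starTotal G q β v = ∑ τ : V → Fin q, outer G β {v, u₁, u₂, u₃} τ *
      pairStarSum (Real.exp (-β)) (τ a) (τ b) (τ d) (τ e) := by
  refine sum_sum_eq_four h _ (fun τ c c₁ c₂ c₃ =>
    (ew (Real.exp (-β)) c₁ c * ew (Real.exp (-β)) c₁ (τ a)) *
    (ew (Real.exp (-β)) c₂ c * ew (Real.exp (-β)) c₂ (τ b) * ew (Real.exp (-β)) c₂ c₁) *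
    (ew (Real.exp (-β)) c₃ c * ew (Real.exp (-β)) c₃ (τ d) * ew (Real.exp (-β)) c₃ (τ e)) *
    (cA q (Real.exp (-β)) * (ind c₁ c + ind c₂ c + ind c₃ c) + cB q (Real.exp (-β)) *
      (ind c₁ (τ a) + ind c₂ (τ b) + 2 * ind c₂ c₁ +
        (ind c₃ (τ d) + ind c₃ (τ e))) - 3 * cD q (Real.exp (-β)))) ?_
  intro τ σ hs
  have h₃₁ : ¬ G.Adj u₃ u₁ := fun k => h₁₃ k.symm
  have h₃₂ : ¬ G.Adj u₃ u₂ := fun k => h₂₃ k.symm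
  have ea : σ a = τ a := by
    apply hs
    simp only [Finset.mem_insert, Finset.mem_singleton, not_or]
    exact ⟨h₁.ac.symm, h₁.adj₃.ne', h₁.bc.symm, by rintro rfl; exact h₁₃ h₁.adj₃⟩
  have eb : σ b = τ b := by
    apply hs
    simp only [Finset.mem_insert, Finset.mem_singleton, not_or]
    exact ⟨h₂.ac.symm, h₂.bc.symm, h₂.adj₃.ne', by rintro rfl; exact h₂₃ h₂.adj₃⟩
  have ed : ∀ x, x ≠ v → G.Adj u₃ x → σ x = τ x := by
    intro x hx k
    apply hs
    simp only [Finset.mem_insert, Finset.mem_singleton, not_or]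
    exact ⟨hx, by rintro rfl; exact h₃₁ k, by rintro rfl; exact h₃₂ k, k.ne'⟩
  rw [starEnergy, touching_star h, h.sum_adj, h.localMono, h₁.localMono, h₂.localMono,
    h₃.localMono, if_pos h₁.adj₂, if_neg h₁₃, if_neg h₂₃, ← ea, ← eb,
    ← ed d h₃.ab.symm h₃.adj₂, ← ed e h₃.ac.symm h₃.adj₃,
    ind_comm (σ v) (σ u₁), ind_comm (σ v) (σ u₂), ind_comm (σ v) (σ u₃), ind_comm (σ u₁) (σ u₂)]
  simp only [ew_eq_exp, ← Real.exp_add]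
  congr 1
  · congr 1; ring
  · ring

/-- The middle vertex u₂ is listed first to match the order of summation in `pathStarSum`. -/
theorem starTotal_eq_path {β : ℝ} {v u₁ u₂ u₃ a b : V} (h : Nbrs G v u₂ u₁ u₃)
    (h₁ : Nbrs G u₁ v u₂ a) (h₂ : Nbrs G u₂ v u₁ u₃) (h₃ : Nbrs G u₃ v u₂ b)
    (h₁₃ : ¬ G.Adj u₁ u₃) :
    (q : ℝ) ^ 4 * starTotal G q β v = ∑ τ : V → Fin q, outer G β {v, u₂, u₁, u₃} τ *
      pathStarSum (Real.exp (-β)) (τ a) (τ b) := by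
  refine sum_sum_eq_four h _ (fun τ c c₂ c₁ c₃ =>
    ew (Real.exp (-β)) c₂ c * ((ew (Real.exp (-β)) c₁ c * ew (Real.exp (-β)) c₁ (τ a) *
      ew (Real.exp (-β)) c₁ c₂) * (ew (Real.exp (-β)) c₃ c * ew (Real.exp (-β)) c₃ (τ b) *
      ew (Real.exp (-β)) c₃ c₂)) *
    (cA q (Real.exp (-β)) * (ind c₁ c + ind c₂ c + ind c₃ c) + cB q (Real.exp (-β)) *
      (ind c₁ (τ a) + ind c₃ (τ b) + 2 * ind c₁ c₂ + 2 * ind c₃ c₂) -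
        3 * cD q (Real.exp (-β)))) ?_
  intro τ σ hs
  have ea : σ a = τ a := by
    apply hs
    simp only [Finset.mem_insert, Finset.mem_singleton, not_or]
    exact ⟨h₁.ac.symm, h₁.bc.symm, h₁.adj₃.ne', by rintro rfl; exact h₁₃ h₁.adj₃⟩
  have eb : σ b = τ b := by
    apply hs
    simp only [Finset.mem_insert, Finset.mem_singleton, not_or]
    exact ⟨h₃.ac.symm, h₃.bc.symm, by rintro rfl; exact h₁₃ h₃.adj₃.symm, h₃.adj₃.ne'⟩
  rw [starEnergy, touching_star h, h.sum_adj, h.localMono, h₁.localMono, h₂.localMono,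
    h₃.localMono, if_pos h₂.adj₂, if_pos h₂.adj₃, if_neg h₁₃, ← ea, ← eb,
    ind_comm (σ v) (σ u₁), ind_comm (σ v) (σ u₂), ind_comm (σ v) (σ u₃), ind_comm (σ u₂) (σ u₁),
    ind_comm (σ u₂) (σ u₃)]
  simp only [ew_eq_exp, ← Real.exp_add]
  congr 1
  · congr 1; ring
  · ring

theorem starTotal_eq_clique {β : ℝ} {v u₁ u₂ u₃ : V} (h : Nbrs G v u₁ u₂ u₃)
    (h₁ : Nbrs G u₁ v u₂ u₃) (h₂ : Nbrs G u₂ v u₁ u₃) (h₃ : Nbrs G u₃ v u₁ u₂) :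
    (q : ℝ) ^ 4 * starTotal G q β v = ∑ τ : V → Fin q, outer G β {v, u₁, u₂, u₃} τ *
      cliqueStarSum q (Real.exp (-β)) := by
  refine sum_sum_eq_four h _ (fun τ c c₁ c₂ c₃ =>
    ew (Real.exp (-β)) c₁ c * (ew (Real.exp (-β)) c₂ c * ew (Real.exp (-β)) c₂ c₁) *
      (ew (Real.exp (-β)) c₃ c * ew (Real.exp (-β)) c₃ c₁ * ew (Real.exp (-β)) c₃ c₂) *
    (cA q (Real.exp (-β)) * (ind c₁ c + ind c₂ c + ind c₃ c) + cB q (Real.exp (-β)) *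
      (2 * ind c₂ c₁ + 2 * ind c₃ c₁ + 2 * ind c₃ c₂) - 3 * cD q (Real.exp (-β)))) ?_
  intro τ σ hs
  rw [starEnergy, touching_star h, h.sum_adj, h.localMono, h₁.localMono, h₂.localMono,
    h₃.localMono, if_pos h₁.adj₂, if_pos h₁.adj₃, if_pos h₂.adj₃,
    ind_comm (σ v) (σ u₁), ind_comm (σ v) (σ u₂), ind_comm (σ v) (σ u₃), ind_comm (σ u₁) (σ u₂),
    ind_comm (σ u₁) (σ u₃), ind_comm (σ u₂) (σ u₃)]
  simp only [ew_eq_exp, ← Real.exp_add]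
  congr 1
  · congr 1; ring
  · ring

theorem exp_neg_mem {β : ℝ} (hβ : 0 < β) : 0 < Real.exp (-β) ∧ Real.exp (-β) < 1 :=
  ⟨Real.exp_pos _, Real.exp_lt_one_iff.2 (by linarith)⟩

theorem nonneg_of_sum_outer {β : ℝ} {s : Finset V} {X : ℝ} (hq : 2 ≤ q) {n : ℕ}
    (T : (V → Fin q) → ℝ) (h : (q : ℝ) ^ n * X = ∑ τ : V → Fin q, outer G β s τ * T τ)
    (hT : ∀ τ, 0 ≤ T τ) : 0 ≤ X := by
  have hq0 : (0 : ℝ) < (q : ℝ) ^ n := by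
    have : 0 < q := by omega
    positivity
  refine nonneg_of_mul_nonneg_right ?_ hq0
  rw [h]
  exact Finset.sum_nonneg fun τ _ => mul_nonneg (outer_pos ..).le (hT τ)

theorem pos_of_sum_outer {β : ℝ} {s : Finset V} {X : ℝ} (hq : 2 ≤ q) {n : ℕ}
    (T : (V → Fin q) → ℝ) (h : (q : ℝ) ^ n * X = ∑ τ : V → Fin q, outer G β s τ * T τ)
    (hT : ∀ τ, 0 ≤ T τ) (hT' : ∃ τ, 0 < T τ) : 0 < X := by
  have hq0 : (0 : ℝ) < (q : ℝ) ^ n := by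
    have : 0 < q := by omega
    positivity
  refine pos_of_mul_pos_right ?_ hq0.le
  rw [h]
  obtain ⟨τ, hτ⟩ := hT'
  exact Finset.sum_pos' (fun τ _ => mul_nonneg (outer_pos ..).le (hT τ))
    ⟨τ, Finset.mem_univ _, mul_pos (outer_pos ..) hτ⟩

theorem eq_zero_of_sum_outer {β : ℝ} {s : Finset V} {X : ℝ} (hq : 2 ≤ q) {n : ℕ}
    (T : (V → Fin q) → ℝ) (h : (q : ℝ) ^ n * X = ∑ τ : V → Fin q, outer G β s τ * T τ)
    (hT : ∀ τ, T τ = 0) : X = 0 := by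
  have hq0 : (0 : ℝ) < (q : ℝ) ^ n := by
    have : 0 < q := by omega
    positivity
  simp only [hT, mul_zero, Finset.sum_const_zero] at h
  exact (mul_eq_zero.1 h).resolve_left hq0.ne'

theorem starTotal_pos_of_adj (hG : Cubic G) (hq : 2 ≤ q) {β : ℝ} (hβ : 0 < β)
    {v u₁ u₂ u₃ : V} (h : Nbrs G v u₁ u₂ u₃) (h₁₂ : G.Adj u₁ u₂) : 0 < starTotal G q β v := by
  obtain ⟨hl, hl1⟩ := exp_neg_mem hβ
  have τ₀ : V → Fin q := fun _ => ⟨0, by omega⟩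
  have path : ∀ {u₁ u₂ u₃ : V}, Nbrs G v u₂ u₁ u₃ → G.Adj u₂ u₁ → G.Adj u₂ u₃ → ¬ G.Adj u₁ u₃ →
      0 < starTotal G q β v := by
    intro u₁ u₂ u₃ h h₂₁ h₂₃ h₁₃
    obtain ⟨a, ha⟩ := hG.exists_two h.adj₂.symm h₂₁.symm h.adj₁.ne
    obtain ⟨b, hb⟩ := hG.exists_two h.adj₃.symm h₂₃.symm h.adj₁.ne
    have h₂ := hG.nbrs h.adj₁.symm h₂₁ h₂₃ h.adj₂.ne h.adj₃.ne h.bc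
    exact pos_of_sum_outer hq _ (starTotal_eq_path h ha h₂ hb h₁₃)
      (fun τ => (pathStarSum_pos hl hl1 hq _ _).le) ⟨τ₀, pathStarSum_pos hl hl1 hq _ _⟩
  by_cases h₁₃ : G.Adj u₁ u₃ <;> by_cases h₂₃ : G.Adj u₂ u₃
  · have k₁ := hG.nbrs h.adj₁.symm h₁₂ h₁₃ h.adj₂.ne h.adj₃.ne h.bc
    have k₂ := hG.nbrs h.adj₂.symm h₁₂.symm h₂₃ h.adj₁.ne h.adj₃.ne h.ac
    have k₃ := hG.nbrs h.adj₃.symm h₁₃.symm h₂₃.symm h.adj₁.ne h.adj₂.ne h.ab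
    exact pos_of_sum_outer hq _ (starTotal_eq_clique h k₁ k₂ k₃)
      (fun τ => (cliqueStarSum_pos hl hl1 hq).le) ⟨τ₀, cliqueStarSum_pos hl hl1 hq⟩
  · exact path h h₁₂ h₁₃ h₂₃
  · exact path h.swap₁₂ h₁₂.symm h₂₃ h₁₃
  · obtain ⟨a, ha⟩ := hG.exists_two h.adj₁.symm h₁₂ h.adj₂.ne
    obtain ⟨b, hb⟩ := hG.exists_two h.adj₂.symm h₁₂.symm h.adj₁.ne
    obtain ⟨d, e, hde⟩ := hG.exists_one h.adj₃.symm
    exact pos_of_sum_outer hq _ (starTotal_eq_pair h ha hb hde h₁₃ h₂₃)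
      (fun τ => (pairStarSum_pos hl hl1 hq _ _ _ _).le) ⟨τ₀, pairStarSum_pos hl hl1 hq _ _ _ _⟩

theorem starTotal_nonneg (hG : Cubic G) (hq : 2 ≤ q) {β : ℝ} (hβ : 0 < β) (v : V) :
    0 ≤ starTotal G q β v := by
  obtain ⟨hl, hl1⟩ := exp_neg_mem hβ
  obtain ⟨u₁, u₂, u₃, h⟩ := hG v
  by_cases h₁₂ : G.Adj u₁ u₂
  · exact (starTotal_pos_of_adj hG hq hβ h h₁₂).le
  by_cases h₂₃ : G.Adj u₂ u₃
  · exact (starTotal_pos_of_adj hG hq hβ h.rot h₂₃).le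
  by_cases h₁₃ : G.Adj u₁ u₃
  · exact (starTotal_pos_of_adj hG hq hβ h.swap₂₃ h₁₃).le
  obtain ⟨x₁, y₁, k₁⟩ := hG.exists_one h.adj₁.symm
  obtain ⟨x₂, y₂, k₂⟩ := hG.exists_one h.adj₂.symm
  obtain ⟨x₃, y₃, k₃⟩ := hG.exists_one h.adj₃.symm
  exact nonneg_of_sum_outer hq _ (starTotal_eq h k₁ k₂ k₃ h₁₂ h₁₃ h₂₃)
    fun τ => starSum_nonneg hl hl1 hq _ _ _ _ _ _

/-- Colour w, an outer neighbour of v but not of u, differently from all other vertices. Then u sees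
one outer colour twice and v sees two colours, the configuration that makes both local inequalities
strict. -/
theorem exists_boundary (hq : 2 ≤ q) {u v w x₁ y₁ x₂ y₂ : V} {k k' : V} (h₁ : Nbrs G u k x₁ y₁)
    (h₂ : Nbrs G v k' x₂ y₂) (hw : w ≠ k') (hw1 : G.Adj v w) (hw2 : ¬ G.Adj u w) :
    ∃ (τ : V → Fin q) (a : Fin q), τ x₁ = a ∧ τ y₁ = a ∧
      ((τ x₂ = a ∧ τ y₂ ≠ a) ∨ (τ x₂ ≠ a ∧ τ y₂ = a)) := by
  have hx : x₁ ≠ w := by rintro rfl; exact hw2 h₁.adj₂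
  have hy : y₁ ≠ w := by rintro rfl; exact hw2 h₁.adj₃
  refine ⟨fun z => if z = w then ⟨1, by omega⟩ else ⟨0, by omega⟩, ⟨0, by omega⟩, by simp [hx],
    by simp [hy], ?_⟩
  rcases (h₂.adj w).1 hw1 with rfl | rfl | rfl
  · exact absurd rfl hw
  · right; simp [h₂.bc.symm]
  · left; simp [h₂.bc]

/-- If two leaves have different neighbourhoods, either two leaves are adjacent or `exists_boundary`
provides a strict term. If all agree, no leaves are adjacent and every term is a `starSum` with
three equal boundaries. -/
theorem starTotal_eq_zero_iff (hG : Cubic G) (hq : 2 ≤ q) {β : ℝ} (hβ : 0 < β) (v : V) :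
    starTotal G q β v = 0 ↔
      ∀ u u', G.Adj v u → G.Adj v u' → ∀ w, G.Adj u w → G.Adj u' w := by
  obtain ⟨hl, hl1⟩ := exp_neg_mem hβ
  constructor
  · intro h0
    by_contra! hcon
    obtain ⟨u₂, u₁, hv₂, hv₁, w, hw₂, hw₁⟩ := hcon
    obtain ⟨u₃, h⟩ := hG.exists_two hv₁ hv₂ (by rintro rfl; exact hw₁ hw₂)
    by_cases h₁₂ : G.Adj u₁ u₂
    · exact (starTotal_pos_of_adj hG hq hβ h h₁₂).ne' h0
    by_cases h₂₃ : G.Adj u₂ u₃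
    · exact (starTotal_pos_of_adj hG hq hβ h.rot h₂₃).ne' h0
    by_cases h₁₃ : G.Adj u₁ u₃
    · exact (starTotal_pos_of_adj hG hq hβ h.swap₂₃ h₁₃).ne' h0
    obtain ⟨x₁, y₁, k₁⟩ := hG.exists_one h.adj₁.symm
    obtain ⟨x₂, y₂, k₂⟩ := hG.exists_one h.adj₂.symm
    obtain ⟨x₃, y₃, k₃⟩ := hG.exists_one h.adj₃.symm
    obtain ⟨τ, a, e1, e2, e3⟩ := exists_boundary hq k₁ k₂
      (by rintro rfl; exact hw₁ hv₁.symm) hw₂ hw₁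
    refine (pos_of_sum_outer hq _ (starTotal_eq h k₁ k₂ k₃ h₁₂ h₁₃ h₂₃)
      (fun τ => starSum_nonneg hl hl1 hq _ _ _ _ _ _) ⟨τ, ?_⟩).ne' h0
    refine starSum_pos (a := a) hl hl1 hq (by simp [level, e1, e2]) (Or.inl ?_)
    rcases e3 with ⟨e3, e4⟩ | ⟨e3, e4⟩
    · simp [level, e3, e4.symm]
    · simp [level, e3, e4]
  · intro hN
    obtain ⟨u₁, u₂, u₃, h⟩ := hG v
    obtain ⟨x, y, k₁⟩ := hG.exists_one h.adj₁.symm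
    have k₂ : Nbrs G u₂ v x y := ⟨k₁.ab, k₁.ac, k₁.bc, fun w => by
      rw [← k₁.adj]; exact ⟨hN _ _ h.adj₂ h.adj₁ w, hN _ _ h.adj₁ h.adj₂ w⟩⟩
    have k₃ : Nbrs G u₃ v x y := ⟨k₁.ab, k₁.ac, k₁.bc, fun w => by
      rw [← k₁.adj]; exact ⟨hN _ _ h.adj₃ h.adj₁ w, hN _ _ h.adj₁ h.adj₃ w⟩⟩
    refine eq_zero_of_sum_outer hq _ (starTotal_eq h k₁ k₂ k₃
      (fun k => G.irrefl (hN _ _ h.adj₁ h.adj₂ _ k)) (fun k => G.irrefl (hN _ _ h.adj₁ h.adj₃ _ k))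
      (fun k => G.irrefl (hN _ _ h.adj₂ h.adj₃ _ k))) fun τ => starSum_same _ _

theorem edgeTotal_nonneg (hG : Cubic G) (hq : 2 ≤ q) {β : ℝ} (hβ : 0 < β) {u v : V}
    (h : G.Adj u v) : 0 ≤ edgeTotal G q β u v := by
  obtain ⟨hl, hl1⟩ := exp_neg_mem hβ
  obtain ⟨x₁, y₁, k₁⟩ := hG.exists_one h
  obtain ⟨x₂, y₂, k₂⟩ := hG.exists_one h.symm
  exact nonneg_of_sum_outer hq _ (edgeTotal_eq k₁ k₂) fun τ => edgeSum_nonneg hl hl1 hq _ _ _ _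

theorem edgeTotal_eq_zero_iff (hG : Cubic G) (hq : 2 ≤ q) {β : ℝ} (hβ : 0 < β) {u v : V}
    (h : G.Adj u v) : edgeTotal G q β u v = 0 ↔ ∀ w, w ≠ u → G.Adj v w → G.Adj u w := by
  obtain ⟨hl, hl1⟩ := exp_neg_mem hβ
  obtain ⟨x₁, y₁, k₁⟩ := hG.exists_one h
  obtain ⟨x₂, y₂, k₂⟩ := hG.exists_one h.symm
  constructor
  · intro h0
    by_contra! hcon
    obtain ⟨w, hw, hw₁, hw₂⟩ := hcon
    obtain ⟨τ, a, e1, e2, e3⟩ := exists_boundary hq k₁ k₂ hw hw₁ hw₂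
    refine (pos_of_sum_outer hq _ (edgeTotal_eq k₁ k₂)
      (fun τ => edgeSum_nonneg hl hl1 hq _ _ _ _) ⟨τ, ?_⟩).ne' h0
    rw [e1, e2]
    refine edgeSum_loop_pair_pos hl hl1 hq a ?_
    rcases e3 with ⟨e3, e4⟩ | ⟨e3, e4⟩
    · rw [e3]; exact e4.symm
    · rw [e4]; exact e3
  · intro hN
    have hx' := k₂.adj₂.ne'
    have hy' := k₂.adj₃.ne'
    have k₁' : Nbrs G u v x₂ y₂ := hG.nbrs h (hN x₂ k₂.ab.symm k₂.adj₂) (hN y₂ k₂.ac.symm k₂.adj₃)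
      hx'.symm hy'.symm k₂.bc
    exact eq_zero_of_sum_outer hq _ (edgeTotal_eq k₁' k₂) fun τ => edgeSum_same _ _

end Local

/-! ### Summing the local inequalities -/

section Totals

open scoped Classical

variable {V : Type*} [Fintype V] {G : SimpleGraph V} {q : ℕ}

theorem Cubic.sum_sum_adj (hG : Cubic G) (f : V → ℝ) :
    (∑ v, ∑ u, if G.Adj v u then f u else 0) = 3 * ∑ u, f u := by
  rw [Finset.sum_comm, Finset.mul_sum]
  refine Finset.sum_congr rfl fun u _ => ?_
  obtain ⟨a, b, c, h⟩ := hG u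
  simp only [G.adj_comm _ u]
  rw [h.sum_adj fun _ => f u]
  ring

/-- Each vertex is a neighbour of three roots, so local counts enter with total coefficient (cA -
cB) + 3 cB = `cS`. -/
theorem Cubic.sum_starEnergy (hG : Cubic G) (l : ℝ) (σ : V → Fin q) :
    ∑ v, starEnergy G l v σ =
      2 * cS q l * (monoEdges G σ : ℝ) - 3 * cD q l * Fintype.card V := by
  have h := two_mul_monoEdges G σ
  unfold starEnergy
  rw [Finset.sum_sub_distrib, Finset.sum_add_distrib, ← Finset.mul_sum, ← Finset.mul_sum,
    Finset.sum_sub_distrib, hG.sum_sum_adj, ← h, ← cA_add_two_mul_cB]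
  simp only [Finset.sum_const, Finset.card_univ, nsmul_eq_mul]
  ring

theorem Cubic.sum_edgeEnergy (hG : Cubic G) (l : ℝ) (σ : V → Fin q) :
    (∑ u, ∑ v, if G.Adj u v then edgeEnergy G l u v σ else 0) =
      3 * uD q l * Fintype.card V - 2 * (uA q l + 4 * uC q l) * (monoEdges G σ : ℝ) := by
  have h := two_mul_monoEdges G σ
  have h1 : (∑ u, ∑ v, if G.Adj u v then (1 : ℝ) else 0) = 3 * Fintype.card V := by
    rw [hG.sum_sum_adj fun _ => 1]; simp
  have h2 := hG.sum_sum_adj (localMono G σ)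
  have h3 : (∑ u, ∑ v, if G.Adj u v then localMono G σ u else 0) = 3 * ∑ u, localMono G σ u := by
    rw [Finset.sum_comm]
    simpa only [G.adj_comm] using h2
  have h4 : (∑ u, ∑ v, if G.Adj u v then ind (σ v) (σ u) else 0) = ∑ u, localMono G σ u := by
    unfold localMono
    refine Finset.sum_congr rfl fun u _ => Finset.sum_congr rfl fun v _ => ?_
    rw [ind_comm]
  -- Over ordered adjacent pairs, the edge itself counts 2m and the local counts of both ends 12m;
  -- removing the edge twice leaves 8m boundary edges.
  have h5 : (∑ u, ∑ v, if G.Adj u v then edgeEnergy G l u v σ else 0) =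
      uD q l * (∑ u, ∑ v, if G.Adj u v then (1 : ℝ) else 0) -
      (uA q l - 2 * uC q l) * (∑ u, ∑ v, if G.Adj u v then ind (σ v) (σ u) else 0) -
      uC q l * ((∑ u, ∑ v, if G.Adj u v then localMono G σ u else 0) +
        ∑ u, ∑ v, if G.Adj u v then localMono G σ v else 0) := by
    simp only [Finset.mul_sum, ← Finset.sum_add_distrib, ← Finset.sum_sub_distrib]
    refine Finset.sum_congr rfl fun u _ => Finset.sum_congr rfl fun v _ => ?_
    unfold edgeEnergy
    split_ifs <;> ring
  rw [h5, h1, h2, h3, h4, ← h]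
  ring

/-! ### From Gibbs sums to energies -/

/-- The unnormalized expected number of monochromatic edges. -/
noncomputable def weightedMono (G : SimpleGraph V) (q : ℕ) (β : ℝ) : ℝ :=
  ∑ σ : V → Fin q, boltz G β σ * (monoEdges G σ : ℝ)

theorem partitionFunction_eq (β : ℝ) :
    partitionFunction G q β = ∑ σ : V → Fin q, boltz G β σ := by
  unfold partitionFunction boltz
  congr!

theorem partitionFunction_pos (hq : 2 ≤ q) (β : ℝ) : 0 < partitionFunction G q β := by
  have : Nonempty (Fin q) := ⟨⟨0, by omega⟩⟩
  rw [partitionFunction_eq]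
  exact Finset.sum_pos (fun σ _ => Real.exp_pos _) Finset.univ_nonempty

theorem Cubic.sum_starTotal (hG : Cubic G) (q : ℕ) (β : ℝ) :
    ∑ v, starTotal G q β v = 2 * cS q (Real.exp (-β)) * weightedMono G q β -
      3 * cD q (Real.exp (-β)) * Fintype.card V * partitionFunction G q β := by
  unfold starTotal weightedMono
  rw [Finset.sum_comm, partitionFunction_eq, Finset.mul_sum, Finset.mul_sum,
    ← Finset.sum_sub_distrib]
  refine Finset.sum_congr rfl fun σ _ => ?_
  rw [← Finset.mul_sum, hG.sum_starEnergy]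
  ring

theorem Cubic.sum_edgeTotal (hG : Cubic G) (q : ℕ) (β : ℝ) :
    (∑ u, ∑ v, if G.Adj u v then edgeTotal G q β u v else 0) =
      3 * uD q (Real.exp (-β)) * Fintype.card V * partitionFunction G q β -
      2 * (uA q (Real.exp (-β)) + 4 * uC q (Real.exp (-β))) * weightedMono G q β := by
  have h : ∀ u v, (if G.Adj u v then edgeTotal G q β u v else 0) =
      ∑ σ : V → Fin q, boltz G β σ *
        if G.Adj u v then edgeEnergy G (Real.exp (-β)) u v σ else 0 := by
    intro u v
    unfold edgeTotal
    split_ifs <;> simp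
  simp only [h]
  unfold weightedMono
  rw [Finset.sum_congr rfl fun u _ => Finset.sum_comm, Finset.sum_comm, partitionFunction_eq,
    Finset.mul_sum, Finset.mul_sum, ← Finset.sum_sub_distrib]
  refine Finset.sum_congr rfl fun σ _ => ?_
  simp only [← Finset.mul_sum]
  rw [hG.sum_edgeEnergy]
  ring

theorem hasDerivAt_partitionFunction (β : ℝ) :
    HasDerivAt (partitionFunction G q) (-weightedMono G q β) β := by
  have h : partitionFunction G q = fun t => ∑ σ : V → Fin q, boltz G t σ :=
    funext fun t => partitionFunction_eq t
  rw [h, weightedMono, ← Finset.sum_neg_distrib]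
  refine HasDerivAt.fun_sum fun σ _ => ?_
  have h1 : HasDerivAt (fun t : ℝ => -t * (monoEdges G σ : ℝ)) (-1 * (monoEdges G σ : ℝ)) β :=
    (hasDerivAt_neg β).mul_const _
  have h2 := h1.exp
  exact h2.congr_deriv (by rw [boltz]; ring)

theorem hasDerivAt_log_partitionFunction (hq : 2 ≤ q) (β : ℝ) :
    HasDerivAt (fun t => Real.log (partitionFunction G q t))
      (-weightedMono G q β / partitionFunction G q β) β :=
  (hasDerivAt_partitionFunction β).log (partitionFunction_pos hq β).ne'

theorem internalEnergy_eq (hq : 2 ≤ q) (β : ℝ) :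
    internalEnergy G q β =
      weightedMono G q β / (Fintype.card V * partitionFunction G q β) := by
  rw [internalEnergy, (hasDerivAt_log_partitionFunction hq β).deriv]
  have := (partitionFunction_pos (G := G) hq β).ne'
  field_simp

/-- The internal energy per particle of `K_{3,3}`. -/
noncomputable def lowerEnergy (q : ℕ) (β : ℝ) : ℝ :=
  3 * cD q (Real.exp (-β)) / (2 * cS q (Real.exp (-β)))

/-- The internal energy per particle of `K_4`. -/
noncomputable def upperEnergy (q : ℕ) (β : ℝ) : ℝ :=
  3 * uD q (Real.exp (-β)) / (2 * (uA q (Real.exp (-β)) + 4 * uC q (Real.exp (-β))))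

theorem internalEnergy_sub_lowerEnergy [Nonempty V] (hG : Cubic G) (hq : 2 ≤ q) {β : ℝ}
    (hβ : 0 < β) : ∃ K : ℝ, 0 < K ∧
      internalEnergy G q β - lowerEnergy q β = K * ∑ v, starTotal G q β v := by
  obtain ⟨hl, hl1⟩ := exp_neg_mem hβ
  have hZ := partitionFunction_pos (G := G) hq β
  have hn : (0 : ℝ) < Fintype.card V := Nat.cast_pos.2 Fintype.card_pos
  have hS : 0 < cS q (Real.exp (-β)) := by
    have h2 : (2 : ℝ) ≤ q := by exact_mod_cast hq
    have := cS_pos ((q : ℝ) - 2) (by linarith) _ hl hl1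
    rwa [sub_add_cancel] at this
  refine ⟨1 / (2 * cS q (Real.exp (-β)) * Fintype.card V * partitionFunction G q β),
    by positivity, ?_⟩
  rw [hG.sum_starTotal, internalEnergy_eq hq, lowerEnergy]
  field_simp

theorem upperEnergy_sub_internalEnergy [Nonempty V] (hG : Cubic G) (hq : 2 ≤ q) {β : ℝ}
    (hβ : 0 < β) : ∃ K : ℝ, 0 < K ∧ upperEnergy q β - internalEnergy G q β =
      K * ∑ u, ∑ v, if G.Adj u v then edgeTotal G q β u v else 0 := by
  obtain ⟨hl, hl1⟩ := exp_neg_mem hβ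
  have hZ := partitionFunction_pos (G := G) hq β
  have hn : (0 : ℝ) < Fintype.card V := Nat.cast_pos.2 Fintype.card_pos
  have hS := uA_add_four_mul_uC_pos hl hl1 hq
  rw [hG.sum_edgeTotal, internalEnergy_eq hq, upperEnergy]
  set S := uA q (Real.exp (-β)) + 4 * uC q (Real.exp (-β))
  refine ⟨1 / (2 * S * Fintype.card V * partitionFunction G q β), by positivity, ?_⟩
  field_simp

/-- Any two vertices with a common neighbour have the same neighbourhood. -/
def Twinned (G : SimpleGraph V) : Prop :=
  ∀ v u u', G.Adj v u → G.Adj v u' → ∀ w, G.Adj u w → G.Adj u' w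

/-- Adjacency is transitive between distinct vertices. -/
def Cluster (G : SimpleGraph V) : Prop :=
  ∀ u v, G.Adj u v → ∀ w, w ≠ u → G.Adj v w → G.Adj u w

theorem lowerEnergy_le [Nonempty V] (hG : Cubic G) (hq : 2 ≤ q) {β : ℝ} (hβ : 0 < β) :
    lowerEnergy q β ≤ internalEnergy G q β := by
  obtain ⟨K, hK, h⟩ := internalEnergy_sub_lowerEnergy hG hq hβ
  have : 0 ≤ K * ∑ v, starTotal G q β v :=
    mul_nonneg hK.le (Finset.sum_nonneg fun v _ => starTotal_nonneg hG hq hβ v)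
  linarith

theorem internalEnergy_eq_lowerEnergy_iff [Nonempty V] (hG : Cubic G) (hq : 2 ≤ q) {β : ℝ}
    (hβ : 0 < β) : internalEnergy G q β = lowerEnergy q β ↔ Twinned G := by
  obtain ⟨K, hK, h⟩ := internalEnergy_sub_lowerEnergy hG hq hβ
  rw [← sub_eq_zero, h, mul_eq_zero, or_iff_right hK.ne',
    Finset.sum_eq_zero_iff_of_nonneg fun v _ => starTotal_nonneg hG hq hβ v]
  simp only [Finset.mem_univ, true_implies, starTotal_eq_zero_iff hG hq hβ, Twinned]

theorem edgeTotal_ite_nonneg (hG : Cubic G) (hq : 2 ≤ q) {β : ℝ} (hβ : 0 < β) (u v : V) :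
    0 ≤ if G.Adj u v then edgeTotal G q β u v else 0 := by
  split_ifs with h
  · exact edgeTotal_nonneg hG hq hβ h
  · rfl

theorem le_upperEnergy [Nonempty V] (hG : Cubic G) (hq : 2 ≤ q) {β : ℝ} (hβ : 0 < β) :
    internalEnergy G q β ≤ upperEnergy q β := by
  obtain ⟨K, hK, h⟩ := upperEnergy_sub_internalEnergy hG hq hβ
  have : 0 ≤ K * ∑ u, ∑ v, if G.Adj u v then edgeTotal G q β u v else 0 :=
    mul_nonneg hK.le (Finset.sum_nonneg fun u _ => Finset.sum_nonneg fun v _ =>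
      edgeTotal_ite_nonneg hG hq hβ u v)
  linarith

theorem internalEnergy_eq_upperEnergy_iff [Nonempty V] (hG : Cubic G) (hq : 2 ≤ q) {β : ℝ}
    (hβ : 0 < β) : internalEnergy G q β = upperEnergy q β ↔ Cluster G := by
  obtain ⟨K, hK, h⟩ := upperEnergy_sub_internalEnergy hG hq hβ
  rw [eq_comm, ← sub_eq_zero, h, mul_eq_zero, or_iff_right hK.ne',
    Finset.sum_eq_zero_iff_of_nonneg fun u _ => Finset.sum_nonneg fun v _ =>
      edgeTotal_ite_nonneg hG hq hβ u v]
  simp only [Finset.mem_univ, true_implies, Cluster]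
  refine forall_congr' fun u => ?_
  rw [Finset.sum_eq_zero_iff_of_nonneg fun v _ => edgeTotal_ite_nonneg hG hq hβ u v]
  simp only [Finset.mem_univ, true_implies]
  refine forall_congr' fun v => ?_
  by_cases huv : G.Adj u v
  · simp only [huv, if_true, true_implies]
    exact edgeTotal_eq_zero_iff hG hq hβ huv
  · simp [huv]

/-! ### Free energy -/

theorem hasDerivAt_freeEnergy (hq : 2 ≤ q) (β : ℝ) :
    HasDerivAt (freeEnergy G q) (-internalEnergy G q β) β := by
  have h := (hasDerivAt_log_partitionFunction (G := G) hq β).const_mul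
    (1 / (Fintype.card V : ℝ))
  rw [internalEnergy, (hasDerivAt_log_partitionFunction (G := G) hq β).deriv]
  exact h.congr_deriv (by ring)

theorem freeEnergy_zero [Nonempty V] : freeEnergy G q 0 = Real.log q := by
  have hn : (Fintype.card V : ℝ) ≠ 0 := Nat.cast_ne_zero.2 Fintype.card_ne_zero
  rw [freeEnergy, partitionFunction_eq]
  simp [boltz, hn]

/-- The difference of the free energies vanishes at β = 0 and has derivative equal to the energy
gap. -/
theorem freeEnergy_le_of_internalEnergy_le {W : Type*} [Fintype W] [Nonempty V] [Nonempty W]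
    {H : SimpleGraph W} (hq : 2 ≤ q)
    (h : ∀ t, 0 < t → internalEnergy H q t ≤ internalEnergy G q t) {β : ℝ} (hβ : 0 < β) :
    freeEnergy G q β ≤ freeEnergy H q β := by
  have hd : ∀ t, HasDerivAt (fun t => freeEnergy H q t - freeEnergy G q t)
      (-internalEnergy H q t - -internalEnergy G q t) t := fun t =>
    (hasDerivAt_freeEnergy hq t).sub (hasDerivAt_freeEnergy hq t)
  have hm : MonotoneOn (fun t => freeEnergy H q t - freeEnergy G q t) (Set.Ici 0) := by
    refine monotoneOn_of_deriv_nonneg (convex_Ici 0)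
      (fun t _ => (hd t).continuousAt.continuousWithinAt)
      (fun t _ => (hd t).differentiableAt.differentiableWithinAt) fun t ht => ?_
    rw [interior_Ici] at ht
    rw [(hd t).deriv]
    linarith [h t ht]
  have := hm (Set.mem_Ici.2 le_rfl) (Set.mem_Ici.2 hβ.le) hβ.le
  simp only [freeEnergy_zero, sub_self] at this
  linarith

end Totals

/-! ### Disjoint unions -/

section Unions

variable {V W : Type*} {G : SimpleGraph V} {H : SimpleGraph W}

theorem mem_of_reachable {S : Set V} (hS : ∀ x ∈ S, ∀ y, G.Adj x y → y ∈ S) {v w : V}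
    (hv : v ∈ S) (h : G.Reachable v w) : w ∈ S := by
  obtain ⟨p⟩ := h
  induction p with
  | nil => exact hv
  | cons h _ ih => exact ih (hS _ hv _ h)

/-- Parametrizing every component by `H` and numbering the finitely many components gives the
isomorphism. -/
theorem isDisjointUnionOfCopies_of_components [Fintype V] (φ : G.ConnectedComponent → W → V)
    (hinj : ∀ c, Function.Injective (φ c))
    (hcomp : ∀ c w, G.connectedComponentMk (φ c w) = c)
    (hsurj : ∀ v, ∃ w, φ (G.connectedComponentMk v) w = v)
    (hadj : ∀ c w w', G.Adj (φ c w) (φ c w') ↔ H.Adj w w') : IsDisjointUnionOfCopies G H := by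
  have : Finite G.ConnectedComponent := Quot.finite _
  obtain ⟨n, ⟨e⟩⟩ := Finite.exists_equiv_fin G.ConnectedComponent
  have hf : Function.Bijective fun p : Fin n × W => φ (e.symm p.1) p.2 := by
    constructor
    · rintro ⟨i, w⟩ ⟨j, w'⟩ h
      have h1 := congrArg G.connectedComponentMk h
      simp only [hcomp, EmbeddingLike.apply_eq_iff_eq] at h1
      subst h1
      exact congrArg _ (hinj _ h)
    · intro v
      obtain ⟨w, hw⟩ := hsurj v
      exact ⟨(e (G.connectedComponentMk v), w), by simpa using hw⟩
  refine ⟨n, ⟨RelIso.symm ⟨Equiv.ofBijective _ hf, ?_⟩⟩⟩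
  rintro ⟨i, w⟩ ⟨j, w'⟩
  simp only [Equiv.ofBijective_apply, disjointCopies]
  constructor
  · intro h
    have h1 := SimpleGraph.ConnectedComponent.connectedComponentMk_eq_of_adj h
    simp only [hcomp, EmbeddingLike.apply_eq_iff_eq] at h1
    subst h1
    exact ⟨rfl, (hadj _ _ _).1 h⟩
  · rintro ⟨rfl, h⟩
    exact (hadj _ _ _).2 h

theorem isDisjointUnionOfCopies_of_maps [Fintype V]
    (h : ∀ v, ∃ φ : W → V, Function.Injective φ ∧ v ∈ Set.range φ ∧
      (∀ w, G.Reachable v (φ w)) ∧ (∀ w w', G.Adj (φ w) (φ w') ↔ H.Adj w w') ∧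
      ∀ w y, G.Adj (φ w) y → y ∈ Set.range φ) : IsDisjointUnionOfCopies G H := by
  choose φ hinj hmem hreach hadj hclosed using h
  refine isDisjointUnionOfCopies_of_components (fun c => φ c.out) (fun c => hinj _) ?_ ?_
    fun c => hadj _
  · intro c w
    refine Eq.trans ?_ c.out_eq
    exact SimpleGraph.ConnectedComponent.eq.2 (hreach _ w).symm
  · intro v
    have h1 : G.Reachable (G.connectedComponentMk v).out v :=
      SimpleGraph.ConnectedComponent.exact (Quot.out_eq (G.connectedComponentMk v))
    -- The range of the chosen copy contains the component's representative and is closed under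
    -- adjacency, so it contains the whole component.
    exact mem_of_reachable (S := Set.range (φ (G.connectedComponentMk v).out)) (by rintro _ ⟨w, rfl⟩ y hy; exact hclosed _ w y hy) (hmem _) h1

end Unions

/-! ### Cubic graphs attaining the bounds -/

section Characterizations

variable {V W : Type*} [Fintype V] [Fintype W] {G : SimpleGraph V} {H : SimpleGraph W}

theorem Twinned.of_isDisjointUnionOfCopies (hH : Twinned H) (h : IsDisjointUnionOfCopies G H) :
    Twinned G := by
  obtain ⟨n, ⟨e⟩⟩ := h
  intro v u u' hu hu' w hw
  rw [← e.map_adj_iff] at hu hu' hw ⊢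
  exact ⟨hu'.1.symm.trans (hu.1.trans hw.1), hH _ _ _ hu.2 hu'.2 _ hw.2⟩

theorem Cluster.of_isDisjointUnionOfCopies (hH : Cluster H) (h : IsDisjointUnionOfCopies G H) :
    Cluster G := by
  obtain ⟨n, ⟨e⟩⟩ := h
  intro u v hu w hne hw
  rw [← e.map_adj_iff] at hu hw ⊢
  have h1 : (e u).1 = (e w).1 := hu.1.trans hw.1
  refine ⟨h1, hH _ _ hu.2 _ (fun h2 => hne (e.injective (Prod.ext h1.symm h2))) hw.2⟩

/-- Transitivity makes v and its three neighbours pairwise adjacent, and this uses up all their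
degrees. -/
theorem Cluster.isDisjointUnionOfCopies (hG : Cubic G) (h : Cluster G) :
    IsDisjointUnionOfCopies G K4 := by
  refine isDisjointUnionOfCopies_of_maps fun v => ?_
  obtain ⟨a, b, c, hv⟩ := hG v
  have key : ∀ {a b c : V}, Nbrs G v a b c → Nbrs G a v b c := fun {a b c} k =>
    hG.nbrs k.adj₁.symm (h a v k.adj₁.symm b k.ab.symm k.adj₂)
      (h a v k.adj₁.symm c k.ac.symm k.adj₃) k.adj₂.ne k.adj₃.ne k.bc
  have ha := key hv
  have hb := key hv.swap₁₂
  have hc := key hv.rot.rot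
  have hinj : Function.Injective ![v, a, b, c] := by
    intro i j hij
    have h1 := hv.adj₁.ne
    have h2 := hv.adj₂.ne
    have h3 := hv.adj₃.ne
    have h4 := hv.ab
    have h5 := hv.ac
    have h6 := hv.bc
    fin_cases i <;> fin_cases j <;> simp_all
  refine ⟨![v, a, b, c], hinj, ⟨0, rfl⟩, ?_, ?_, ?_⟩
  · intro w
    fin_cases w
    · exact .refl _
    · exact hv.adj₁.reachable
    · exact hv.adj₂.reachable
    · exact hv.adj₃.reachable
  · intro w w'
    rw [SimpleGraph.top_adj]
    refine ⟨by rintro k rfl; exact G.irrefl k, fun k => ?_⟩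
    fin_cases w <;> fin_cases w' <;>
      simp_all [hv.adj, ha.adj, hb.adj, hc.adj]
  · intro w y hy
    simp only [Set.mem_range, Fin.exists_fin_succ, Matrix.cons_val_zero, Matrix.cons_val_succ]
    fin_cases w <;> simp_all [hv.adj, ha.adj, hb.adj, hc.adj, eq_comm] <;> tauto

/-- One side is the neighbourhood {a, b, c} of v, the other the neighbourhood {v, x, y} of a.
Twinning forces every vertex of one side to have the other side as its neighbourhood. -/
theorem Twinned.isDisjointUnionOfCopies (hG : Cubic G) (h : Twinned G) :
    IsDisjointUnionOfCopies G K33 := by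
  refine isDisjointUnionOfCopies_of_maps fun v => ?_
  obtain ⟨a, b, c, hv⟩ := hG v
  obtain ⟨x, y, ha⟩ := hG.exists_one hv.adj₁.symm
  have twin : ∀ {p p' k a b c}, G.Adj k p → G.Adj k p' → Nbrs G p a b c → Nbrs G p' a b c :=
    fun {p p' k a b c} h1 h2 hp => ⟨hp.ab, hp.ac, hp.bc, fun z => by
      rw [← hp.adj]; exact ⟨h _ _ _ h2 h1 z, h _ _ _ h1 h2 z⟩⟩
  have hb := twin hv.adj₁ hv.adj₂ ha
  have hc := twin hv.adj₁ hv.adj₃ ha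
  have hx := twin ha.adj₁ ha.adj₂ hv
  have hy := twin ha.adj₁ ha.adj₃ hv
  have inj3 : ∀ {p a b c : V}, Nbrs G p a b c → Function.Injective ![a, b, c] := by
    intro p a b c hp i j hij
    have h4 := hp.ab
    have h5 := hp.ac
    have h6 := hp.bc
    fin_cases i <;> fin_cases j <;> simp_all
  have hL : Function.Injective ![v, x, y] := inj3 ha
  have hR : Function.Injective ![a, b, c] := inj3 hv
  have hLR : ∀ i z, G.Adj (![v, x, y] i) z ↔ ∃ j, ![a, b, c] j = z := by
    intro i z
    simp only [Fin.exists_fin_succ, Matrix.cons_val_zero, Matrix.cons_val_succ]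
    fin_cases i <;> simp [hv.adj, hx.adj, hy.adj, eq_comm]
  have hRL : ∀ i z, G.Adj (![a, b, c] i) z ↔ ∃ j, ![v, x, y] j = z := by
    intro i z
    simp only [Fin.exists_fin_succ, Matrix.cons_val_zero, Matrix.cons_val_succ]
    fin_cases i <;> simp [ha.adj, hb.adj, hc.adj, eq_comm]
  have hadj : ∀ i j, G.Adj (![v, x, y] i) (![a, b, c] j) := fun i j => (hLR i _).2 ⟨j, rfl⟩
  refine ⟨Sum.elim ![v, x, y] ![a, b, c], hL.sumElim hR fun i j => (hadj i j).ne,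
    ⟨Sum.inl 0, rfl⟩, ?_, ?_, ?_⟩
  · rintro (i | j)
    · exact (hadj 0 0).reachable.trans (hadj i 0).symm.reachable
    · exact (hadj 0 j).reachable
  · rintro (i | i) (j | j)
    · simp only [Sum.elim_inl, hLR]
      refine ⟨?_, by simp⟩
      rintro ⟨k, hk⟩
      exact absurd hk (hadj j k).ne'
    · simpa using hadj i j
    · simpa using (hadj j i).symm
    · simp only [Sum.elim_inr, hRL]
      refine ⟨?_, by simp⟩
      rintro ⟨k, hk⟩
      exact absurd hk (hadj k j).ne
  · rintro (i | i) z hz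
    · obtain ⟨j, hj⟩ := (hLR i z).1 hz
      exact ⟨Sum.inr j, hj⟩
    · obtain ⟨j, hj⟩ := (hRL i z).1 hz
      exact ⟨Sum.inl j, hj⟩

theorem twinned_K33 : Twinned K33 := by
  rintro (v | v) (u | u) (u' | u') <;> simp

theorem cluster_K4 : Cluster K4 := by
  intro u v _ w hw _
  exact hw.symm

theorem cubic_K33 : Cubic K33 := by
  have h : ∀ x : Fin 3, x = 0 ∨ x = 1 ∨ x = 2 := by decide
  rintro (v | v)
  · exact ⟨Sum.inr 0, Sum.inr 1, Sum.inr 2, by simp, by simp, by simp,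
      by rintro (x | x) <;> simp [h]⟩
  · exact ⟨Sum.inl 0, Sum.inl 1, Sum.inl 2, by simp, by simp, by simp,
      by rintro (x | x) <;> simp [h]⟩

theorem cubic_K4 : Cubic K4 := by
  intro v
  have h : ∀ v : Fin 4, v + 1 ≠ v + 2 ∧ v + 1 ≠ v + 3 ∧ v + 2 ≠ v + 3 ∧
      ∀ x, v ≠ x ↔ x = v + 1 ∨ x = v + 2 ∨ x = v + 3 := by decide
  obtain ⟨h1, h2, h3, h4⟩ := h v
  exact ⟨_, _, _, h1, h2, h3, h4⟩

theorem cubic_of_isRegularOfDegree [G.LocallyFinite] (hG : G.IsRegularOfDegree 3) : Cubic G := by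
  classical
  intro v
  obtain ⟨a, b, c, hab, hac, hbc, h⟩ := Finset.card_eq_three.1 (hG v)
  refine ⟨a, b, c, hab, hac, hbc, fun x => ?_⟩
  rw [← SimpleGraph.mem_neighborFinset, h]
  simp

end Characterizations

end Potts

/-! ### The theorem -/

theorem theorem1 {V : Type*} [Fintype V] [Nonempty V] (G : SimpleGraph V) [G.LocallyFinite]
    (hG : G.IsRegularOfDegree 3) (q : ℕ) (hq : 2 ≤ q) (β : ℝ) (hβ : 0 < β) :
    (Potts.internalEnergy Potts.K33 q β ≤ Potts.internalEnergy G q β ∧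
      Potts.internalEnergy G q β ≤ Potts.internalEnergy Potts.K4 q β) ∧
    (Potts.internalEnergy G q β = Potts.internalEnergy Potts.K33 q β ↔
      Potts.IsDisjointUnionOfCopies G Potts.K33) ∧
    (Potts.internalEnergy G q β = Potts.internalEnergy Potts.K4 q β ↔
      Potts.IsDisjointUnionOfCopies G Potts.K4) ∧
    (Potts.freeEnergy Potts.K4 q β ≤ Potts.freeEnergy G q β ∧
      Potts.freeEnergy G q β ≤ Potts.freeEnergy Potts.K33 q β) := by
  have hC : Potts.Cubic G := Potts.cubic_of_isRegularOfDegree hG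
  -- The energies of the two extremal graphs are never computed: they follow from the equality case
  -- applied to the graphs themselves.
  have hlow : ∀ t, 0 < t → Potts.internalEnergy Potts.K33 q t = Potts.lowerEnergy q t := fun t ht =>
    (Potts.internalEnergy_eq_lowerEnergy_iff Potts.cubic_K33 hq ht).2 Potts.twinned_K33
  have hup : ∀ t, 0 < t → Potts.internalEnergy Potts.K4 q t = Potts.upperEnergy q t := fun t ht =>
    (Potts.internalEnergy_eq_upperEnergy_iff Potts.cubic_K4 hq ht).2 Potts.cluster_K4
  refine ⟨⟨?_, ?_⟩, ?_, ?_, ?_, ?_⟩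
  · exact (hlow β hβ).trans_le (Potts.lowerEnergy_le hC hq hβ)
  · exact (Potts.le_upperEnergy hC hq hβ).trans_eq (hup β hβ).symm
  · rw [hlow β hβ, Potts.internalEnergy_eq_lowerEnergy_iff hC hq hβ]
    exact ⟨fun h => h.isDisjointUnionOfCopies hC, Potts.twinned_K33.of_isDisjointUnionOfCopies⟩
  · rw [hup β hβ, Potts.internalEnergy_eq_upperEnergy_iff hC hq hβ]
    exact ⟨fun h => h.isDisjointUnionOfCopies hC, Potts.cluster_K4.of_isDisjointUnionOfCopies⟩
  · exact Potts.freeEnergy_le_of_internalEnergy_le hq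
      (fun t ht => (Potts.le_upperEnergy hC hq ht).trans_eq (hup t ht).symm) hβ
  · exact Potts.freeEnergy_le_of_internalEnergy_le hq
      (fun t ht => (hlow t ht).trans_le (Potts.lowerEnergy_le hC hq ht)) hβ
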